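/- For a Dirichlet polynomial $D(s)=\sum_{n} a_n n^{-s}$ (a finite sum, $a_n\in\mathbb{C}$) and $1\le r<\infty$ put \[ \|D\|_{\mathcal{H}_r} := \lim_{T\to\infty}\left(\frac{1}{2T}\int_{-T}^{T}|D(it)|^{r}\,dt\right)^{1/r}. \] This limit exists and defines a norm on the space of Dirichlet polynomials. The Hardy space $\mathcal{H}_r$ is the completion of this normed space, regarded as a space of Dirichlet series: $\sum_{n} a_n n^{-s}$ belongs to $\mathcal{H}_r$ if there is a sequence of Dirichlet polynomials that is Cauchy for $\|\cdot\|_{\mathcal{H}_r}$ and whose $n$-th coefficients converge to $a_n$ for every $n\ge 1$. A sequence $(\lambda_n)_{n\ge1}$ of real numbers is a multiplier from $\mathcal{H}_p$ to $\mathcal{H}_q$ if for every Dirichlet series $\sum_n a_n n^{-s}$ in $\mathcal{H}_p$ the series $\sum_n \lambda_n a_n n^{-s}$ belongs to $\mathcal{H}_q$. Theorem. Let $1\le p<q<\infty$ and let $(\lambda_n)_{n\ge 1}$ be a decreasing (not necessarily strictly) sequence of positive real numbers such that \[ \sum_{n\ge 3}\frac{\lambda_n}{n\log\log n}\left(\sqrt{\frac{q}{p}}+\varepsilon\right)^{\frac{\log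 n}{\log\log n}}<\infty \qquad\text{for some } \varepsilon>0. \] Then $(\lambda_n)_{n\ge1}$ is a multiplier from $\mathcal{H}_p$ to $\mathcal{H}_q$. -/

import Mathlib

open Filter Topology

/-- The value at `s` of the Dirichlet polynomial `∑ aₙ n⁻ˢ` (a finite sum) with coefficients `a`. -/
noncomputable def dirichletPoly (a : ℕ+ →₀ ℂ) (s : ℂ) : ℂ :=
  a.sum fun n c => c * ((n : ℕ) : ℂ) ^ (-s)

/-- The mean `((1 / 2T) ∫_{-T}^{T} |D(it)|^p dt)^{1/p}` of the Dirichlet polynomial `D`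
with coefficients `a`. -/
noncomputable def hardyMean (p : ℝ) (a : ℕ+ →₀ ℂ) (T : ℝ) : ℝ :=
  (1 / (2 * T) * ∫ t in (-T)..T, ‖dirichletPoly a (Complex.I * (t : ℂ))‖ ^ p) ^ (1 / p)

/-- The norm `‖D‖ = lim_{T → ∞} ((1 / 2T) ∫_{-T}^{T} |D(it)|^p dt)^{1/p}` of a Dirichlet polynomial.
The limit exists for every `p > 0`, see `tendsto_hardyMean` below. -/
noncomputable def hardyNorm (p : ℝ) (a : ℕ+ →₀ ℂ) : ℝ :=
  limUnder atTop (hardyMean p a)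

/-- The Dirichlet series `∑ aₙ n⁻ˢ` belongs to the Hardy space `ℋ_p`, the completion of the Dirichlet
polynomials for `hardyNorm p`: it is represented by a Cauchy sequence of Dirichlet polynomials, and
its coefficients are the limits of the coefficients of these polynomials. -/
def MemHardy (p : ℝ) (a : ℕ+ → ℂ) : Prop :=
  ∃ P : ℕ → (ℕ+ →₀ ℂ),
    (∀ δ > 0, ∃ N : ℕ, ∀ k ≥ N, ∀ l ≥ N, hardyNorm p (P k - P l) < δ) ∧
    ∀ n : ℕ+, Tendsto (fun k => P k n) atTop (𝓝 (a n))

/-- `(λₙ)` is a multiplier from `ℋ_p` to `ℋ_q`: if `∑ aₙ n⁻ˢ` is in `ℋ_p`, then `∑ λₙ aₙ n⁻ˢ`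
is in `ℋ_q`. -/
def IsHardyMultiplier (p q : ℝ) (lam : ℕ+ → ℝ) : Prop :=
  ∀ a : ℕ+ → ℂ, MemHardy p a → MemHardy q (fun n => (lam n : ℂ) * a n)

/-! The limit in `hardyNorm` exists: `|D(it)|^p` is a uniform limit of trigonometric polynomials. -/

/-- The character `t ↦ exp(iθt)` of the real line. -/
noncomputable def lineChar (θ : ℝ) : ℝ → ℂ := fun t => Complex.exp ((θ : ℂ) * Complex.I * (t : ℂ))

/-- The algebra of trigonometric polynomials (with real frequencies) on the real line. -/
noncomputable def trigAlg : Subalgebra ℂ (ℝ → ℂ) := Algebra.adjoin ℂ (Set.range lineChar)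

theorem exists_mean_lineChar (θ : ℝ) :
    ∃ L : ℂ, Tendsto (fun T : ℝ => ((1 / (2 * T) : ℝ) : ℂ) * ∫ t in (-T)..T, lineChar θ t)
      atTop (𝓝 L) := by
  by_cases h : θ = 0
  · refine ⟨1, tendsto_const_nhds.congr' ?_⟩
    filter_upwards [eventually_gt_atTop (0 : ℝ)] with T hT
    have hT' : (T : ℂ) ≠ 0 := by exact_mod_cast hT.ne'
    simp [lineChar, h]
    field_simp
    norm_num
  · refine ⟨0, ?_⟩
    have hc : (θ : ℂ) * Complex.I ≠ 0 := mul_ne_zero (by exact_mod_cast h) Complex.I_ne_zero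
    have hn : ∀ t : ℝ, ‖Complex.exp ((θ : ℂ) * Complex.I * (t : ℂ))‖ = 1 := by
      intro t
      have : (θ : ℂ) * Complex.I * (t : ℂ) = ((θ * t : ℝ) : ℂ) * Complex.I := by push_cast; ring
      rw [this, Complex.norm_exp_ofReal_mul_I]
    have hb : ∀ T : ℝ, ‖∫ t in (-T)..T, lineChar θ t‖ ≤ 2 / ‖(θ : ℂ) * Complex.I‖ := by
      intro T
      unfold lineChar
      rw [integral_exp_mul_complex hc, norm_div]
      gcongr
      refine (norm_sub_le _ _).trans ?_
      rw [hn, hn]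
      norm_num
    have hz : Tendsto (fun T : ℝ => 1 / (2 * T) * (2 / ‖(θ : ℂ) * Complex.I‖)) atTop (𝓝 0) := by
      have h1 : Tendsto (fun T : ℝ => 2 * T) atTop atTop :=
        tendsto_id.const_mul_atTop (by norm_num)
      simpa using (h1.inv_tendsto_atTop).mul_const (2 / ‖(θ : ℂ) * Complex.I‖)
    refine squeeze_zero_norm' ?_ hz
    filter_upwards [eventually_gt_atTop (0 : ℝ)] with T hT
    rw [norm_mul, Complex.norm_real, Real.norm_of_nonneg (by positivity)]
    gcongr
    exact hb T

theorem lineChar_continuous (θ : ℝ) : Continuous (lineChar θ) := by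
  unfold lineChar
  fun_prop

theorem exists_mean_of_mem_trigAlg {f : ℝ → ℂ} (hf : f ∈ trigAlg) :
    Continuous f ∧ ∃ L : ℂ, Tendsto (fun T : ℝ => ((1 / (2 * T) : ℝ) : ℂ) * ∫ t in (-T)..T, f t)
      atTop (𝓝 L) := by
  have hcl : ((Submonoid.closure (Set.range lineChar) : Submonoid (ℝ → ℂ)) : Set (ℝ → ℂ))
      ⊆ Set.range lineChar := by
    intro g hg
    induction hg using Submonoid.closure_induction with
    | mem x hx => exact hx
    | one => exact ⟨0, by funext t; simp [lineChar]⟩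
    | mul x y _ _ hx hy =>
      obtain ⟨a, rfl⟩ := hx
      obtain ⟨b, rfl⟩ := hy
      refine ⟨a + b, ?_⟩
      funext t
      simp only [lineChar, Pi.mul_apply]
      rw [← Complex.exp_add]
      congr 1
      push_cast
      ring
  have hspan : f ∈ Submodule.span ℂ (Set.range lineChar) := by
    have h1 : f ∈ Subalgebra.toSubmodule (Algebra.adjoin ℂ (Set.range lineChar)) := hf
    rw [Algebra.adjoin_eq_span] at h1
    exact Submodule.span_mono hcl h1
  clear hf hcl
  induction hspan using Submodule.span_induction with
  | mem x hx =>
    obtain ⟨θ, rfl⟩ := hx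
    exact ⟨lineChar_continuous θ, exists_mean_lineChar θ⟩
  | zero => exact ⟨continuous_const, 0, by simp⟩
  | add x y _ _ hx hy =>
    obtain ⟨cx, L, hL⟩ := hx
    obtain ⟨cy, M, hM⟩ := hy
    refine ⟨cx.add cy, L + M, (hL.add hM).congr fun T => ?_⟩
    simp only [Pi.add_apply]
    rw [intervalIntegral.integral_add (cx.intervalIntegrable _ _) (cy.intervalIntegrable _ _)]
    ring
  | smul c x _ hx =>
    obtain ⟨cx, L, hL⟩ := hx
    refine ⟨cx.const_smul c, c * L, (hL.const_mul c).congr fun T => ?_⟩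
    simp only [Pi.smul_apply, smul_eq_mul]
    rw [intervalIntegral.integral_const_mul]
    ring

theorem exists_mean_of_approx {f : ℝ → ℝ} (hf : Continuous f)
    (happ : ∀ δ > 0, ∃ g ∈ trigAlg, ∀ t, ‖(f t : ℂ) - g t‖ ≤ δ) :
    ∃ L : ℝ, Tendsto (fun T : ℝ => 1 / (2 * T) * ∫ t in (-T)..T, f t) atTop (𝓝 L) := by
  set m : ℝ → ℝ := fun T => 1 / (2 * T) * ∫ t in (-T)..T, f t with hm
  have key : Cauchy (map m atTop) := by
    rw [Metric.cauchy_iff]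
    refine ⟨inferInstance, fun δ hδ => ?_⟩
    obtain ⟨g, hg, hfg⟩ := happ (δ / 8) (by positivity)
    obtain ⟨cg, L, hL⟩ := exists_mean_of_mem_trigAlg hg
    refine ⟨Metric.ball L.re (δ / 2), ?_, ?_⟩
    · rw [mem_map]
      have h1 := (Metric.tendsto_nhds.1 hL) (δ / 4) (by positivity)
      filter_upwards [h1, eventually_gt_atTop (0 : ℝ)] with T hT hT0
      have hfc : Continuous fun t => (f t : ℂ) := Complex.continuous_ofReal.comp hf
      have e1 : ‖((m T : ℝ) : ℂ) - ((1 / (2 * T) : ℝ) : ℂ) * ∫ t in (-T)..T, g t‖ ≤ δ / 8 := by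
        have : ((m T : ℝ) : ℂ) - ((1 / (2 * T) : ℝ) : ℂ) * ∫ t in (-T)..T, g t
            = ((1 / (2 * T) : ℝ) : ℂ) * ∫ t in (-T)..T, ((f t : ℂ) - g t) := by
          rw [intervalIntegral.integral_sub (hfc.intervalIntegrable _ _)
            (cg.intervalIntegrable _ _), intervalIntegral.integral_ofReal, hm]
          push_cast
          ring
        rw [this, norm_mul, Complex.norm_real, Real.norm_of_nonneg (by positivity)]
        have h2 : ‖∫ t in (-T)..T, ((f t : ℂ) - g t)‖ ≤ δ / 8 * |T - (-T)| :=
          intervalIntegral.norm_integral_le_of_norm_le_const fun t _ => hfg t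
        rw [abs_of_pos (by linarith)] at h2
        calc _ ≤ 1 / (2 * T) * (δ / 8 * (T - (-T))) := by gcongr
          _ = δ / 8 := by field_simp; ring
      rw [dist_eq_norm] at hT
      have e2 : ‖((m T : ℝ) : ℂ) - L‖ < δ / 2 := by
        have := norm_sub_le_norm_sub_add_norm_sub ((m T : ℝ) : ℂ)
          (((1 / (2 * T) : ℝ) : ℂ) * ∫ t in (-T)..T, g t) L
        linarith
      have e3 := (Complex.abs_re_le_norm (((m T : ℝ) : ℂ) - L)).trans_lt e2
      rw [Complex.sub_re, Complex.ofReal_re] at e3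
      simpa [Real.dist_eq] using e3
    · intro x hx y hy
      rw [Metric.mem_ball] at hx hy
      have := dist_triangle_right x y L.re
      linarith
  obtain ⟨L, hL⟩ := CompleteSpace.complete key
  exact ⟨L, hL⟩

theorem dirichletPoly_mem_trigAlg (a : ℕ+ →₀ ℂ) :
    (fun t : ℝ => dirichletPoly a (Complex.I * (t : ℂ))) ∈ trigAlg ∧
      (fun t : ℝ => (starRingEnd ℂ) (dirichletPoly a (Complex.I * (t : ℂ)))) ∈ trigAlg := by
  have hpow : ∀ (n : ℕ+) (t : ℝ),
      ((n : ℕ) : ℂ) ^ (-(Complex.I * (t : ℂ))) = lineChar (-Real.log n) t := by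
    intro n t
    have hn : ((n : ℕ) : ℂ) ≠ 0 := by exact_mod_cast n.ne_zero
    rw [Complex.cpow_def_of_ne_zero hn, lineChar, ← Complex.natCast_log]
    congr 1
    push_cast
    ring
  have hconj : ∀ (θ t : ℝ), (starRingEnd ℂ) (lineChar θ t) = lineChar (-θ) t := by
    intro θ t
    simp only [lineChar]
    rw [← Complex.exp_conj]
    simp
  have hmem : ∀ θ, lineChar θ ∈ trigAlg := fun θ => Algebra.subset_adjoin ⟨θ, rfl⟩
  constructor
  · have : (fun t : ℝ => dirichletPoly a (Complex.I * (t : ℂ)))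
        = ∑ n ∈ a.support, a n • lineChar (-Real.log n) := by
      funext t
      simp [dirichletPoly, Finsupp.sum, hpow]
    rw [this]
    exact sum_mem fun n _ => trigAlg.smul_mem (hmem _) _
  · have : (fun t : ℝ => (starRingEnd ℂ) (dirichletPoly a (Complex.I * (t : ℂ))))
        = ∑ n ∈ a.support, (starRingEnd ℂ) (a n) • lineChar (Real.log n) := by
      funext t
      simp [dirichletPoly, Finsupp.sum, hpow, hconj]
    rw [this]
    exact sum_mem fun n _ => trigAlg.smul_mem (hmem _) _

/-- The limit that defines `hardyNorm` exists. -/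
theorem tendsto_hardyMean {p : ℝ} (hp : 0 < p) (a : ℕ+ →₀ ℂ) :
    Tendsto (hardyMean p a) atTop (𝓝 (hardyNorm p a)) := by
  obtain ⟨hD, hDc⟩ := dirichletPoly_mem_trigAlg a
  set D : ℝ → ℂ := fun t => dirichletPoly a (Complex.I * (t : ℂ)) with hDdef
  have cD : Continuous D := (exists_mean_of_mem_trigAlg hD).1
  obtain ⟨R, hR⟩ : ∃ R : ℝ, ∀ t, ‖D t‖ ≤ R := by
    refine ⟨∑ n ∈ a.support, ‖a n‖, fun t => ?_⟩
    refine (norm_sum_le _ _).trans (Finset.sum_le_sum fun n _ => ?_)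
    rw [norm_mul, Complex.norm_natCast_cpow_of_pos n.pos]
    simp
  have hmean : ∃ L : ℝ, Tendsto (fun T : ℝ => 1 / (2 * T) * ∫ t in (-T)..T, ‖D t‖ ^ p)
      atTop (𝓝 L) := by
    refine exists_mean_of_approx (cD.norm.rpow_const fun _ => Or.inr hp.le) fun δ hδ => ?_
    have hc : ContinuousOn (fun u : ℝ => u ^ (p / 2)) (Set.Icc 0 (R ^ 2)) :=
      (Real.continuous_rpow_const (by positivity)).continuousOn
    obtain ⟨Q, hQ⟩ := exists_polynomial_near_of_continuousOn 0 (R ^ 2) _ hc δ hδ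
    set u : ℝ → ℂ := fun t => D t * (starRingEnd ℂ) (D t) with hu
    have hu_mem : u ∈ trigAlg := trigAlg.mul_mem hD hDc
    have hu_eq : ∀ t, u t = ((‖D t‖ ^ 2 : ℝ) : ℂ) := by
      intro t
      rw [hu]
      simp only
      rw [Complex.mul_conj, Complex.normSq_eq_norm_sq]
    refine ⟨Polynomial.aeval u (Q.map (algebraMap ℝ ℂ)), ?_, fun t => ?_⟩
    · rw [Polynomial.aeval_eq_sum_range]
      exact sum_mem fun i _ => trigAlg.smul_mem (pow_mem hu_mem i) _
    · have h1 : (Polynomial.aeval u (Q.map (algebraMap ℝ ℂ))) t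
          = ((Q.eval (‖D t‖ ^ 2) : ℝ) : ℂ) := by
        have h2 := Polynomial.aeval_algHom_apply (Pi.evalAlgHom ℂ (fun _ : ℝ => ℂ) t) u
          (Q.map (algebraMap ℝ ℂ))
        simp only [Pi.evalAlgHom_apply] at h2
        rw [← h2, hu_eq]
        rw [Polynomial.aeval_map_algebraMap, Polynomial.aeval_eq_sum_range,
          Polynomial.eval_eq_sum_range]
        simp
      have hmem : ‖D t‖ ^ 2 ∈ Set.Icc (0 : ℝ) (R ^ 2) :=
        ⟨by positivity, pow_le_pow_left₀ (norm_nonneg _) (hR t) 2⟩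
      have h3 := hQ _ hmem
      have h4 : (‖D t‖ ^ 2) ^ (p / 2) = ‖D t‖ ^ p := by
        rw [← Real.rpow_natCast, ← Real.rpow_mul (norm_nonneg _)]
        congr 1
        push_cast
        ring
      simp only [h4] at h3
      rw [h1, ← Complex.ofReal_sub, Complex.norm_real, Real.norm_eq_abs, abs_sub_comm]
      exact h3.le
  obtain ⟨L, hL⟩ := hmean
  exact tendsto_nhds_limUnder ⟨L ^ (1 / p), hL.rpow_const (Or.inr (by positivity))⟩

/-! Summation by parts writes the multiplier as `∑ (λ_m - λ_{m+1}) S_m` with `S_m` the partial sum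
operator. It is enough to bound `S_m` from `ℋ_p` to `ℋ_q` on Dirichlet polynomials by about `K ^
(log m / log log m) / log log m` with `K = √(q/p) + ε`; monotonicity of `λ` and dyadic condensation
then produce exactly the series of the hypothesis.

The bound for `S_m` combines two facts. On `ℋ_p` the norm of `S_m` is `O(log m)`: an integer-valued
completely additive weight close to a multiple of `log n` separates `n ≤ m` from `n > m`, so `S_m`
is an average of twists over roots of unity against a Dirichlet kernel (`hardyNorm_partialSum_le`).
To pass from `ℋ_p` to `ℋ_q`, one uses that multiplication of the coefficients by `√(p/q) ^ Ω(n)` is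
a contraction (`hardyNorm_weissler`), which costs `√(q/p) ^ J` up to a factor `J + 1` if every term
has at most `J` prime factors. Primes below `Y = (log n) ^ θ` are split off beforehand at the price
of a power of `log n` each, so that only prime factors `≥ Y` count and `J` is about `log n / (θ log
log n)`, with `θ < 1` close to `1`.

The contraction is Weissler's inequality on the disc, carried to many variables by Minkowski's
inequality (`weissler_lmarginal`) and to Dirichlet series by the Bohr correspondence
(`hardyNorm_eq_integral`). On the disc, reflecting the zeros reduces it to `f = exp P`. There the
norm is followed along radii and exponents with (exponent) · (radius)² constant. Its monotonicity
follows from a Poincaré inequality for `U` under the density `exp U` on the circle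
(`circ_exp_poincare`), which in turn comes from a cubic inequality for functions of mean zero proved
by Fourier series. -/

open MeasureTheory Polynomial
open scoped ENNReal

/-! ### Fourier series on the circle and a cubic inequality for functions of mean zero. -/

/-- The uniform probability measure on the interval `(0, 2π]`. -/
noncomputable def circ : Measure ℝ :=
  ENNReal.ofReal (2 * Real.pi)⁻¹ • volume.restrict (Set.Ioc 0 (2 * Real.pi))

theorem integral_circ {E : Type*} [NormedAddCommGroup E] [NormedSpace ℝ E] (f : ℝ → E) :
    ∫ θ, f θ ∂circ = (2 * Real.pi)⁻¹ • ∫ θ in (0 : ℝ)..(2 * Real.pi), f θ := by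
  rw [circ, integral_smul_measure, intervalIntegral.integral_of_le (by positivity),
    ENNReal.toReal_ofReal (by positivity)]

instance isProbabilityMeasure_circ : IsProbabilityMeasure circ := by
  refine ⟨?_⟩
  rw [circ, Measure.smul_apply, Measure.restrict_apply MeasurableSet.univ, Set.univ_inter,
    Real.volume_Ioc, sub_zero, smul_eq_mul, ← ENNReal.ofReal_mul (by positivity),
    inv_mul_cancel₀ (by positivity), ENNReal.ofReal_one]

theorem Continuous.integrable_circ {E : Type*} [NormedAddCommGroup E] {f : ℝ → E}
    (hf : Continuous f) : Integrable f circ := by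
  rw [circ]
  refine Integrable.smul_measure ?_ ENNReal.ofReal_ne_top
  exact (hf.integrableOn_Icc (a := 0) (b := 2 * Real.pi)).mono_set Set.Ioc_subset_Icc_self

theorem integral_circ_deriv_eq_zero {f f' : ℝ → ℝ} (hf : ∀ x, HasDerivAt f (f' x) x)
    (hf' : Continuous f') (hper : f (2 * Real.pi) = f 0) : ∫ θ, f' θ ∂circ = 0 := by
  rw [integral_circ, intervalIntegral.integral_eq_sub_of_hasDerivAt (fun x _ => hf x)
    (hf'.intervalIntegrable _ _), hper]
  simp

/-- Fourier coefficients with respect to `circ`. -/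
noncomputable def circCoeff (f : ℝ → ℂ) (n : ℤ) : ℂ :=
  ∫ θ, Complex.exp (-(n * θ * Complex.I)) * f θ ∂circ

theorem fourierCoeffOn_eq_circCoeff (h : (0 : ℝ) < 2 * Real.pi) (f : ℝ → ℂ) (n : ℤ) :
    fourierCoeffOn h f n = circCoeff f n := by
  rw [fourierCoeffOn_eq_integral, circCoeff, integral_circ, sub_zero, one_div]
  congr 1
  refine intervalIntegral.integral_congr fun x _ => ?_
  simp only [smul_eq_mul]
  rw [fourier_coe_apply]
  congr 2
  have : (Real.pi : ℂ) ≠ 0 := by exact_mod_cast Real.pi_ne_zero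
  push_cast
  field_simp

theorem hasSum_sq_circCoeff {f : ℝ → ℂ} (hf : Continuous f) :
    HasSum (fun n => ‖circCoeff f n‖ ^ 2) (∫ θ, ‖f θ‖ ^ 2 ∂circ) := by
  have h : (0 : ℝ) < 2 * Real.pi := by positivity
  have hL : MemLp f 2 (volume.restrict (Set.Ioc 0 (2 * Real.pi))) := by
    refine (memLp_two_iff_integrable_sq_norm hf.aestronglyMeasurable).2 ?_
    exact ((hf.norm.pow 2).integrableOn_Icc).mono_set Set.Ioc_subset_Icc_self
  have := hasSum_sq_fourierCoeffOn h hL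
  simp_rw [fourierCoeffOn_eq_circCoeff] at this
  rw [sub_zero] at this
  rwa [integral_circ]

theorem circCoeff_deriv {f f' : ℝ → ℂ} (hf : ∀ x, HasDerivAt f (f' x) x)
    (hf' : Continuous f') (hper : f (2 * Real.pi) = f 0) (n : ℤ) :
    circCoeff f' n = n * Complex.I * circCoeff f n := by
  have h : (0 : ℝ) < 2 * Real.pi := by positivity
  rcases eq_or_ne n 0 with rfl | hn
  · simp only [circCoeff, Int.cast_zero, zero_mul, neg_zero, Complex.exp_zero, one_mul]
    rw [integral_circ, intervalIntegral.integral_eq_sub_of_hasDerivAt (fun x _ => hf x)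
      (hf'.intervalIntegrable _ _), hper]
    simp
  · have h1 := fourierCoeffOn_of_hasDerivAt h hn (fun x _ => hf x) (hf'.intervalIntegrable _ _)
    rw [fourierCoeffOn_eq_circCoeff, fourierCoeffOn_eq_circCoeff, hper] at h1
    have hpi : (Real.pi : ℂ) ≠ 0 := by exact_mod_cast Real.pi_ne_zero
    have hn' : (n : ℂ) ≠ 0 := by exact_mod_cast hn
    rw [h1]
    push_cast
    field_simp
    ring

/-- The higher harmonics satisfy a Wirtinger inequality with a larger constant. -/
theorem circ_wirtinger {f f' : ℝ → ℝ} (hf : ∀ x, HasDerivAt f (f' x) x)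
    (hf' : Continuous f') (hper : f (2 * Real.pi) = f 0) (h0 : ∫ θ, f θ ∂circ = 0) :
    3 * (∫ θ, f θ ^ 2 ∂circ - 2 * ((∫ θ, Real.cos θ * f θ ∂circ) ^ 2
      + (∫ θ, Real.sin θ * f θ ∂circ) ^ 2)) ≤ ∫ θ, f' θ ^ 2 ∂circ - ∫ θ, f θ ^ 2 ∂circ := by
  have cf : Continuous f := continuous_iff_continuousAt.2 fun x => (hf x).continuousAt
  set F : ℝ → ℂ := fun x => (f x : ℂ)
  set F' : ℝ → ℂ := fun x => (f' x : ℂ)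
  have cF : Continuous F := Complex.continuous_ofReal.comp cf
  have cF' : Continuous F' := Complex.continuous_ofReal.comp hf'
  have hF : ∀ x, HasDerivAt F (F' x) x := fun x => (hf x).ofReal_comp
  have hFper : F (2 * Real.pi) = F 0 := by simp [F, hper]
  have s1 := hasSum_sq_circCoeff cF
  have s2 := hasSum_sq_circCoeff cF'
  simp only [circCoeff_deriv hF cF' hFper] at s2
  have e1 : ∫ θ, ‖F θ‖ ^ 2 ∂circ = ∫ θ, f θ ^ 2 ∂circ := by simp [F]
  have e2 : ∫ θ, ‖F' θ‖ ^ 2 ∂circ = ∫ θ, f' θ ^ 2 ∂circ := by simp [F']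
  rw [e1] at s1
  rw [e2] at s2
  have c0 : circCoeff F 0 = 0 := by
    simp only [circCoeff, Int.cast_zero, zero_mul, neg_zero, Complex.exp_zero, one_mul, F]
    rw [integral_complex_ofReal, h0]
    simp
  -- `s = ±1` is the frequency as a real number; both coefficients of the first harmonic have the
  -- same modulus because `f` is real.
  have hc : ∀ s : ℝ, s ^ 2 = 1 → ∀ n : ℤ, (n : ℝ) = s → ‖circCoeff F n‖ ^ 2 =
      (∫ θ, Real.cos θ * f θ ∂circ) ^ 2 + (∫ θ, Real.sin θ * f θ ∂circ) ^ 2 := by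
    intro s hs n hn
    have h1 : circCoeff F n = ((∫ θ, Real.cos θ * f θ ∂circ : ℝ) : ℂ)
        - s * ((∫ θ, Real.sin θ * f θ ∂circ : ℝ) : ℂ) * Complex.I := by
      have hn' : (n : ℂ) = (s : ℂ) := by rw [← hn]; simp
      rw [circCoeff, hn', ← integral_complex_ofReal, ← integral_complex_ofReal,
        ← integral_const_mul, ← integral_mul_const, ← integral_sub]
      · refine integral_congr_ae (Eventually.of_forall fun θ => ?_)
        have h2 : Complex.exp (-((s : ℂ) * θ * Complex.I))
            = Real.cos θ - s * Real.sin θ * Complex.I := by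
          have : -((s : ℂ) * θ * Complex.I) = ((-(s * θ) : ℝ) : ℂ) * Complex.I := by
            push_cast; ring
          rw [this, Complex.exp_mul_I, ← Complex.ofReal_cos, ← Complex.ofReal_sin]
          have hs' : s = 1 ∨ s = -1 := by
            rwa [sq, mul_self_eq_one_iff] at hs
          rcases hs' with rfl | rfl
          · simp; ring
          · simp
        simp only [h2, F]
        push_cast
        ring
      · exact Continuous.integrable_circ (by fun_prop)
      · exact Continuous.integrable_circ (by fun_prop)
    rw [h1, ← Complex.normSq_eq_norm_sq, Complex.normSq_apply]
    simp
    linear_combination (∫ θ, Real.sin θ * f θ ∂circ) ^ 2 * hs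
  have p1 := hc 1 (by norm_num) 1 (by norm_num)
  have m1 := hc (-1) (by norm_num) (-1) (by norm_num)
  set A := (∫ θ, Real.cos θ * f θ ∂circ) ^ 2 + (∫ θ, Real.sin θ * f θ ∂circ) ^ 2
  have s3 : HasSum (fun n : ℤ => if n = 1 ∨ n = -1 then A else 0) (2 * A) := by
    have : HasSum (fun n : ℤ => if n = 1 ∨ n = -1 then A else 0)
        (∑ n ∈ ({1, -1} : Finset ℤ), if n = 1 ∨ n = -1 then A else 0) :=
      hasSum_sum_of_ne_finset_zero (by intro b hb; simp at hb; simp [hb])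
    convert! this using 1
    rw [Finset.sum_pair (by norm_num)]
    simp
    ring
  have := hasSum_le ?_ ((s1.sub s3).mul_left 3) (s2.sub s1)
  · exact this
  · intro n
    simp only [norm_mul, Complex.norm_intCast, Complex.norm_I, mul_one, mul_pow, sq_abs]
    split_ifs with h
    · rcases h with rfl | rfl
      · rw [p1]; simp
      · rw [m1]; simp
    · rcases eq_or_ne n 0 with rfl | hn
      · simp [c0]
      -- The remaining frequencies have `|n| ≥ 2`, so `n² - 1 ≥ 3`.
      · have : (4 : ℝ) ≤ (n : ℝ) ^ 2 := by
          have : (2 : ℤ) ^ 2 ≤ n ^ 2 := sq_le_sq.2 (by grind)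
          exact_mod_cast this
        nlinarith [sq_nonneg ‖circCoeff F n‖]

theorem circ_cauchy_schwarz {f g : ℝ → ℝ} (hf : Continuous f) (hg : Continuous g) :
    (∫ θ, f θ * g θ ∂circ) ^ 2 ≤ (∫ θ, f θ ^ 2 ∂circ) * ∫ θ, g θ ^ 2 ∂circ := by
  have h : ∀ x : ℝ, 0 ≤ (∫ θ, g θ ^ 2 ∂circ) * (x * x) + (2 * ∫ θ, f θ * g θ ∂circ) * x
      + ∫ θ, f θ ^ 2 ∂circ := by
    intro x
    have h1 : 0 ≤ ∫ θ, (f θ + x * g θ) ^ 2 ∂circ := integral_nonneg fun θ => sq_nonneg _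
    have h2 : ∫ θ, (f θ + x * g θ) ^ 2 ∂circ = (∫ θ, f θ ^ 2 ∂circ)
        + (2 * x) * (∫ θ, f θ * g θ ∂circ) + x ^ 2 * ∫ θ, g θ ^ 2 ∂circ := by
      rw [← integral_const_mul, ← integral_const_mul, ← integral_add, ← integral_add]
      · exact integral_congr_ae (Eventually.of_forall fun θ => by ring)
      all_goals exact Continuous.integrable_circ (by fun_prop)
    rw [h2] at h1
    linarith
  have := discrim_le_zero h
  rw [discrim] at this
  linarith

/-- Integrating `f'` against the sawtooth `y - x ± π`, which jumps at `x`, gives `2π f(x)`, because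
`f` has mean zero and equal values at the endpoints. Cauchy-Schwarz with the square integral `2π³/3`
of the sawtooth yields the constant. -/
theorem circ_sup_bound {f f' : ℝ → ℝ} (hf : ∀ x, HasDerivAt f (f' x) x)
    (hf' : Continuous f') (hper : f (2 * Real.pi) = f 0) (h0 : ∫ θ, f θ ∂circ = 0) {x : ℝ}
    (hx : x ∈ Set.Icc 0 (2 * Real.pi)) : f x ^ 2 ≤ Real.pi ^ 2 / 3 * ∫ θ, f' θ ^ 2 ∂circ := by
  have cf : Continuous f := continuous_iff_continuousAt.2 fun x => (hf x).continuousAt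
  have hpi := Real.pi_pos
  rw [integral_circ, smul_eq_mul, mul_eq_zero] at h0
  replace h0 := h0.resolve_left (by positivity)
  rw [integral_circ, smul_eq_mul]
  set I := ∫ θ in (0 : ℝ)..(2 * Real.pi), f' θ ^ 2
  have hi : ∀ {g : ℝ → ℝ} {a b : ℝ}, Continuous g → IntervalIntegrable g volume a b :=
    fun hg => hg.intervalIntegrable _ _
  have hparts : ∀ a b c : ℝ, ∫ y in a..b, (y - x + c) * f' y
      = (b - x + c) * f b - (a - x + c) * f a - ∫ y in a..b, f y := by
    intro a b c
    have := intervalIntegral.integral_mul_deriv_eq_deriv_mul (a := a) (b := b)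
      (u := fun y => y - x + c) (u' := fun _ => 1) (v := f) (v' := f')
      (fun y _ => by simpa using ((hasDerivAt_id y).sub_const x).add_const c)
      (fun y _ => hf y) (hi continuous_const) (hi hf')
    simpa using this
  have hsq : ∀ a b c : ℝ, ∫ y in a..b, (y - x + c) ^ 2
      = ((b - x + c) ^ 3 - (a - x + c) ^ 3) / 3 := by
    intro a b c
    rw [intervalIntegral.integral_eq_sub_of_hasDerivAt (f := fun y => (y - x + c) ^ 3 / 3)]
    · ring
    · intro y _
      have := ((((hasDerivAt_id y).sub_const x).add_const c).pow 3).div_const 3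
      convert! this using 1
      simp
    · exact hi (by fun_prop)
  have hexp : ∀ τ a b c : ℝ, ∫ y in a..b, (f' y - τ * (y - x + c)) ^ 2
      = (∫ y in a..b, f' y ^ 2) - 2 * τ * (∫ y in a..b, (y - x + c) * f' y)
        + τ ^ 2 * ∫ y in a..b, (y - x + c) ^ 2 := by
    intro τ a b c
    rw [← intervalIntegral.integral_const_mul, ← intervalIntegral.integral_const_mul,
      ← intervalIntegral.integral_sub, ← intervalIntegral.integral_add]
    · exact intervalIntegral.integral_congr fun y _ => by ring
    all_goals exact hi (by fun_prop)
  -- Cauchy-Schwarz in the form `∫ (f' - τ · sawtooth)² ≥ 0`, computed on both sides of the jump;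
  -- the boundary terms at `0` and `2π` cancel by periodicity.
  have key : ∀ τ : ℝ, 0 ≤ I - 2 * τ * (2 * Real.pi * f x) + τ ^ 2 * (2 * Real.pi ^ 3 / 3) := by
    intro τ
    have h1 : 0 ≤ ∫ y in (0 : ℝ)..x, (f' y - τ * (y - x + Real.pi)) ^ 2 :=
      intervalIntegral.integral_nonneg hx.1 fun y _ => sq_nonneg _
    have h2 : 0 ≤ ∫ y in x..(2 * Real.pi), (f' y - τ * (y - x + -Real.pi)) ^ 2 :=
      intervalIntegral.integral_nonneg hx.2 fun y _ => sq_nonneg _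
    rw [hexp, hparts, hsq] at h1 h2
    have h3 : (∫ y in (0 : ℝ)..x, f' y ^ 2) + ∫ y in x..(2 * Real.pi), f' y ^ 2 = I :=
      intervalIntegral.integral_add_adjacent_intervals (hi (by fun_prop)) (hi (by fun_prop))
    have h4 : (∫ y in (0 : ℝ)..x, f y) + ∫ y in x..(2 * Real.pi), f y = 0 := by
      exact (intervalIntegral.integral_add_adjacent_intervals (hi cf) (hi cf)).trans h0
    rw [hper] at h2
    have h5 := add_nonneg h1 h2
    refine h5.trans_eq ?_
    linear_combination h3 + 2 * τ * h4
  -- The value of `τ` that minimises the quadratic.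
  have := key (3 * f x / Real.pi ^ 2)
  have e : I - 2 * (3 * f x / Real.pi ^ 2) * (2 * Real.pi * f x)
      + (3 * f x / Real.pi ^ 2) ^ 2 * (2 * Real.pi ^ 3 / 3) = I - 6 * f x ^ 2 / Real.pi := by
    field_simp
    ring
  rw [e, sub_nonneg, div_le_iff₀ hpi] at this
  calc f x ^ 2 ≤ I * Real.pi / 6 := by linarith
    _ = _ := by field_simp; ring

theorem ae_circ_mem : ∀ᵐ θ ∂circ, θ ∈ Set.Icc 0 (2 * Real.pi) := by
  rw [circ]
  refine Measure.ae_smul_measure ?_ _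
  filter_upwards [ae_restrict_mem measurableSet_Ioc] with θ hθ using Set.Ioc_subset_Icc_self hθ

/-- Here `w` is the energy of the first harmonic, `G` that of the higher ones, `D` the Dirichlet
energy and `k` the cubic integral. With `σ² = w + G` and `d² = D - σ²` the spectral gap gives `G ≤
d²/3`, and this forces `k ≤ d (3σ² + d²)`. Since `2σ² + D = 3σ² + d²`, the claim is then `(2ad -
(3σ² + d²))² ≥ 0`. -/
theorem cubic_form_bound {w G D k a : ℝ} (hw : 0 ≤ w) (hG : 0 ≤ G) (ha : 0 ≤ a)
    (hD : 3 * G ≤ D - (w + G))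
    (hk : k ≤ 3 * (w * √G) + (2 * √(2 * w) + √(3.29 * D)) * G) :
    4 * a * k ≤ (2 * (w + G) + D) ^ 2 + 4 * a ^ 2 * (D - (w + G)) := by
  set s2 := w + G with hs2
  set d := √(D - s2) with hd
  have hd0 : 0 ≤ d := Real.sqrt_nonneg _
  have hd2 : d ^ 2 = D - s2 := Real.sq_sqrt (by linarith)
  set g := √G
  have hg0 : 0 ≤ g := Real.sqrt_nonneg _
  have hg2 : g ^ 2 = G := Real.sq_sqrt hG
  set σ := √s2
  have hσ0 : 0 ≤ σ := Real.sqrt_nonneg _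
  have hσ2 : σ ^ 2 = s2 := Real.sq_sqrt (by linarith)
  set S := √(3.29 * D)
  have hS0 : 0 ≤ S := Real.sqrt_nonneg _
  have hS2 : S ^ 2 = 3.29 * D := Real.sq_sqrt (by nlinarith)
  -- The decimals `0.5774` and `1.4143` are `1/√3` and `√2` rounded up; there is enough slack in
  -- `t6` to afford it.
  have hgd : g ≤ 0.5774 * d := abs_le_of_sq_le_sq' (by nlinarith) (by positivity) |>.2
  have hGd : G ≤ d ^ 2 / 3 := by linarith
  have hsw : √(2 * w) ≤ 1.4143 * σ := by
    rw [Real.sqrt_le_left (by positivity)]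
    nlinarith
  have t1 : w * √G ≤ σ ^ 2 * (0.5774 * d) := by
    apply mul_le_mul _ hgd hg0 (by positivity)
    linarith
  have t2 : √(2 * w) * G ≤ 1.4143 * σ * (d ^ 2 / 3) :=
    mul_le_mul hsw hGd hG (by positivity)
  have t3 : S * G ≤ S * (d ^ 2 / 3) := by gcongr
  have t4 : S * d ≤ 0.91 * (σ ^ 2 + d ^ 2) + 0.91 * d ^ 2 := by
    nlinarith [sq_nonneg (S - 1.82 * d)]
  have hk' : k ≤ d * (3 * σ ^ 2 + d ^ 2) := by
    have t5 : S * (d ^ 2 / 3) ≤ d * (0.91 * (σ ^ 2 + d ^ 2) + 0.91 * d ^ 2) / 3 := by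
      nlinarith
    have t6 : σ ^ 2 * 1.7322 + 0.94287 * (σ * d) + (0.91 * (σ ^ 2 + d ^ 2) + 0.91 * d ^ 2) / 3
      ≤ 3 * σ ^ 2 + d ^ 2 := by nlinarith [sq_nonneg (σ - d), sq_nonneg σ, sq_nonneg d]
    have t7 := mul_le_mul_of_nonneg_left t6 hd0
    nlinarith
  have hD' : D = d ^ 2 + σ ^ 2 := by linarith
  calc 4 * a * k ≤ 4 * a * (d * (3 * σ ^ 2 + d ^ 2)) := by gcongr
    _ ≤ (2 * σ ^ 2 + D) ^ 2 + 4 * a ^ 2 * d ^ 2 := by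
      rw [hD']
      nlinarith [sq_nonneg (2 * a * d - (3 * σ ^ 2 + d ^ 2))]
    _ = _ := by rw [hσ2, hd2]

/-- Split `f = f1 + g` with `f1` the first harmonic. The difference of the two energies vanishes on
`f1`, so it controls only `g`. This suffices because `f1 ^ 3` has mean zero: every surviving term of
`∫ f³` contains `g`. -/
theorem circ_cubic_bound {f f' : ℝ → ℝ} (hf : ∀ x, HasDerivAt f (f' x) x)
    (hf' : Continuous f') (hper : f (2 * Real.pi) = f 0) (h0 : ∫ θ, f θ ∂circ = 0)
    {a : ℝ} (ha : 0 ≤ a) :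
    4 * a * ∫ θ, f θ ^ 3 ∂circ ≤ (2 * ∫ θ, f θ ^ 2 ∂circ + ∫ θ, f' θ ^ 2 ∂circ) ^ 2
      + 4 * a ^ 2 * (∫ θ, f' θ ^ 2 ∂circ - ∫ θ, f θ ^ 2 ∂circ) := by
  have cf : Continuous f := continuous_iff_continuousAt.2 fun x => (hf x).continuousAt
  have hw := circ_wirtinger hf hf' hper h0
  have hsup := fun {x} => circ_sup_bound (x := x) hf hf' hper h0
  set Ac := ∫ θ, Real.cos θ * f θ ∂circ with hAc
  set As := ∫ θ, Real.sin θ * f θ ∂circ with hAs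
  set s2 := ∫ θ, f θ ^ 2 ∂circ with hs2
  set D := ∫ θ, f' θ ^ 2 ∂circ with hDdef
  set w := 2 * (Ac ^ 2 + As ^ 2) with hwdef
  set f1 : ℝ → ℝ := fun θ => 2 * (Ac * Real.cos θ + As * Real.sin θ) with hf1
  set g : ℝ → ℝ := fun θ => f θ - f1 θ with hg
  have cf1 : Continuous f1 := by fun_prop
  have cg : Continuous g := by fun_prop
  have hz : ∀ {F F' : ℝ → ℝ}, (∀ x, HasDerivAt F (F' x) x) → Continuous F' →
    F (2 * Real.pi) = F 0 → ∫ θ, F' θ ∂circ = 0 := integral_circ_deriv_eq_zero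
  have E1 : ∫ θ, f1 θ ∂circ = 0 := by
    refine hz (F := fun θ => 2 * (Ac * Real.sin θ + As * -Real.cos θ)) (fun x => ?_) cf1 (by simp)
    have := (((Real.hasDerivAt_sin x).const_mul Ac).add
      ((Real.hasDerivAt_cos x).neg.const_mul As)).const_mul 2
    convert! this using 1
    simp [hf1]
  have E2 : ∫ θ, (f1 θ ^ 2 - w) ∂circ = 0 := by
    refine hz (F := fun θ => 2 * ((Ac ^ 2 - As ^ 2) * (Real.sin θ * Real.cos θ)
      + 2 * Ac * As * Real.sin θ ^ 2)) (fun x => ?_) (by fun_prop) (by simp)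
    have := ((((Real.hasDerivAt_sin x).mul (Real.hasDerivAt_cos x)).const_mul (Ac ^ 2 - As ^ 2)).add
      (((Real.hasDerivAt_sin x).pow 2).const_mul (2 * Ac * As))).const_mul 2
    convert! this using 1
    simp only [hf1, hwdef]
    push_cast
    linear_combination (2 * Ac ^ 2 + 2 * As ^ 2) * Real.sin_sq_add_cos_sq x
  have E3 : ∫ θ, f1 θ ^ 3 ∂circ = 0 := by
    refine hz (F := fun θ => 8 * (Ac ^ 3 * (Real.sin θ - Real.sin θ ^ 3 / 3)
      - Ac ^ 2 * As * Real.cos θ ^ 3 + Ac * As ^ 2 * Real.sin θ ^ 3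
      + As ^ 3 * (Real.cos θ ^ 3 / 3 - Real.cos θ))) (fun x => ?_) (by fun_prop) (by simp)
    have hs := Real.hasDerivAt_sin x
    have hc := Real.hasDerivAt_cos x
    have := ((((((hs.sub ((hs.pow 3).div_const 3)).const_mul (Ac ^ 3)).sub
      ((hc.pow 3).const_mul (Ac ^ 2 * As))).add ((hs.pow 3).const_mul (Ac * As ^ 2))).add
      ((((hc.pow 3).div_const 3).sub hc).const_mul (As ^ 3)))).const_mul 8
    convert! this using 1
    simp only [hf1]
    push_cast
    linear_combination (8 * (Ac ^ 3 * Real.cos x + As ^ 3 * Real.sin x))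
      * Real.sin_sq_add_cos_sq x
  have E4 : ∫ θ, f θ * f1 θ ∂circ = w := by
    have : ∀ θ, f θ * f1 θ = 2 * Ac * (Real.cos θ * f θ) + 2 * As * (Real.sin θ * f θ) := by
      intro θ; simp only [hf1]; ring
    simp_rw [this]
    rw [integral_add, integral_const_mul, integral_const_mul, ← hAc, ← hAs, hwdef]
    · ring
    all_goals exact Continuous.integrable_circ (by fun_prop)
  have E2' : ∫ θ, f1 θ ^ 2 ∂circ = w := by
    rw [integral_sub (Continuous.integrable_circ (by fun_prop)) (integrable_const _)] at E2
    simp at E2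
    linarith
  set G := ∫ θ, g θ ^ 2 ∂circ with hG
  have E5 : s2 = w + G := by
    have : ∫ θ, g θ ^ 2 ∂circ = s2 - 2 * (∫ θ, f θ * f1 θ ∂circ) + ∫ θ, f1 θ ^ 2 ∂circ := by
      rw [hs2, ← integral_const_mul, ← integral_sub, ← integral_add]
      · exact integral_congr_ae (Eventually.of_forall fun θ => by simp only [hg]; ring)
      all_goals exact Continuous.integrable_circ (by fun_prop)
    rw [hG, this, E4, E2']
    ring
  have hG0 : 0 ≤ G := integral_nonneg fun θ => sq_nonneg _
  have hw0 : 0 ≤ w := by positivity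
  have hf1sq : ∀ θ, f1 θ ^ 2 ≤ 2 * w := by
    intro θ
    simp only [hf1, hwdef]
    nlinarith [sq_nonneg (Ac * Real.sin θ - As * Real.cos θ), Real.sin_sq_add_cos_sq θ]
  have h1 : ∫ θ, (f1 θ ^ 2 - w) * g θ ∂circ ≤ w * √G := by
    have hcs := circ_cauchy_schwarz (f := fun θ => f1 θ ^ 2 - w) (by fun_prop) cg
    -- Pointwise, since `0 ≤ f1² ≤ 2w`.
    have hle : ∫ θ, (f1 θ ^ 2 - w) ^ 2 ∂circ ≤ w ^ 2 := by
      have := integral_mono (μ := circ) (f := fun θ => (f1 θ ^ 2 - w) ^ 2) (g := fun _ => w ^ 2)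
        (Continuous.integrable_circ (by fun_prop)) (integrable_const _)
        (fun θ => by
          have := hf1sq θ
          have := sq_nonneg (f1 θ)
          simp only
          nlinarith)
      simpa using this
    refine abs_le_of_sq_le_sq' (hcs.trans ?_) (by positivity) |>.2
    rw [mul_pow, Real.sq_sqrt hG0]
    gcongr
  have hk : ∫ θ, f θ ^ 3 ∂circ ≤ 3 * (w * √G) + (2 * √(2 * w) + √(3.29 * D)) * G := by
    -- Expansion of `(f1 + g)³` with `3 f1 + g = 2 f1 + f`. The constant `w` can be subtracted from
    -- `f1²` because `g` has mean zero.
    have e : ∫ θ, f θ ^ 3 ∂circ = ∫ θ, f1 θ ^ 3 ∂circ + 3 * ∫ θ, (f1 θ ^ 2 - w) * g θ ∂circ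
        + 3 * w * (∫ θ, f θ ∂circ - ∫ θ, f1 θ ∂circ)
        + ∫ θ, (2 * f1 θ + f θ) * g θ ^ 2 ∂circ := by
      rw [← integral_const_mul, ← integral_sub, ← integral_const_mul, ← integral_add,
        ← integral_add, ← integral_add]
      · exact integral_congr_ae (Eventually.of_forall fun θ => by simp only [hg]; ring)
      all_goals exact Continuous.integrable_circ (by fun_prop)
    rw [e, E3, h0, E1]
    have h2 : ∫ θ, (2 * f1 θ + f θ) * g θ ^ 2 ∂circ ≤ (2 * √(2 * w) + √(3.29 * D)) * G := by
      rw [hG, ← integral_const_mul]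
      refine integral_mono_ae (Continuous.integrable_circ (by fun_prop))
        (Continuous.integrable_circ (by fun_prop)) ?_
      filter_upwards [ae_circ_mem] with θ hθ
      have b1 : f1 θ ≤ √(2 * w) := Real.le_sqrt_of_sq_le (hf1sq θ)
      -- `3.29` exceeds `π²/3`, the constant of the sup bound.
      have b2 : f θ ≤ √(3.29 * D) := by
        refine Real.le_sqrt_of_sq_le ((hsup hθ).trans ?_)
        have hD0 : 0 ≤ D := integral_nonneg fun θ => sq_nonneg _
        have := Real.pi_lt_d4
        have := Real.pi_pos
        gcongr
        nlinarith
      gcongr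
    linarith
  rw [E5]
  refine cubic_form_bound hw0 hG0 ha ?_ hk
  linarith

/-! ### The Poincaré inequality with density `exp U`. -/

/-- This is `|x| ≤ |sinh x|` at `x = w/2`. It trades the logarithm `U = 2 log v` for a polynomial
expression in `v`. -/
theorem sq_le_exp_sub_one_sq_mul (w : ℝ) : w ^ 2 ≤ (Real.exp w - 1) ^ 2 * Real.exp (-w) := by
  have h1 : |w / 2| ≤ |Real.sinh (w / 2)| := by
    rcases le_total 0 (w / 2) with h | h
    · rw [abs_of_nonneg h, abs_of_nonneg (Real.sinh_nonneg_iff.2 h)]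
      exact Real.self_le_sinh_iff.2 h
    · rw [abs_of_nonpos h, abs_of_nonpos (Real.sinh_nonpos_iff.2 h)]
      exact neg_le_neg (Real.sinh_le_self_iff.2 h)
  have h2 := sq_le_sq.2 h1
  have h3 : (Real.exp w - 1) ^ 2 * Real.exp (-w) = 4 * Real.sinh (w / 2) ^ 2 := by
    rw [Real.sinh_eq]
    have e1 : Real.exp w = Real.exp (w / 2) ^ 2 := by rw [← Real.exp_nat_mul]; congr 1; push_cast; ring
    have e2 : Real.exp (-w) = Real.exp (-(w / 2)) ^ 2 := by
      rw [← Real.exp_nat_mul]; congr 1; push_cast; ring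
    have e3 : Real.exp (w / 2) * Real.exp (-(w / 2)) = 1 := by rw [← Real.exp_add]; simp
    rw [e1, e2]
    linear_combination (Real.exp (w / 2) ^ 2 * (Real.exp (w / 2) * Real.exp (-(w / 2)) + 1)
      - 2 * (Real.exp (w / 2) * Real.exp (-(w / 2)) + 1) + 2) * e3
  rw [h3]
  linarith

/-- A Poincaré inequality for a function `U` with respect to the measure with density `exp U`. -/
theorem circ_exp_poincare {U U' : ℝ → ℝ} (hU : ∀ x, HasDerivAt U (U' x) x)
    (hU' : Continuous U') (hper : U (2 * Real.pi) = U 0) :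
    (∫ θ, Real.exp (U θ) ∂circ) * (∫ θ, Real.exp (U θ) * U θ ^ 2 ∂circ)
        - (∫ θ, Real.exp (U θ) * U θ ∂circ) ^ 2
      ≤ (∫ θ, Real.exp (U θ) ∂circ) * ∫ θ, Real.exp (U θ) * U' θ ^ 2 ∂circ := by
  have cU : Continuous U := continuous_iff_continuousAt.2 fun x => (hU x).continuousAt
  set v : ℝ → ℝ := fun θ => Real.exp (U θ / 2) with hv
  set v' : ℝ → ℝ := fun θ => Real.exp (U θ / 2) * (U' θ / 2) with hv'
  have cv : Continuous v := by fun_prop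
  have cv' : Continuous v' := by fun_prop
  have vpos : ∀ θ, 0 < v θ := fun θ => Real.exp_pos _
  have vsq : ∀ θ, v θ ^ 2 = Real.exp (U θ) := fun θ => by
    rw [hv, ← Real.exp_nat_mul]; congr 1; push_cast; ring
  set a := ∫ θ, v θ ∂circ with ha
  have apos : 0 < a := by
    refine (integral_pos_iff_support_of_nonneg (fun θ => (vpos θ).le) cv.integrable_circ).2 ?_
    have : Function.support v = Set.univ := Set.eq_univ_of_forall fun θ => (vpos θ).ne'
    simp [this]
  have key := circ_cubic_bound (f := fun θ => v θ - a) (f' := v') (a := a)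
    (fun x => by simpa using ((hU x).div_const 2).exp.sub_const a) cv' (by simp [hv, hper])
    (by rw [integral_sub cv.integrable_circ (integrable_const _)]; simp [ha]) apos.le
  set M := ∫ θ, v θ ^ 2 ∂circ with hM
  set C := ∫ θ, v θ ^ 3 ∂circ with hC
  set D := ∫ θ, v' θ ^ 2 ∂circ with hD
  have hD0 : 0 ≤ D := integral_nonneg fun θ => sq_nonneg _
  have hM0 : 0 ≤ M := integral_nonneg fun θ => sq_nonneg _
  have e2 : ∫ θ, (v θ - a) ^ 2 ∂circ = M - a ^ 2 := by
    have : ∫ θ, (v θ - a) ^ 2 ∂circ = M - 2 * a * (∫ θ, v θ ∂circ) + ∫ _, a ^ 2 ∂circ := by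
      rw [hM, ← integral_const_mul, ← integral_sub, ← integral_add]
      · exact integral_congr_ae (Eventually.of_forall fun θ => by ring)
      all_goals exact Continuous.integrable_circ (by fun_prop)
    rw [this, ← ha]; simp; ring
  have e3 : ∫ θ, (v θ - a) ^ 3 ∂circ = C - 3 * a * M + 2 * a ^ 3 := by
    have : ∫ θ, (v θ - a) ^ 3 ∂circ = C - 3 * a * M + 3 * a ^ 2 * (∫ θ, v θ ∂circ)
        - ∫ _, a ^ 3 ∂circ := by
      rw [hM, hC, ← integral_const_mul (3 * a), ← integral_const_mul (3 * a ^ 2), ← integral_sub,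
        ← integral_add, ← integral_sub]
      · exact integral_congr_ae (Eventually.of_forall fun θ => by ring)
      all_goals exact Continuous.integrable_circ (by fun_prop)
    rw [this, ← ha]; simp; ring
  rw [e2, e3] at key
  -- The terms in `a² M` and `a⁴` cancel exactly, which explains the shape of the cubic inequality.
  have key' : 4 * a * C ≤ (2 * M + D) ^ 2 := by nlinarith
  -- With this `c` one has `C ≤ a c²`, hence `∫ v (v - c)² ≤ c D`.
  set c := (2 * M + D) / (2 * a) with hc
  have M_pos : 0 < M := by
    have := circ_cauchy_schwarz (f := v) (g := fun _ => 1) cv continuous_const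
    simp only [mul_one] at this
    rw [← ha, ← hM] at this
    simp at this
    nlinarith
  have cpos : 0 < c := by positivity
  have hcub : C - 2 * c * M + c ^ 2 * a ≤ c * D := by
    have hca : 2 * M + D = 2 * a * c := by rw [hc]; field_simp
    have : C ≤ a * c ^ 2 := by
      rw [hca] at key'
      have : 4 * a * C ≤ 4 * a * (a * c ^ 2) := by linarith
      exact le_of_mul_le_mul_left this (by positivity)
    nlinarith
  -- The variance is at most the second moment about any point; about `b` the `sinh` estimate
  -- applies with `w = U/2 - log c`.
  set b := 2 * Real.log c with hb
  have hvar : ∫ θ, Real.exp (U θ) * (U θ - b) ^ 2 ∂circ ≤ ∫ θ, Real.exp (U θ) * U' θ ^ 2 ∂circ := by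
    have h1 : ∫ θ, Real.exp (U θ) * (U θ - b) ^ 2 ∂circ
        ≤ ∫ θ, 4 / c * (v θ ^ 3 - 2 * c * v θ ^ 2 + c ^ 2 * v θ) ∂circ := by
      refine integral_mono (Continuous.integrable_circ (by fun_prop))
        (Continuous.integrable_circ (by fun_prop)) fun θ => ?_
      have := sq_le_exp_sub_one_sq_mul (U θ / 2 - Real.log c)
      have e4 : Real.exp (U θ / 2 - Real.log c) = v θ / c := by
        rw [Real.exp_sub, Real.exp_log cpos]
      have e5 : Real.exp (-(U θ / 2 - Real.log c)) = c / v θ := by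
        rw [Real.exp_neg, e4, inv_div]
      rw [e4, e5] at this
      have hvp := vpos θ
      simp only
      rw [← vsq]
      calc v θ ^ 2 * (U θ - b) ^ 2 = 4 * v θ ^ 2 * (U θ / 2 - Real.log c) ^ 2 := by rw [hb]; ring
        _ ≤ 4 * v θ ^ 2 * ((v θ / c - 1) ^ 2 * (c / v θ)) := by gcongr
        _ = _ := by field_simp; ring
    have h2 : ∫ θ, 4 / c * (v θ ^ 3 - 2 * c * v θ ^ 2 + c ^ 2 * v θ) ∂circ
        = 4 / c * (C - 2 * c * M + c ^ 2 * a) := by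
      rw [integral_const_mul, integral_add, integral_sub, integral_const_mul, integral_const_mul]
      all_goals exact Continuous.integrable_circ (by fun_prop)
    have h3 : ∫ θ, Real.exp (U θ) * U' θ ^ 2 ∂circ = 4 * D := by
      rw [hD, ← integral_const_mul]
      refine integral_congr_ae (Eventually.of_forall fun θ => ?_)
      simp only [← vsq, hv']
      ring
    rw [h3]
    refine (h1.trans_eq h2).trans ?_
    calc 4 / c * (C - 2 * c * M + c ^ 2 * a) ≤ 4 / c * (c * D) := by gcongr
      _ = 4 * D := by field_simp
  have e6 : ∫ θ, Real.exp (U θ) * (U θ - b) ^ 2 ∂circ = (∫ θ, Real.exp (U θ) * U θ ^ 2 ∂circ)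
      - 2 * b * (∫ θ, Real.exp (U θ) * U θ ∂circ) + b ^ 2 * ∫ θ, Real.exp (U θ) ∂circ := by
    rw [← integral_const_mul, ← integral_const_mul, ← integral_sub, ← integral_add]
    · exact integral_congr_ae (Eventually.of_forall fun θ => by ring)
    all_goals exact Continuous.integrable_circ (by fun_prop)
  have e7 : ∫ θ, Real.exp (U θ) ∂circ = M := by rw [hM]; simp_rw [vsq]
  rw [e7] at e6 ⊢
  rw [e6] at hvar
  have := mul_le_mul_of_nonneg_left hvar hM0
  nlinarith [sq_nonneg (b * M - ∫ θ, Real.exp (U θ) * U θ ∂circ)]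

/-! ### Monotonicity of the norms of `exp P` along the flow of radii and exponents. -/

theorem hasDerivAt_integral_circ {F F' : ℝ → ℝ → ℝ} (hF : Continuous (Function.uncurry F))
    (hF' : Continuous (Function.uncurry F'))
    (hd : ∀ r θ, HasDerivAt (fun r => F r θ) (F' r θ) r) (r : ℝ) :
    HasDerivAt (fun r => ∫ θ, F r θ ∂circ) (∫ θ, F' r θ ∂circ) r := by
  have hK : IsCompact (Metric.closedBall r 1 ×ˢ Set.Icc (0 : ℝ) (2 * Real.pi)) :=
    (isCompact_closedBall r 1).prod isCompact_Icc
  obtain ⟨B, hB⟩ := hK.exists_bound_of_continuousOn hF'.continuousOn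
  have c1 : ∀ r, Continuous (F r) := fun r => hF.comp (by fun_prop : Continuous fun θ => (r, θ))
  have c2 : ∀ r, Continuous (F' r) := fun r => hF'.comp (by fun_prop : Continuous fun θ => (r, θ))
  refine (hasDerivAt_integral_of_dominated_loc_of_deriv_le (bound := fun _ => B)
    (Metric.closedBall_mem_nhds r one_pos)
    (Eventually.of_forall fun r => (c1 r).aestronglyMeasurable) (c1 r).integrable_circ
    (c2 r).aestronglyMeasurable ?_ (integrable_const _)
    (Eventually.of_forall fun θ r _ => hd r θ)).2
  filter_upwards [ae_circ_mem] with θ hθ r' hr'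
  exact hB (r', θ) ⟨hr', hθ⟩

/-- The point `r exp(iθ)`. -/
noncomputable def polarPt (r θ : ℝ) : ℂ := r * Complex.exp (θ * Complex.I)

theorem continuous_polarPt : Continuous (Function.uncurry polarPt) := by
  unfold polarPt Function.uncurry
  fun_prop

theorem polarPt_two_pi (r : ℝ) : polarPt r (2 * Real.pi) = polarPt r 0 := by
  simp [polarPt]

theorem hasDerivAt_polarPt_left (r θ : ℝ) :
    HasDerivAt (fun r => polarPt r θ) (Complex.exp (θ * Complex.I)) r := by
  have := ((hasDerivAt_id r).ofReal_comp).mul_const (Complex.exp (θ * Complex.I))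
  simpa [polarPt] using this

theorem hasDerivAt_polarPt_right (r θ : ℝ) :
    HasDerivAt (fun θ => polarPt r θ) (Complex.I * polarPt r θ) θ := by
  have := ((((hasDerivAt_id θ).ofReal_comp).mul_const Complex.I).cexp).const_mul (r : ℂ)
  convert! this using 1
  simp only [polarPt]
  push_cast
  simp
  ring

/-- The real part of `P` in polar coordinates. -/
noncomputable def polRe (P : ℂ[X]) (r θ : ℝ) : ℝ := (P.eval (polarPt r θ)).re

/-- The imaginary part of `P` in polar coordinates. -/
noncomputable def polIm (P : ℂ[X]) (r θ : ℝ) : ℝ := (P.eval (polarPt r θ)).im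

/-- The radial derivative of `polRe P`. -/
noncomputable def polReDeriv (P : ℂ[X]) (r θ : ℝ) : ℝ :=
  ((derivative P).eval (polarPt r θ) * Complex.exp (θ * Complex.I)).re

@[fun_prop]
theorem continuous_polRe (P : ℂ[X]) : Continuous (Function.uncurry (polRe P)) :=
  Complex.continuous_re.comp (P.continuous.comp continuous_polarPt)

@[fun_prop]
theorem continuous_polIm (P : ℂ[X]) : Continuous (Function.uncurry (polIm P)) :=
  Complex.continuous_im.comp (P.continuous.comp continuous_polarPt)

@[fun_prop]
theorem continuous_polReDeriv (P : ℂ[X]) : Continuous (Function.uncurry (polReDeriv P)) :=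
  Complex.continuous_re.comp ((P.derivative.continuous.comp continuous_polarPt).mul
    (by fun_prop))

theorem hasDerivAt_polRe_left (P : ℂ[X]) (r θ : ℝ) :
    HasDerivAt (fun r => polRe P r θ) (polReDeriv P r θ) r := by
  have h := (P.hasDerivAt (polarPt r θ)).comp r (hasDerivAt_polarPt_left r θ)
  exact Complex.reCLM.hasFDerivAt.comp_hasDerivAt r h

theorem mul_polReDeriv (P : ℂ[X]) (r θ : ℝ) :
    r * polReDeriv P r θ = polRe (X * derivative P) r θ := by
  rw [polReDeriv, polRe, ← Complex.re_ofReal_mul, eval_mul, eval_X, polarPt]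
  congr 1
  ring

theorem hasDerivAt_polRe_right (P : ℂ[X]) (r θ : ℝ) :
    HasDerivAt (fun θ => polRe P r θ) (-polIm (X * derivative P) r θ) θ := by
  have h := (P.hasDerivAt (polarPt r θ)).comp θ (hasDerivAt_polarPt_right r θ)
  have := Complex.reCLM.hasFDerivAt.comp_hasDerivAt θ h
  convert! this using 1
  simp [polIm]
  ring

theorem hasDerivAt_polIm_right (P : ℂ[X]) (r θ : ℝ) :
    HasDerivAt (fun θ => polIm P r θ) (polRe (X * derivative P) r θ) θ := by
  have h := (P.hasDerivAt (polarPt r θ)).comp θ (hasDerivAt_polarPt_right r θ)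
  have := Complex.imCLM.hasFDerivAt.comp_hasDerivAt θ h
  convert! this using 1
  simp [polRe]
  ring

@[fun_prop]
theorem continuous_polRe_right (P : ℂ[X]) (r : ℝ) : Continuous (polRe P r) :=
  (continuous_polRe P).comp (by fun_prop : Continuous fun θ => (r, θ))

@[fun_prop]
theorem continuous_polIm_right (P : ℂ[X]) (r : ℝ) : Continuous (polIm P r) :=
  (continuous_polIm P).comp (by fun_prop : Continuous fun θ => (r, θ))

theorem integral_exp_polRe_pos (P : ℂ[X]) (r : ℝ) : 0 < ∫ θ, Real.exp (polRe P r θ) ∂circ := by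
  have c : Continuous fun θ => Real.exp (polRe P r θ) := by fun_prop
  refine (integral_pos_iff_support_of_nonneg (fun θ => (Real.exp_pos _).le) c.integrable_circ).2 ?_
  have : Function.support (fun θ => Real.exp (polRe P r θ)) = Set.univ :=
    Set.eq_univ_of_forall fun θ => (Real.exp_pos _).ne'
  simp [this]

/-- Integration by parts in `θ`: by the Cauchy-Riemann equations the two integrands differ by the
angular derivative of `exp(Re P) · Im(zP')`, a periodic function. -/
theorem integral_exp_mul_polRe_theta (P : ℂ[X]) (r : ℝ) :
    ∫ θ, Real.exp (polRe P r θ) * polRe (X * derivative (X * derivative P)) r θ ∂circ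
      = ∫ θ, Real.exp (polRe P r θ) * polIm (X * derivative P) r θ ^ 2 ∂circ := by
  rw [← sub_eq_zero, ← integral_sub]
  · refine integral_circ_deriv_eq_zero
      (f := fun θ => Real.exp (polRe P r θ) * polIm (X * derivative P) r θ) (fun θ => ?_)
      (by fun_prop) ?_
    · have := (hasDerivAt_polRe_right P r θ).exp.mul (hasDerivAt_polIm_right (X * derivative P) r θ)
      convert! this using 1
      ring
    · simp [polRe, polIm, polarPt_two_pi]
  all_goals exact Continuous.integrable_circ (by fun_prop)

/-- The entropy functional whose sign controls the monotonicity of the norms along the flow. -/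
noncomputable def flowGap (P : ℂ[X]) (r : ℝ) : ℝ :=
  (2 * (∫ θ, Real.exp (polRe P r θ) * polRe P r θ ∂circ)
    - ∫ θ, Real.exp (polRe P r θ) * polRe (X * derivative P) r θ ∂circ)
    / (∫ θ, Real.exp (polRe P r θ) ∂circ) - 2 * Real.log (∫ θ, Real.exp (polRe P r θ) ∂circ)

theorem hasDerivAt_integral_exp_polRe (P : ℂ[X]) (r : ℝ) :
    HasDerivAt (fun r => ∫ θ, Real.exp (polRe P r θ) ∂circ)
      (∫ θ, Real.exp (polRe P r θ) * polReDeriv P r θ ∂circ) r :=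
  hasDerivAt_integral_circ (F := fun r θ => Real.exp (polRe P r θ))
    (F' := fun r θ => Real.exp (polRe P r θ) * polReDeriv P r θ)
    (Real.continuous_exp.comp (continuous_polRe P))
    ((Real.continuous_exp.comp (continuous_polRe P)).mul (continuous_polReDeriv P))
    (fun r θ => (hasDerivAt_polRe_left P r θ).exp) r

theorem hasDerivAt_integral_exp_mul_polRe (P Q : ℂ[X]) (r : ℝ) :
    HasDerivAt (fun r => ∫ θ, Real.exp (polRe P r θ) * polRe Q r θ ∂circ)
      (∫ θ, (Real.exp (polRe P r θ) * polReDeriv P r θ * polRe Q r θ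
        + Real.exp (polRe P r θ) * polReDeriv Q r θ) ∂circ) r :=
  hasDerivAt_integral_circ (F := fun r θ => Real.exp (polRe P r θ) * polRe Q r θ)
    (F' := fun r θ => Real.exp (polRe P r θ) * polReDeriv P r θ * polRe Q r θ
        + Real.exp (polRe P r θ) * polReDeriv Q r θ)
    ((Real.continuous_exp.comp (continuous_polRe P)).mul (continuous_polRe Q))
    ((((Real.continuous_exp.comp (continuous_polRe P)).mul (continuous_polReDeriv P)).mul
      (continuous_polRe Q)).add
      ((Real.continuous_exp.comp (continuous_polRe P)).mul (continuous_polReDeriv Q)))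
    (fun r θ => (hasDerivAt_polRe_left P r θ).exp.mul (hasDerivAt_polRe_left Q r θ)) r

/-- In the notation of the proof, `r d M² = (2V - W - Z) M - 2AB + B²`. The Poincaré inequality
replaces `M Z` by `M Q - A²`, and what remains is Cauchy-Schwarz, `(B - A)² ≤ M (W - 2V + Q)`, for
`Re(zP') - Re P` under the density `exp(Re P)`. -/
theorem exists_hasDerivAt_flowGap (P : ℂ[X]) (r : ℝ) :
    ∃ d, HasDerivAt (flowGap P) d r ∧ r * d ≤ 0 := by
  set N := X * derivative P with hN
  have hM := hasDerivAt_integral_exp_polRe P r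
  have hA := hasDerivAt_integral_exp_mul_polRe P P r
  have hB := hasDerivAt_integral_exp_mul_polRe P N r
  have Mpos := integral_exp_polRe_pos P r
  set M := ∫ θ, Real.exp (polRe P r θ) ∂circ with hMdef
  set A := ∫ θ, Real.exp (polRe P r θ) * polRe P r θ ∂circ with hAdef
  set B := ∫ θ, Real.exp (polRe P r θ) * polRe N r θ ∂circ with hBdef
  set M' := ∫ θ, Real.exp (polRe P r θ) * polReDeriv P r θ ∂circ with hM'
  set A' := ∫ θ, (Real.exp (polRe P r θ) * polReDeriv P r θ * polRe P r θ
        + Real.exp (polRe P r θ) * polReDeriv P r θ) ∂circ with hA'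
  set B' := ∫ θ, (Real.exp (polRe P r θ) * polReDeriv P r θ * polRe N r θ
        + Real.exp (polRe P r θ) * polReDeriv N r θ) ∂circ with hB'
  set V := ∫ θ, Real.exp (polRe P r θ) * (polRe N r θ * polRe P r θ) ∂circ with hV
  set W := ∫ θ, Real.exp (polRe P r θ) * polRe N r θ ^ 2 ∂circ with hW
  set Z := ∫ θ, Real.exp (polRe P r θ) * polIm N r θ ^ 2 ∂circ with hZ
  have rM : r * M' = B := by
    rw [hM', hBdef, ← integral_const_mul]
    refine integral_congr_ae (Eventually.of_forall fun θ => ?_)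
    simp only [hN, ← mul_polReDeriv]
    ring
  have rA : r * A' = V + B := by
    rw [hA', hBdef, hV, ← integral_const_mul, ← integral_add]
    · refine integral_congr_ae (Eventually.of_forall fun θ => ?_)
      simp only [hN, ← mul_polReDeriv]
      ring
    all_goals exact Continuous.integrable_circ (by fun_prop)
  have rB : r * B' = W + Z := by
    rw [hB', hW, hZ, hN, ← integral_exp_mul_polRe_theta, ← integral_const_mul, ← integral_add]
    · refine integral_congr_ae (Eventually.of_forall fun θ => ?_)
      simp only [← mul_polReDeriv]
      ring
    all_goals exact Continuous.integrable_circ (by fun_prop)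
  refine ⟨_, ((((hA.const_mul 2).sub hB).div hM Mpos.ne').sub ((hM.log Mpos.ne').const_mul 2)), ?_⟩
  have hp := circ_exp_poincare (fun θ => hasDerivAt_polRe_right P r θ) (by fun_prop)
    (by simp [polRe, polarPt_two_pi])
  simp only [neg_sq, ← hN] at hp
  rw [← hMdef, ← hAdef, ← hZ] at hp
  set Q := ∫ θ, Real.exp (polRe P r θ) * polRe P r θ ^ 2 ∂circ with hQ
  have hcs := circ_cauchy_schwarz (f := fun θ => Real.exp (polRe P r θ / 2))
    (g := fun θ => Real.exp (polRe P r θ / 2) * (polRe N r θ - polRe P r θ)) (by fun_prop)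
    (by fun_prop)
  have hexp : ∀ θ, Real.exp (polRe P r θ / 2) ^ 2 = Real.exp (polRe P r θ) := fun θ => by
    rw [← Real.exp_nat_mul]; congr 1; push_cast; ring
  have i1 : ∫ θ, Real.exp (polRe P r θ / 2) * (Real.exp (polRe P r θ / 2)
      * (polRe N r θ - polRe P r θ)) ∂circ = B - A := by
    rw [hBdef, hAdef, ← integral_sub]
    · refine integral_congr_ae (Eventually.of_forall fun θ => ?_)
      simp only [← hexp]
      ring
    all_goals exact Continuous.integrable_circ (by fun_prop)
  have i2 : ∫ θ, (Real.exp (polRe P r θ / 2) * (polRe N r θ - polRe P r θ)) ^ 2 ∂circ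
      = W - 2 * V + Q := by
    rw [hW, hV, hQ, ← integral_const_mul, ← integral_sub, ← integral_add]
    · refine integral_congr_ae (Eventually.of_forall fun θ => ?_)
      simp only [← hexp]
      ring
    all_goals exact Continuous.integrable_circ (by fun_prop)
  rw [i1, i2] at hcs
  simp_rw [hexp] at hcs
  rw [← hMdef] at hcs
  have e : r * ((((2 * A' - B') * M - (2 * A - B) * M') / M ^ 2) - 2 * (M' / M))
      = ((2 * (V + B) - (W + Z)) * M - (2 * A - B) * B - 2 * B * M) / M ^ 2 := by
    rw [← rA, ← rB, ← rM]
    field_simp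
  refine e.trans_le ?_
  refine div_nonpos_of_nonpos_of_nonneg ?_ (by positivity)
  nlinarith

theorem flowGap_zero (P : ℂ[X]) : flowGap P 0 = 0 := by
  have h1 : ∀ θ, polRe P 0 θ = (P.eval 0).re := fun θ => by simp [polRe, polarPt]
  have h2 : ∀ θ, polRe (X * derivative P) 0 θ = 0 := fun θ => by simp [polRe, polarPt]
  simp only [flowGap, h1, h2]
  simp
  have := (Real.exp_pos (P.eval 0).re).ne'
  field_simp
  ring

theorem flowGap_nonpos (P : ℂ[X]) {r : ℝ} (hr : 0 ≤ r) : flowGap P r ≤ 0 := by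
  rw [← flowGap_zero P]
  choose d hd hd' using exists_hasDerivAt_flowGap P
  refine antitoneOn_of_deriv_nonpos (convex_Ici 0)
    (fun x _ => (hd x).continuousAt.continuousWithinAt)
    (fun x _ => (hd x).differentiableAt.differentiableWithinAt) (fun x hx => ?_)
    (Set.mem_Ici.2 le_rfl) (Set.mem_Ici.2 hr) hr
  rw [interior_Ici, Set.mem_Ioi] at hx
  rw [(hd x).deriv]
  exact nonpos_of_mul_nonpos_right (hd' x) hx

theorem polRe_C_mul (s : ℝ) (P : ℂ[X]) (r θ : ℝ) :
    polRe (C (s : ℂ) * P) r θ = s * polRe P r θ := by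
  simp [polRe]

/-- Radius `exp τ` and exponent `exp(-2τ)` keep (exponent) · (radius)² constant, as in Weissler's
inequality. The derivative in `τ` is a negative multiple of `flowGap` for the rescaled polynomial,
and `flowGap` starts at `0` and decreases in the radius. -/
theorem monotone_mul_log_integral_exp (P : ℂ[X]) :
    Monotone fun τ : ℝ => Real.exp (2 * τ) *
      Real.log (∫ θ, Real.exp (Real.exp (-2 * τ) * polRe P (Real.exp τ) θ) ∂circ) := by
  have hd : ∀ τ, HasDerivAt (fun τ : ℝ => Real.exp (2 * τ) *
      Real.log (∫ θ, Real.exp (Real.exp (-2 * τ) * polRe P (Real.exp τ) θ) ∂circ))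
      (-Real.exp (2 * τ) * flowGap (C (Real.exp (-2 * τ) : ℂ) * P) (Real.exp τ)) τ := by
    intro τ
    have e2 : ∀ τ : ℝ, HasDerivAt (fun τ : ℝ => Real.exp (-2 * τ)) (-2 * Real.exp (-2 * τ)) τ := by
      intro τ
      have := ((hasDerivAt_id τ).const_mul (-2 : ℝ)).exp
      convert! this using 1
      simp
      ring
    have e3 : HasDerivAt (fun τ : ℝ => Real.exp (2 * τ)) (2 * Real.exp (2 * τ)) τ := by
      have := ((hasDerivAt_id τ).const_mul (2 : ℝ)).exp
      convert! this using 1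
      simp
      ring
    have cc : ∀ Q : ℂ[X], Continuous (Function.uncurry fun τ θ => polRe Q (Real.exp τ) θ) :=
      fun Q => (continuous_polRe Q).comp
        (by fun_prop : Continuous fun x : ℝ × ℝ => (Real.exp x.1, x.2))
    have ce : Continuous (Function.uncurry fun (τ : ℝ) (_ : ℝ) => Real.exp (-2 * τ)) := by
      unfold Function.uncurry; fun_prop
    have hI := hasDerivAt_integral_circ
      (F := fun τ θ => Real.exp (Real.exp (-2 * τ) * polRe P (Real.exp τ) θ))
      (F' := fun τ θ => Real.exp (Real.exp (-2 * τ) * polRe P (Real.exp τ) θ) *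
        (-2 * Real.exp (-2 * τ) * polRe P (Real.exp τ) θ
          + Real.exp (-2 * τ) * polRe (X * derivative P) (Real.exp τ) θ))
      (Real.continuous_exp.comp (ce.mul (cc P)))
      ((Real.continuous_exp.comp (ce.mul (cc P))).mul
        (((continuous_const.mul ce).mul (cc P)).add (ce.mul (cc _))))
      (fun τ θ => by
        have h1 := (hasDerivAt_polRe_left P (Real.exp τ) θ).comp τ (Real.hasDerivAt_exp τ)
        rw [mul_comm, mul_polReDeriv] at h1
        exact ((e2 τ).mul h1).exp) τ
    set s := Real.exp (-2 * τ) with hs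
    have hpos := integral_exp_polRe_pos (C (s : ℂ) * P) (Real.exp τ)
    simp only [polRe_C_mul] at hpos
    have := e3.mul (hI.log hpos.ne')
    convert! this using 1
    have hder : X * derivative (C (s : ℂ) * P) = C (s : ℂ) * (X * derivative P) := by
      rw [derivative_C_mul]; ring
    simp only [flowGap, hder, polRe_C_mul]
    have hsplit : ∫ θ, Real.exp (s * polRe P (Real.exp τ) θ) *
        (-2 * s * polRe P (Real.exp τ) θ + s * polRe (X * derivative P) (Real.exp τ) θ) ∂circ
        = (∫ θ, Real.exp (s * polRe P (Real.exp τ) θ) * (s * polRe (X * derivative P)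
            (Real.exp τ) θ) ∂circ)
          - 2 * ∫ θ, Real.exp (s * polRe P (Real.exp τ) θ) * (s * polRe P (Real.exp τ) θ) ∂circ := by
      rw [← integral_const_mul, ← integral_sub]
      · exact integral_congr_ae (Eventually.of_forall fun θ => by ring)
      all_goals exact Continuous.integrable_circ (by fun_prop)
    rw [hsplit]
    ring
  refine monotone_of_deriv_nonneg (fun τ => (hd τ).differentiableAt) fun τ => ?_
  rw [(hd τ).deriv]
  have := flowGap_nonpos (C (Real.exp (-2 * τ) : ℂ) * P) (Real.exp_pos τ).le
  nlinarith [Real.exp_pos (2 * τ)]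

theorem weissler_exp (W : ℂ[X]) {p q : ℝ} (hp : 0 < p) (hpq : p ≤ q) :
    ∫ θ, Real.exp (polRe W (√(p / q)) θ) ^ q ∂circ
      ≤ (∫ θ, Real.exp (polRe W 1 θ) ^ p ∂circ) ^ (q / p) := by
  have hq : 0 < q := hp.trans_le hpq
  have hpq' : 0 < p / q := by positivity
  have hexp : Real.exp (Real.log (p / q) / 2) = √(p / q) := by
    rw [← Real.log_sqrt hpq'.le, Real.exp_log (Real.sqrt_pos.2 hpq')]
  have hτ : Real.log (p / q) / 2 ≤ 0 := by
    have := Real.log_nonpos hpq'.le ((div_le_one hq).2 hpq)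
    linarith
  -- For the polynomial `pW`, time `0` has exponent `p` on the unit circle, and time `log(p/q)/2`
  -- has exponent `q` on the circle of radius `√(p/q)`.
  have key := monotone_mul_log_integral_exp (C (p : ℂ) * W) hτ
  simp only [polRe_C_mul, hexp, mul_zero, Real.exp_zero, one_mul] at key
  have h1 : Real.exp (2 * (Real.log (p / q) / 2)) = p / q := by
    rw [mul_div_cancel₀ _ two_ne_zero, Real.exp_log hpq']
  have h2 : Real.exp (-2 * (Real.log (p / q) / 2)) = q / p := by
    rw [show -2 * (Real.log (p / q) / 2) = -Real.log (p / q) by ring, Real.exp_neg,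
      Real.exp_log hpq', inv_div]
  rw [h1, h2] at key
  have h3 : ∀ θ, q / p * (p * polRe W (√(p / q)) θ) = polRe W (√(p / q)) θ * q := fun θ => by
    field_simp
  simp only [h3] at key
  simp only [← Real.exp_mul]
  have a1 := integral_exp_polRe_pos (C (q : ℂ) * W) (√(p / q))
  have a2 := integral_exp_polRe_pos (C (p : ℂ) * W) 1
  simp only [polRe_C_mul, mul_comm q, mul_comm p] at a1 a2
  simp only [mul_comm p] at key
  rw [← Real.log_le_log_iff a1 (Real.rpow_pos_of_pos a2 _), Real.log_rpow a2]
  have := mul_le_mul_of_nonneg_left key (by positivity : 0 ≤ q / p)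
  calc _ = q / p * (p / q * Real.log (∫ θ, Real.exp (polRe W (√(p / q)) θ * q) ∂circ)) := by
        field_simp
    _ ≤ _ := by rw [div_mul_comm] at *; linarith

/-! ### Removing the zeros: Weissler's inequality for all polynomials. -/

/-- The function `h` is on the closed unit disc a bounded limit of moduli of exponentials of
polynomials. -/
def IsExpLimit (h : ℂ → ℝ) : Prop :=
  ∃ (W : ℕ → ℂ[X]) (B : ℝ), (∀ n z, ‖z‖ ≤ 1 → ((W n).eval z).re ≤ B) ∧
    ∀ z, ‖z‖ ≤ 1 → Tendsto (fun n => Real.exp ((W n).eval z).re) atTop (𝓝 (h z))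

theorem IsExpLimit.mul {g h : ℂ → ℝ} (hg : IsExpLimit g) (hh : IsExpLimit h) :
    IsExpLimit fun z => g z * h z := by
  obtain ⟨V, A, hA, hV⟩ := hg
  obtain ⟨W, B, hB, hW⟩ := hh
  refine ⟨fun n => V n + W n, A + B, fun n z hz => ?_, fun z hz => ?_⟩
  · simpa using add_le_add (hA n z hz) (hB n z hz)
  · simpa [Real.exp_add] using (hV z hz).mul (hW z hz)

theorem isExpLimit_const {c : ℝ} (hc : 0 < c) : IsExpLimit fun _ => c :=
  ⟨fun _ => C (Real.log c : ℂ), Real.log c, fun n z _ => by simp,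
    fun z _ => by simp [Real.exp_log hc]⟩

theorem exists_poly_near_log {β : ℂ} (hβ : ‖β‖ < 1) {η : ℝ} (hη : 0 < η) :
    ∃ W : ℂ[X], ∀ z, ‖z‖ ≤ 1 → |(W.eval z).re - Real.log ‖1 - β * z‖| ≤ η := by
  have hlim : Tendsto (fun k : ℕ => ‖β‖ ^ (k + 1) * (1 - ‖β‖)⁻¹) atTop (𝓝 0) := by
    have := ((tendsto_pow_atTop_nhds_zero_of_lt_one (norm_nonneg β) hβ).comp
      (tendsto_add_atTop_nat 1)).mul_const (1 - ‖β‖)⁻¹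
    simpa using this
  obtain ⟨k, hk⟩ := (hlim.eventually_lt_const hη).exists
  refine ⟨∑ j ∈ Finset.range (k + 1), C ((-1) ^ (j + 1) * (-β) ^ j / j) * X ^ j, fun z hz => ?_⟩
  have hbz : ‖-β * z‖ ≤ ‖β‖ := by
    rw [norm_mul, norm_neg]
    exact mul_le_of_le_one_right (norm_nonneg _) hz
  have e : (∑ j ∈ Finset.range (k + 1), C ((-1) ^ (j + 1) * (-β) ^ j / j) * X ^ j : ℂ[X]).eval z
      = Complex.logTaylor (k + 1) (-β * z) := by
    simp only [Complex.logTaylor, eval_finsetSum, eval_mul, eval_C, eval_pow, eval_X]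
    refine Finset.sum_congr rfl fun j _ => ?_
    rw [mul_pow]
    ring
  have h1 := Complex.norm_log_sub_logTaylor_le k (z := -β * z) (hbz.trans_lt hβ)
  rw [e, abs_sub_comm]
  have e2 : Real.log ‖1 - β * z‖ = (Complex.log (1 + -β * z)).re := by
    rw [Complex.log_re]; congr 2; ring
  rw [e2, ← Complex.sub_re]
  refine (Complex.abs_re_le_norm _).trans (h1.trans (le_trans ?_ hk.le))
  have h0 : 0 < 1 - ‖β‖ := by linarith
  refine (div_le_self (mul_nonneg (by positivity) (inv_nonneg.2 (by linarith)))
    (by linarith [(Nat.cast_nonneg k : (0 : ℝ) ≤ k)])).trans ?_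
  have h3 : 0 ≤ (1 - ‖-β * z‖)⁻¹ := inv_nonneg.2 (by linarith)
  gcongr

/-- Shrinking `β` slightly puts the zero off the closed disc, where Taylor polynomials approximate
the logarithm uniformly. For `‖β‖ = 1` the limit has a zero on the circle, so the exponents are
bounded only from above; dominated convergence needs no more. -/
theorem isExpLimit_linear {β : ℂ} (hβ : ‖β‖ ≤ 1) : IsExpLimit fun z => ‖1 - β * z‖ := by
  have hu : ∀ n : ℕ, (0 : ℝ) < 1 / ((n : ℝ) + 1) := fun n => by positivity
  have hu1 : ∀ n : ℕ, 1 / ((n : ℝ) + 1) ≤ 1 := fun n => by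
    rw [div_le_one (by positivity)]; linarith [(Nat.cast_nonneg n : (0 : ℝ) ≤ n)]
  set b : ℕ → ℂ := fun n => ((1 - 1 / ((n : ℝ) + 1) : ℝ) : ℂ) * β with hb
  have hbn : ∀ n, ‖b n‖ < 1 := by
    intro n
    rw [hb]
    simp only
    rw [norm_mul, Complex.norm_real, Real.norm_of_nonneg (by linarith [hu1 n])]
    nlinarith [hu n, hu1 n, norm_nonneg β]
  choose W hW using fun n => exists_poly_near_log (hbn n) (hu n)
  have hne : ∀ n z, ‖z‖ ≤ 1 → 0 < ‖1 - b n * z‖ := by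
    intro n z hz
    rw [norm_pos_iff, sub_ne_zero]
    intro h
    have : ‖b n * z‖ = 1 := by rw [← h, norm_one]
    rw [norm_mul] at this
    nlinarith [hbn n, norm_nonneg (b n), norm_nonneg z]
  refine ⟨W, Real.log 2 + 1, fun n z hz => ?_, fun z hz => ?_⟩
  · have h1 := (abs_le.1 (hW n z hz)).2
    have h2 : Real.log ‖1 - b n * z‖ ≤ Real.log 2 := by
      refine Real.log_le_log (hne n z hz) ((norm_sub_le _ _).trans ?_)
      rw [norm_one, norm_mul]
      nlinarith [hbn n, norm_nonneg (b n), norm_nonneg z]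
    linarith [hu1 n]
  · have hu0 : Tendsto (fun n : ℕ => 1 / ((n : ℝ) + 1)) atTop (𝓝 0) :=
      tendsto_one_div_add_atTop_nhds_zero_nat
    have h1 : Tendsto (fun n => ((W n).eval z).re - Real.log ‖1 - b n * z‖) atTop (𝓝 0) :=
      squeeze_zero_norm (fun n => hW n z hz) hu0
    have h2 : Tendsto (fun n => ‖1 - b n * z‖) atTop (𝓝 ‖1 - β * z‖) := by
      have : Tendsto (fun n : ℕ => ((1 - 1 / ((n : ℝ) + 1) : ℝ) : ℂ)) atTop (𝓝 ((1 - 0 : ℝ) : ℂ)) :=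
        (Complex.continuous_ofReal.tendsto _).comp (hu0.const_sub 1)
      simpa [hb] using ((this.mul_const β).mul_const z).const_sub 1 |>.norm
    have h3 := h2.mul ((Real.continuous_exp.tendsto 0).comp h1)
    rw [Real.exp_zero, mul_one] at h3
    refine h3.congr fun n => ?_
    simp only [Function.comp]
    rw [Real.exp_sub, Real.exp_log (hne n z hz)]
    field_simp [(hne n z hz).ne']

theorem norm_polarPt {r : ℝ} (hr : 0 ≤ r) (θ : ℝ) : ‖polarPt r θ‖ = r := by
  rw [polarPt, norm_mul, Complex.norm_exp_ofReal_mul_I, mul_one, Complex.norm_real,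
    Real.norm_of_nonneg hr]

theorem IsExpLimit.tendsto_integral {h : ℂ → ℝ} {W : ℕ → ℂ[X]} {B : ℝ}
    (hB : ∀ n z, ‖z‖ ≤ 1 → ((W n).eval z).re ≤ B)
    (hW : ∀ z, ‖z‖ ≤ 1 → Tendsto (fun n => Real.exp ((W n).eval z).re) atTop (𝓝 (h z)))
    {r s : ℝ} (hr : 0 ≤ r) (hr1 : r ≤ 1) (hs : 0 < s) :
    Tendsto (fun n => ∫ θ, Real.exp (polRe (W n) r θ) ^ s ∂circ) atTop
      (𝓝 (∫ θ, h (polarPt r θ) ^ s ∂circ)) := by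
  have hz : ∀ θ, ‖polarPt r θ‖ ≤ 1 := fun θ => (norm_polarPt hr θ).trans_le hr1
  refine tendsto_integral_of_dominated_convergence (fun _ => Real.exp B ^ s) (fun n => ?_)
    (integrable_const _) (fun n => Eventually.of_forall fun θ => ?_)
    (Eventually.of_forall fun θ => ?_)
  · have : Continuous fun θ => Real.exp (polRe (W n) r θ) ^ s :=
      Continuous.rpow_const (by fun_prop) fun _ => Or.inr hs.le
    exact this.aestronglyMeasurable
  · rw [Real.norm_of_nonneg (by positivity)]
    gcongr
    exact hB n _ (hz θ)
  · exact (hW _ (hz θ)).rpow_const (Or.inr hs.le)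

theorem IsExpLimit.weissler {h : ℂ → ℝ} (hh : IsExpLimit h) {p q : ℝ} (hp : 0 < p)
    (hpq : p ≤ q) :
    ∫ θ, h (polarPt (√(p / q)) θ) ^ q ∂circ ≤ (∫ θ, h (polarPt 1 θ) ^ p ∂circ) ^ (q / p) := by
  obtain ⟨W, B, hB, hW⟩ := hh
  have hq : 0 < q := hp.trans_le hpq
  have h1 : √(p / q) ≤ 1 := Real.sqrt_le_one.2 ((div_le_one hq).2 hpq)
  exact le_of_tendsto_of_tendsto' (IsExpLimit.tendsto_integral hB hW (Real.sqrt_nonneg _) h1 hq)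
    ((IsExpLimit.tendsto_integral hB hW zero_le_one le_rfl hp).rpow_const
      (Or.inr (by positivity))) fun n => weissler_exp (W n) hp hpq

/-- A zero `α` inside the disc is reflected: `|1 - ᾱz|` agrees with `|z - α|` on the circle and
dominates it inside. For `‖α‖ ≥ 1` the factor is already `|α| |1 - z/α|`. -/
theorem exists_isExpLimit_linear (α : ℂ) : ∃ h : ℂ → ℝ, IsExpLimit h ∧
    ∀ z, ‖z‖ ≤ 1 → ‖z - α‖ ≤ h z ∧ (‖z‖ = 1 → h z = ‖z - α‖) := by
  rcases lt_or_ge ‖α‖ 1 with h | h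
  · refine ⟨_, isExpLimit_linear (β := (starRingEnd ℂ) α) (by simpa using h.le), fun z hz => ?_⟩
    have e : ‖1 - (starRingEnd ℂ) α * z‖ ^ 2 = ‖z - α‖ ^ 2 + (1 - ‖z‖ ^ 2) * (1 - ‖α‖ ^ 2) := by
      simp only [← Complex.normSq_eq_norm_sq, Complex.normSq_apply]
      simp
      ring
    refine ⟨?_, fun h1 => ?_⟩
    · refine abs_le_of_sq_le_sq' ?_ (norm_nonneg _) |>.2
      rw [e]
      nlinarith [norm_nonneg z, norm_nonneg α, mul_nonneg
        (by nlinarith [norm_nonneg z] : 0 ≤ 1 - ‖z‖ ^ 2)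
        (by nlinarith [norm_nonneg α] : 0 ≤ 1 - ‖α‖ ^ 2)]
    · rw [h1] at e
      exact (sq_eq_sq₀ (norm_nonneg _) (norm_nonneg _)).1 (by rw [e]; ring)
  · have h0 : 0 < ‖α‖ := by linarith
    have hα : α ≠ 0 := norm_pos_iff.1 h0
    refine ⟨_, (isExpLimit_const h0).mul (isExpLimit_linear (β := α⁻¹) ?_), fun z _ => ?_⟩
    · rw [norm_inv]; exact inv_le_one_of_one_le₀ h
    · have : ‖α‖ * ‖1 - α⁻¹ * z‖ = ‖z - α‖ := by
        rw [← norm_mul, ← norm_neg]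
        congr 1
        field_simp
        ring
      exact ⟨this.ge, fun _ => this⟩

/-- Multiply over the roots. Replacing `|f|` by `h` leaves the integral over the unit circle
unchanged and does not decrease the one over the smaller circle, so Weissler's inequality for `h`
implies it for `f`. -/
theorem exists_isExpLimit {f : ℂ[X]} (hf : f ≠ 0) : ∃ h : ℂ → ℝ, IsExpLimit h ∧
    ∀ z, ‖z‖ ≤ 1 → ‖f.eval z‖ ≤ h z ∧ (‖z‖ = 1 → h z = ‖f.eval z‖) := by
  have key : ∀ s : Multiset ℂ, ∃ h : ℂ → ℝ, IsExpLimit h ∧ ∀ z, ‖z‖ ≤ 1 →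
      ‖((s.map fun a => X - C a).prod).eval z‖ ≤ h z ∧
        (‖z‖ = 1 → h z = ‖((s.map fun a => X - C a).prod).eval z‖) := by
    intro s
    induction s using Multiset.induction with
    | empty => exact ⟨_, isExpLimit_const one_pos, fun z _ => by simp⟩
    | cons a s ih =>
      obtain ⟨h, hh, h1⟩ := ih
      obtain ⟨g, hg, h2⟩ := exists_isExpLimit_linear a
      refine ⟨_, hg.mul hh, fun z hz => ?_⟩
      obtain ⟨u1, u2⟩ := h1 z hz
      obtain ⟨v1, v2⟩ := h2 z hz
      simp only [Multiset.map_cons, Multiset.prod_cons, eval_mul, eval_sub, eval_X, eval_C,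
        norm_mul]
      refine ⟨by gcongr; exact (norm_nonneg _).trans v1, fun hz1 => ?_⟩
      rw [u2 hz1, v2 hz1]
  obtain ⟨h, hh, h1⟩ := key f.roots
  have hl : 0 < ‖f.leadingCoeff‖ := norm_pos_iff.2 (leadingCoeff_ne_zero.2 hf)
  refine ⟨_, (isExpLimit_const hl).mul hh, fun z hz => ?_⟩
  have e : ‖f.eval z‖ = ‖f.leadingCoeff‖ * ‖((f.roots.map fun a => X - C a).prod).eval z‖ := by
    conv_lhs => rw [(IsAlgClosed.splits f).eq_prod_roots]
    rw [eval_mul, eval_C, norm_mul]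
  rw [e]
  exact ⟨by gcongr; exact (h1 z hz).1, fun hz1 => by rw [(h1 z hz).2 hz1]⟩

/-- Weissler's inequality: `f ↦ f(√(p/q) ·)` is a contraction from `H^p` to `H^q` of the disc. -/
theorem weissler (f : ℂ[X]) {p q : ℝ} (hp : 0 < p) (hpq : p ≤ q) :
    ∫ θ, ‖f.eval (polarPt (√(p / q)) θ)‖ ^ q ∂circ
      ≤ (∫ θ, ‖f.eval (polarPt 1 θ)‖ ^ p ∂circ) ^ (q / p) := by
  have hq : 0 < q := hp.trans_le hpq
  rcases eq_or_ne f 0 with rfl | hf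
  · simp [Real.zero_rpow hq.ne', Real.zero_rpow hp.ne', Real.zero_rpow (div_pos hq hp).ne']
  obtain ⟨h, hh, h1⟩ := exists_isExpLimit hf
  have hr1 : √(p / q) ≤ 1 := Real.sqrt_le_one.2 ((div_le_one hq).2 hpq)
  have e1 : ∫ θ, h (polarPt 1 θ) ^ p ∂circ = ∫ θ, ‖f.eval (polarPt 1 θ)‖ ^ p ∂circ := by
    refine integral_congr_ae (Eventually.of_forall fun θ => ?_)
    have hn := norm_polarPt zero_le_one θ
    simp only [(h1 _ hn.le).2 hn]
  rw [← e1]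
  refine le_trans ?_ (hh.weissler hp hpq)
  obtain ⟨W, B, hB, hW⟩ := hh
  have hz : ∀ θ, ‖polarPt (√(p / q)) θ‖ ≤ 1 := fun θ =>
    (norm_polarPt (Real.sqrt_nonneg _) θ).trans_le hr1
  refine integral_mono_of_nonneg (Eventually.of_forall fun θ => by positivity) ?_
    (Eventually.of_forall fun θ => ?_)
  · have hm : AEStronglyMeasurable (fun θ => h (polarPt (√(p / q)) θ)) circ :=
      aestronglyMeasurable_of_tendsto_ae atTop
        (f := fun n θ => Real.exp (polRe (W n) (√(p / q)) θ))
        (fun n => (by fun_prop : Continuous fun θ =>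
          Real.exp (polRe (W n) (√(p / q)) θ)).aestronglyMeasurable)
        (Eventually.of_forall fun θ => hW _ (hz θ))
    refine Integrable.of_bound (C := Real.exp B ^ q)
      ((Real.continuous_rpow_const hq.le).comp_aestronglyMeasurable hm)
      (Eventually.of_forall fun θ => ?_)
    have h0 : 0 ≤ h (polarPt (√(p / q)) θ) := (norm_nonneg _).trans (h1 _ (hz θ)).1
    rw [Real.norm_of_nonneg (by positivity)]
    gcongr
    exact le_of_tendsto' (hW _ (hz θ)) fun n => Real.exp_le_exp.2 (hB n _ (hz θ))
  · have := (h1 _ (hz θ)).1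
    simp only
    gcongr

/-! ### Minkowski's inequality and Weissler's inequality in several variables. -/

/-- **Minkowski's integral inequality.** -/
theorem lintegral_lintegral_rpow_le {X Y : Type*} [MeasurableSpace X] [MeasurableSpace Y]
    {μ : Measure X} {ν : Measure Y} [SFinite μ] [SFinite ν] {g : X → Y → ℝ≥0∞}
    (hg : Measurable (Function.uncurry g)) {r : ℝ} (hr : 1 ≤ r)
    (hfin : ∫⁻ y, (∫⁻ x, g x y ∂μ) ^ r ∂ν ≠ ∞) :
    ∫⁻ y, (∫⁻ x, g x y ∂μ) ^ r ∂ν ≤ (∫⁻ x, (∫⁻ y, g x y ^ r ∂ν) ^ (1 / r) ∂μ) ^ r := by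
  have hr0 : 0 < r := by linarith
  rcases hr.eq_or_lt with rfl | hr1
  · simp only [ENNReal.rpow_one, div_one]
    exact (lintegral_lintegral_swap hg.aemeasurable).ge
  set G : Y → ℝ≥0∞ := fun y => ∫⁻ x, g x y ∂μ with hG
  have mG : Measurable G := hg.lintegral_prod_left
  set I := ∫⁻ y, G y ^ r ∂ν with hI
  have hconj : r.HolderConjugate (r / (r - 1)) := Real.HolderConjugate.conjExponent hr1
  have h1 : I ≤ (∫⁻ x, (∫⁻ y, g x y ^ r ∂ν) ^ (1 / r) ∂μ) * I ^ (1 / (r / (r - 1))) := by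
    calc I = ∫⁻ y, ∫⁻ x, g x y * G y ^ (r - 1) ∂μ ∂ν := by
          refine lintegral_congr fun y => ?_
          have mgy : Measurable fun x => g x y :=
            hg.comp (by fun_prop : Measurable fun x => (x, y))
          rw [lintegral_mul_const _ mgy]
          conv_lhs => rw [show r = 1 + (r - 1) by ring,
            ENNReal.rpow_add_of_nonneg _ _ zero_le_one (by linarith), ENNReal.rpow_one]
      _ = ∫⁻ x, ∫⁻ y, g x y * G y ^ (r - 1) ∂ν ∂μ := by
          refine (lintegral_lintegral_swap ?_).symm
          exact (hg.mul ((mG.comp measurable_snd).pow_const _)).aemeasurable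
      _ ≤ ∫⁻ x, (∫⁻ y, g x y ^ r ∂ν) ^ (1 / r) * I ^ (1 / (r / (r - 1))) ∂μ := by
          refine lintegral_mono fun x => ?_
          have := ENNReal.lintegral_mul_le_Lp_mul_Lq ν hconj (f := g x)
            (g := fun y => G y ^ (r - 1))
            (hg.comp (by fun_prop : Measurable fun y => (x, y))).aemeasurable
            (mG.pow_const _).aemeasurable
          refine this.trans_eq ?_
          simp only [← ENNReal.rpow_mul]
          rw [mul_div_cancel₀ _ (by linarith : r - 1 ≠ 0)]
      _ = _ := by
          rw [lintegral_mul_const]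
          exact ((hg.pow_const r).lintegral_prod_right).pow_const _
  rcases eq_or_ne I 0 with h0 | h0
  · rw [h0]; exact zero_le
  -- Finiteness of `I` is what permits dividing by the conjugate power of `I`.
  have h2 : I ^ (1 / r) ≤ ∫⁻ x, (∫⁻ y, g x y ^ r ∂ν) ^ (1 / r) ∂μ := by
    have e : I = I ^ (1 / r) * I ^ (1 / (r / (r - 1))) := by
      rw [← ENNReal.rpow_add _ _ h0 hfin]
      have : 1 / r + 1 / (r / (r - 1)) = 1 := by field_simp; ring
      rw [this, ENNReal.rpow_one]
    rw [e] at h1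
    conv_rhs at h1 => rw [← e]
    refine (ENNReal.mul_le_mul_iff_left ?_ ?_).1 h1
    · exact (ENNReal.rpow_pos (pos_iff_ne_zero.2 h0) hfin).ne'
    · exact ENNReal.rpow_ne_top_of_nonneg
        (by rw [one_div_div]; exact div_nonneg (by linarith) hr0.le) hfin
  calc I = (I ^ (1 / r)) ^ r := by rw [← ENNReal.rpow_mul, one_div_mul_cancel hr0.ne', ENNReal.rpow_one]
    _ ≤ _ := by gcongr

theorem lintegral_enorm_rpow_eq_ofReal {Ω : Type*} [MeasurableSpace Ω] {μ : Measure Ω}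
    {f : Ω → ℂ} {r : ℝ} (hr : 0 ≤ r) (hf : Integrable (fun ω => ‖f ω‖ ^ r) μ) :
    ∫⁻ ω, ‖f ω‖ₑ ^ r ∂μ = ENNReal.ofReal (∫ ω, ‖f ω‖ ^ r ∂μ) := by
  rw [ofReal_integral_eq_lintegral_ofReal hf (Eventually.of_forall fun ω => by positivity)]
  refine lintegral_congr fun ω => ?_
  rw [← ofReal_norm, ENNReal.ofReal_rpow_of_nonneg (norm_nonneg _) hr]

theorem continuous_polarPt_right (r : ℝ) : Continuous (polarPt r) :=
  continuous_polarPt.comp (by fun_prop : Continuous fun θ => (r, θ))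

theorem weissler_lintegral (f : ℂ[X]) {p q : ℝ} (hp : 0 < p) (hpq : p ≤ q) :
    ∫⁻ θ, ‖f.eval (polarPt (√(p / q)) θ)‖ₑ ^ q ∂circ
      ≤ (∫⁻ θ, ‖f.eval (polarPt 1 θ)‖ₑ ^ p ∂circ) ^ (q / p) := by
  have hq : 0 < q := hp.trans_le hpq
  have hc : ∀ r s : ℝ, 0 < s → Integrable (fun θ => ‖f.eval (polarPt r θ)‖ ^ s) circ :=
    fun r s hs => ((f.continuous.comp (continuous_polarPt_right r)).norm.rpow_const
      fun _ => Or.inr hs.le).integrable_circ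
  rw [lintegral_enorm_rpow_eq_ofReal hq.le (hc _ _ hq),
    lintegral_enorm_rpow_eq_ofReal hp.le (hc _ _ hp),
    ENNReal.ofReal_rpow_of_nonneg (integral_nonneg fun _ => by positivity) (by positivity)]
  exact ENNReal.ofReal_le_ofReal (weissler f hp hpq)

section Tensor

variable {ι : Type*} [DecidableEq ι]

/-- The point with angles `θ` and radii `ρ` in the coordinates in `s` and `1` elsewhere. -/
noncomputable def torusPt (ρ : ℝ) (s : Finset ι) (θ : ι → ℝ) : ι → ℂ :=
  fun i => polarPt (if i ∈ s then ρ else 1) (θ i)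

theorem exists_polynomial_eval_update (P : MvPolynomial ι ℂ) (w : ι → ℂ) (i : ι) :
    ∃ Q : ℂ[X], ∀ z, Q.eval z = MvPolynomial.eval (Function.update w i z) P := by
  refine ⟨MvPolynomial.eval₂ C (fun j => if j = i then X else C (w j)) P, fun z => ?_⟩
  have := MvPolynomial.hom_eval₂ P C (evalRingHom z) (fun j => if j = i then X else C (w j))
  rw [coe_evalRingHom] at this
  rw [this]
  have e1 : (evalRingHom z).comp C = RingHom.id ℂ := by ext; simp
  rw [e1, MvPolynomial.eval₂_id]
  congr 2
  funext j
  by_cases h : j = i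
  · subst h; simp
  · simp [h]

theorem torusPt_update_insert (ρ : ℝ) {s : Finset ι} {i : ι} (θ : ι → ℝ) (t : ℝ) :
    torusPt ρ (insert i s) (Function.update θ i t)
      = Function.update (torusPt ρ s θ) i (polarPt ρ t) := by
  funext j
  by_cases h : j = i
  · subst h; simp [torusPt]
  · simp [torusPt, h]

theorem torusPt_update (ρ : ℝ) {s : Finset ι} {i : ι} (hi : i ∉ s) (θ : ι → ℝ) (t : ℝ) :
    torusPt ρ s (Function.update θ i t) = Function.update (torusPt ρ s θ) i (polarPt 1 t) := by
  funext j
  by_cases h : j = i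
  · subst h; simp [torusPt, hi]
  · simp [torusPt, h]

theorem norm_eval_torusPt_le (P : MvPolynomial ι ℂ) {ρ : ℝ} (h0 : 0 ≤ ρ) (h1 : ρ ≤ 1)
    (s : Finset ι) (θ : ι → ℝ) :
    ‖MvPolynomial.eval (torusPt ρ s θ) P‖ ≤ ∑ d ∈ P.support, ‖P.coeff d‖ := by
  rw [MvPolynomial.eval_eq]
  refine (norm_sum_le _ _).trans (Finset.sum_le_sum fun d _ => ?_)
  rw [norm_mul, norm_prod]
  refine mul_le_of_le_one_right (norm_nonneg _) (Finset.prod_le_one (fun _ _ => norm_nonneg _)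
    fun i _ => ?_)
  rw [norm_pow, torusPt]
  refine pow_le_one₀ (norm_nonneg _) ?_
  split_ifs
  · rwa [norm_polarPt h0]
  · rw [norm_polarPt zero_le_one]

theorem continuous_eval_torusPt (P : MvPolynomial ι ℂ) (ρ : ℝ) (s : Finset ι) :
    Continuous fun θ => MvPolynomial.eval (torusPt ρ s θ) P := by
  refine (MvPolynomial.continuous_eval P).comp (continuous_pi fun i => ?_)
  exact (continuous_polarPt_right _).comp (continuous_apply i)

/-- Induction on the variables. The one-variable inequality in the new angle produces a mixed norm
in the wrong order; Minkowski's inequality with exponent `q / p ≥ 1` interchanges the integrals, and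
the induction hypothesis applies with the new angle frozen. -/
theorem weissler_lmarginal [Countable ι] (P : MvPolynomial ι ℂ) {p q : ℝ} (hp : 0 < p)
    (hpq : p ≤ q) (s : Finset ι) (x : ι → ℝ) :
    lmarginal (fun _ => circ) s
        (fun θ => ‖MvPolynomial.eval (torusPt (√(p / q)) s θ) P‖ₑ ^ q) x
      ≤ (lmarginal (fun _ => circ) s
        (fun θ => ‖MvPolynomial.eval (torusPt (√(p / q)) ∅ θ) P‖ₑ ^ p) x) ^ (q / p) := by
  have hq : 0 < q := hp.trans_le hpq
  set ρ := √(p / q) with hρ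
  have hρ0 : 0 ≤ ρ := Real.sqrt_nonneg _
  have hρ1 : ρ ≤ 1 := Real.sqrt_le_one.2 ((div_le_one hq).2 hpq)
  have hr1 : 1 ≤ q / p := (one_le_div hp).2 hpq
  have hm : ∀ (s : Finset ι) (c : ℝ),
      Measurable fun θ => ‖MvPolynomial.eval (torusPt ρ s θ) P‖ₑ ^ c := fun s c =>
    ((continuous_eval_torusPt P ρ s).measurable.enorm).pow_const c
  induction s using Finset.induction generalizing x with
  | empty =>
    simp only [lmarginal_empty, ← ENNReal.rpow_mul]
    rw [mul_div_cancel₀ _ hp.ne']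
  | insert i s hi ih =>
    rw [lmarginal_insert' _ (hm _ _) hi, lmarginal_insert _ (hm _ _) hi]
    have step1 : ∀ θ : ι → ℝ,
        ∫⁻ t, ‖MvPolynomial.eval (torusPt ρ (insert i s) (Function.update θ i t)) P‖ₑ ^ q ∂circ
        ≤ (∫⁻ t, ‖MvPolynomial.eval (torusPt ρ s (Function.update θ i t)) P‖ₑ ^ p ∂circ)
          ^ (q / p) := by
      intro θ
      simp only [torusPt_update_insert, torusPt_update ρ hi]
      obtain ⟨Q, hQ⟩ := exists_polynomial_eval_update P (torusPt ρ s θ) i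
      simp only [← hQ]
      exact weissler_lintegral Q hp hpq
    refine (lmarginal_mono (fun θ => step1 θ) x).trans ?_
    rw [lmarginal]
    have mg : Measurable (Function.uncurry fun (t : ℝ) (y : s → ℝ) =>
        ‖MvPolynomial.eval (torusPt ρ s (Function.update (Function.updateFinset x s y) i t)) P‖ₑ
          ^ p) := by
      refine (hm s p).comp ?_
      refine measurable_pi_lambda _ fun j => ?_
      by_cases h : j = i
      · subst h; simp only [Function.update_self]; fun_prop
      · simp only [Function.update_of_ne h]
        have : Measurable fun z : ℝ × (s → ℝ) => Function.updateFinset x s z.2 :=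
          measurable_updateFinset.comp measurable_snd
        exact (measurable_pi_apply j).comp this
    refine (lintegral_lintegral_rpow_le mg hr1 ?_).trans ?_
    -- The finiteness required by Minkowski: the polynomial is bounded on the closed polydisc by the
    -- sum of its coefficients in modulus.
    · refine ne_top_of_le_ne_top (b := ((ENNReal.ofReal (∑ d ∈ P.support, ‖P.coeff d‖)) ^ p)
        ^ (q / p)) ?_ ?_
      · exact ENNReal.rpow_ne_top_of_nonneg (by positivity)
          (ENNReal.rpow_ne_top_of_nonneg hp.le ENNReal.ofReal_ne_top)
      · refine (lintegral_mono (g := fun _ => ((ENNReal.ofReal (∑ d ∈ P.support, ‖P.coeff d‖))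
          ^ p) ^ (q / p)) fun y => ?_).trans_eq (by simp)
        refine ENNReal.rpow_le_rpow ?_ (by positivity)
        refine (lintegral_mono (g := fun _ => (ENNReal.ofReal (∑ d ∈ P.support, ‖P.coeff d‖))
          ^ p) fun t => ?_).trans_eq (by simp)
        refine ENNReal.rpow_le_rpow ?_ hp.le
        rw [← ofReal_norm]
        exact ENNReal.ofReal_le_ofReal (norm_eval_torusPt_le P hρ0 hρ1 _ _)
    · refine ENNReal.rpow_le_rpow (lintegral_mono fun t => ?_) (by positivity)
      have := ih (Function.update x i t)
      rw [lmarginal_update_of_notMem (hm s q) hi] at this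
      have h2 := ENNReal.rpow_le_rpow this (by positivity : 0 ≤ 1 / (q / p))
      rw [← ENNReal.rpow_mul, mul_one_div_cancel (by positivity), ENNReal.rpow_one] at h2
      refine le_trans (le_of_eq ?_) h2
      rw [lmarginal]
      simp only [Function.comp, ← ENNReal.rpow_mul]
      rw [mul_div_cancel₀ _ hp.ne']

end Tensor

/-! ### The Bohr correspondence between the line and the torus. -/

/-- The value `∑ cₙ χ(n)` of a Dirichlet polynomial at a character `χ`. -/
noncomputable def charEval (χ : ℕ+ →* ℂ) (c : ℕ+ →₀ ℂ) : ℂ := c.sum fun n z => z * χ n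

theorem charEval_single (χ : ℕ+ →* ℂ) (n : ℕ+) (z : ℂ) :
    charEval χ (Finsupp.single n z) = z * χ n := by
  simp [charEval]

theorem charEval_sum {κ : Type*} (χ : ℕ+ →* ℂ) (s : Finset κ) (c : κ → ℕ+ →₀ ℂ) :
    charEval χ (∑ i ∈ s, c i) = ∑ i ∈ s, charEval χ (c i) :=
  (Finsupp.sum_finsetSum_index (fun _ => zero_mul _) (fun _ _ _ => add_mul _ _ _)).symm

/-- Dirichlet convolution. The support is tracked because orthonormality of the characters will be
assumed only on `S`. -/
theorem exists_charEval_mul (S : Submonoid ℕ+) {a b : ℕ+ →₀ ℂ} (ha : ∀ n ∈ a.support, n ∈ S)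
    (hb : ∀ n ∈ b.support, n ∈ S) : ∃ c : ℕ+ →₀ ℂ, (∀ n ∈ c.support, n ∈ S) ∧
      ∀ χ, charEval χ c = charEval χ a * charEval χ b := by
  refine ⟨∑ n ∈ a.support, ∑ m ∈ b.support, Finsupp.single (n * m) (a n * b m), ?_, fun χ => ?_⟩
  · intro k hk
    obtain ⟨n, hn, hk⟩ := Finset.mem_biUnion.1 (Finsupp.support_finsetSum hk)
    obtain ⟨m, hm, hk⟩ := Finset.mem_biUnion.1 (Finsupp.support_finsetSum hk)
    rw [Finset.mem_singleton.1 (Finsupp.support_single_subset hk)]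
    exact S.mul_mem (ha n hn) (hb m hm)
  · simp only [charEval_sum, charEval_single, map_mul]
    simp only [charEval, Finsupp.sum, Finset.sum_mul_sum]
    exact Finset.sum_congr rfl fun n _ => Finset.sum_congr rfl fun m _ => by ring

theorem exists_charEval_pow (S : Submonoid ℕ+) {a : ℕ+ →₀ ℂ} (ha : ∀ n ∈ a.support, n ∈ S)
    (k : ℕ) : ∃ c : ℕ+ →₀ ℂ, (∀ n ∈ c.support, n ∈ S) ∧ ∀ χ, charEval χ c = charEval χ a ^ k := by
  induction k with
  | zero =>
    refine ⟨Finsupp.single 1 1, fun n hn => ?_, fun χ => by simp [charEval_single]⟩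
    rw [Finset.mem_singleton.1 (Finsupp.support_single_subset hn)]
    exact S.one_mem
  | succ k ih =>
    obtain ⟨c, hc, h⟩ := ih
    obtain ⟨d, hd, h'⟩ := exists_charEval_mul S hc ha
    exact ⟨d, hd, fun χ => by rw [h', h, pow_succ]⟩

/-- A family of random characters which are orthonormal on `S` in the limit along `l`. -/
structure AsympOrthonormal {Ω J : Type*} [MeasurableSpace Ω] (S : Submonoid ℕ+)
    (x : Ω → ℕ+ →* ℂ) (μ : J → Measure Ω) (l : Filter J) : Prop where
  meas : ∀ n, Measurable fun ω => x ω n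
  norm : ∀ ω n, ‖x ω n‖ = 1
  prob : ∀ᶠ j in l, IsProbabilityMeasure (μ j)
  orth : ∀ n ∈ S, ∀ m ∈ S, Tendsto (fun j => ∫ ω, x ω n * (starRingEnd ℂ) (x ω m) ∂μ j) l
    (𝓝 (if n = m then 1 else 0))

namespace AsympOrthonormal

variable {Ω J : Type*} [MeasurableSpace Ω] {S : Submonoid ℕ+} {x : Ω → ℕ+ →* ℂ}
  {μ : J → Measure Ω} {l : Filter J}

theorem measurable_charEval (h : AsympOrthonormal S x μ l) (a : ℕ+ →₀ ℂ) :
    Measurable fun ω => charEval (x ω) a := by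
  unfold charEval Finsupp.sum
  exact Finset.measurable_fun_sum _ fun n _ => (h.meas n).const_mul _

theorem norm_charEval_le (h : AsympOrthonormal S x μ l) (a : ℕ+ →₀ ℂ) (ω : Ω) :
    ‖charEval (x ω) a‖ ≤ ∑ n ∈ a.support, ‖a n‖ := by
  refine (norm_sum_le _ _).trans (Finset.sum_le_sum fun n _ => ?_)
  rw [norm_mul, h.norm, mul_one]

theorem tendsto_integral_sq (h : AsympOrthonormal S x μ l) {a : ℕ+ →₀ ℂ}
    (ha : ∀ n ∈ a.support, n ∈ S) :
    Tendsto (fun j => ∫ ω, ‖charEval (x ω) a‖ ^ 2 ∂μ j) l (𝓝 (∑ n ∈ a.support, ‖a n‖ ^ 2)) := by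
  have key : Tendsto (fun j => ((∫ ω, ‖charEval (x ω) a‖ ^ 2 ∂μ j : ℝ) : ℂ)) l
      (𝓝 (∑ n ∈ a.support, ∑ m ∈ a.support, a n * (starRingEnd ℂ) (a m) *
        if n = m then 1 else 0)) := by
    have h1 : Tendsto (fun j => ∑ n ∈ a.support, ∑ m ∈ a.support, a n * (starRingEnd ℂ) (a m) *
        ∫ ω, x ω n * (starRingEnd ℂ) (x ω m) ∂μ j) l
        (𝓝 (∑ n ∈ a.support, ∑ m ∈ a.support, a n * (starRingEnd ℂ) (a m) *
          if n = m then 1 else 0)) :=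
      tendsto_finsetSum _ fun n hn => tendsto_finsetSum _ fun m hm =>
        (h.orth n (ha n hn) m (ha m hm)).const_mul _
    refine h1.congr' ?_
    filter_upwards [h.prob] with j hj
    have hint : ∀ n m, Integrable (fun ω => x ω n * (starRingEnd ℂ) (x ω m)) (μ j) := fun n m => by
      refine Integrable.of_bound (C := 1) ?_ (Eventually.of_forall fun ω => ?_)
      · exact ((h.meas n).mul
          (Complex.continuous_conj.measurable.comp (h.meas m))).aestronglyMeasurable
      · rw [norm_mul, Complex.norm_conj, h.norm, h.norm, mul_one]
    rw [← integral_complex_ofReal]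
    simp only [← integral_const_mul]
    have : ∀ ω, ((‖charEval (x ω) a‖ ^ 2 : ℝ) : ℂ) = ∑ n ∈ a.support, ∑ m ∈ a.support,
        a n * (starRingEnd ℂ) (a m) * (x ω n * (starRingEnd ℂ) (x ω m)) := by
      intro ω
      rw [← Complex.normSq_eq_norm_sq, ← Complex.mul_conj, charEval, Finsupp.sum, map_sum,
        Finset.sum_mul_sum]
      refine Finset.sum_congr rfl fun n _ => Finset.sum_congr rfl fun m _ => ?_
      rw [map_mul]
      ring
    simp only [this]
    rw [integral_finsetSum _ fun n _ => integrable_finsetSum _ fun m _ => (hint n m).const_mul _]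
    refine Finset.sum_congr rfl fun n _ => ?_
    rw [integral_finsetSum _ fun m _ => (hint n m).const_mul _]
  have e : (∑ n ∈ a.support, ∑ m ∈ a.support, a n * (starRingEnd ℂ) (a m) *
      if n = m then 1 else 0) = ((∑ n ∈ a.support, ‖a n‖ ^ 2 : ℝ) : ℂ) := by
    push_cast
    refine Finset.sum_congr rfl fun n hn => ?_
    simp only [mul_ite, mul_one, mul_zero, Finset.sum_ite_eq, if_pos hn]
    rw [Complex.mul_conj, Complex.normSq_eq_norm_sq]
    push_cast
    ring
  rw [e] at key
  exact (Complex.continuous_re.tendsto _).comp key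

/-- `|D|^(2k) = |D^k|²`, and `D^k` is again a Dirichlet polynomial over `S`, so Parseval in the
limit expresses each moment by coefficients alone. `L` is fixed before the family, which makes two
families comparable. -/
theorem exists_tendsto_integral_poly (S : Submonoid ℕ+) {a : ℕ+ →₀ ℂ}
    (ha : ∀ n ∈ a.support, n ∈ S) (Q : Polynomial ℝ) : ∃ L : ℝ,
    ∀ {Ω J : Type} [MeasurableSpace Ω] {x : Ω → ℕ+ →* ℂ} {μ : J → Measure Ω} {l : Filter J},
      AsympOrthonormal S x μ l →
      Tendsto (fun j => ∫ ω, Q.eval (‖charEval (x ω) a‖ ^ 2) ∂μ j) l (𝓝 L) := by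
  choose c hc hc' using fun k => exists_charEval_pow S ha k
  refine ⟨∑ k ∈ Finset.range (Q.natDegree + 1), Q.coeff k * ∑ n ∈ (c k).support, ‖c k n‖ ^ 2,
    fun {Ω J _ x μ l} h => ?_⟩
  have h1 := tendsto_finsetSum (Finset.range (Q.natDegree + 1)) fun k _ =>
    (h.tendsto_integral_sq (hc k)).const_mul (Q.coeff k)
  refine h1.congr' ?_
  filter_upwards [h.prob] with j hj
  have : ∀ ω, Q.eval (‖charEval (x ω) a‖ ^ 2) = ∑ k ∈ Finset.range (Q.natDegree + 1),
      Q.coeff k * ‖charEval (x ω) (c k)‖ ^ 2 := by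
    intro ω
    rw [Polynomial.eval_eq_sum_range]
    refine Finset.sum_congr rfl fun k _ => ?_
    rw [hc', norm_pow, ← pow_mul, ← pow_mul, mul_comm 2 k]
  simp only [this]
  rw [integral_finsetSum]
  · simp only [integral_const_mul]
  · intro k _
    refine Integrable.const_mul ?_ _
    refine Integrable.of_bound (C := (∑ n ∈ (c k).support, ‖c k n‖) ^ 2)
      ((h.measurable_charEval _).norm.pow_const 2).aestronglyMeasurable
      (Eventually.of_forall fun ω => ?_)
    rw [norm_pow, norm_norm]
    exact pow_le_pow_left₀ (norm_nonneg _) (h.norm_charEval_le _ _) 2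

/-- The `L^r` means of a Dirichlet polynomial along a family of random characters depend only on
the asymptotic orthonormality of the family. -/
theorem tendsto_of_tendsto {Ω J Ω' J' : Type} [MeasurableSpace Ω] [MeasurableSpace Ω']
    {x : Ω → ℕ+ →* ℂ} {μ : J → Measure Ω} {l : Filter J} {x' : Ω' → ℕ+ →* ℂ}
    {μ' : J' → Measure Ω'} {l' : Filter J'} [l.NeBot]
    (h : AsympOrthonormal S x μ l) (h' : AsympOrthonormal S x' μ' l') {a : ℕ+ →₀ ℂ}
    (ha : ∀ n ∈ a.support, n ∈ S) {r : ℝ} (hr : 0 < r) {v : ℝ}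
    (hv : Tendsto (fun j => ∫ ω, ‖charEval (x ω) a‖ ^ r ∂μ j) l (𝓝 v)) :
    Tendsto (fun j => ∫ ω, ‖charEval (x' ω) a‖ ^ r ∂μ' j) l' (𝓝 v) := by
  rw [Metric.tendsto_nhds]
  intro ε hε
  set R := ∑ n ∈ a.support, ‖a n‖
  have hcont : ContinuousOn (fun u : ℝ => u ^ (r / 2)) (Set.Icc 0 (R ^ 2)) :=
    (Real.continuous_rpow_const (by positivity)).continuousOn
  -- Weierstrass approximation of `u ^ (r/2)` at `u = |D|²` reduces the `r`-th mean to even moments.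
  obtain ⟨Q, hQ⟩ := exists_polynomial_near_of_continuousOn 0 (R ^ 2) _ hcont (ε / 4) (by positivity)
  have near : ∀ {Ω J : Type} [MeasurableSpace Ω] {x : Ω → ℕ+ →* ℂ} {μ : J → Measure Ω}
      {l : Filter J}, AsympOrthonormal S x μ l → ∀ᶠ j in l,
      |∫ ω, Q.eval (‖charEval (x ω) a‖ ^ 2) ∂μ j - ∫ ω, ‖charEval (x ω) a‖ ^ r ∂μ j| ≤ ε / 4 := by
    intro Ω J _ x μ l h
    filter_upwards [h.prob] with j hj
    have hb : ∀ ω, |Q.eval (‖charEval (x ω) a‖ ^ 2) - ‖charEval (x ω) a‖ ^ r| ≤ ε / 4 := by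
      intro ω
      have hmem : ‖charEval (x ω) a‖ ^ 2 ∈ Set.Icc (0 : ℝ) (R ^ 2) :=
        ⟨by positivity, pow_le_pow_left₀ (norm_nonneg _) (h.norm_charEval_le a ω) 2⟩
      have h3 := hQ _ hmem
      have h4 : (‖charEval (x ω) a‖ ^ 2) ^ (r / 2) = ‖charEval (x ω) a‖ ^ r := by
        rw [← Real.rpow_natCast, ← Real.rpow_mul (norm_nonneg _)]
        congr 1
        push_cast
        ring
      simp only [h4] at h3
      exact h3.le
    have mc := h.measurable_charEval a
    have i2 : Integrable (fun ω => ‖charEval (x ω) a‖ ^ r) (μ j) := by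
      refine Integrable.of_bound (C := R ^ r) (mc.norm.pow_const r).aestronglyMeasurable
        (Eventually.of_forall fun ω => ?_)
      rw [Real.norm_of_nonneg (by positivity)]
      gcongr
      exact h.norm_charEval_le a ω
    have mQ : Measurable fun ω => Q.eval (‖charEval (x ω) a‖ ^ 2) :=
      Q.continuous.measurable.comp (mc.norm.pow_const 2)
    have i3 : Integrable (fun ω => Q.eval (‖charEval (x ω) a‖ ^ 2) - ‖charEval (x ω) a‖ ^ r)
        (μ j) :=
      Integrable.of_bound (C := ε / 4) (mQ.sub (mc.norm.pow_const r)).aestronglyMeasurable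
        (Eventually.of_forall hb)
    have i1 : Integrable (fun ω => Q.eval (‖charEval (x ω) a‖ ^ 2)) (μ j) := by
      refine (i3.add i2).congr (Eventually.of_forall fun ω => ?_)
      simp
    rw [← integral_sub i1 i2]
    have := norm_integral_le_of_norm_le_const (μ := μ j)
      (f := fun ω => Q.eval (‖charEval (x ω) a‖ ^ 2) - ‖charEval (x ω) a‖ ^ r)
      (Eventually.of_forall hb)
    simpa using this
  obtain ⟨L, hL⟩ := exists_tendsto_integral_poly S ha Q
  have hvL : |L - v| ≤ ε / 4 :=
    le_of_tendsto ((hL h).sub hv).abs (near h)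
  filter_upwards [near h', (Metric.tendsto_nhds.1 (hL h')) (ε / 4) (by positivity)] with j h1 h2
  rw [Real.dist_eq] at h2 ⊢
  rw [abs_le] at h1 hvL
  rw [abs_lt] at h2 ⊢
  constructor <;> linarith [h1.1, h1.2, hvL.1, hvL.2, h2.1, h2.2]

end AsympOrthonormal

/-- The character `n ↦ n^{-it}`. -/
noncomputable def lineHom (t : ℝ) : ℕ+ →* ℂ where
  toFun n := ((n : ℕ) : ℂ) ^ (-(Complex.I * (t : ℂ)))
  map_one' := by simp
  map_mul' n m := by
    rw [PNat.mul_coe, Nat.cast_mul, Complex.natCast_mul_natCast_cpow]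

theorem lineHom_apply (t : ℝ) (n : ℕ+) : lineHom t n = ((n : ℕ) : ℂ) ^ (-(Complex.I * (t : ℂ))) :=
  rfl

theorem lineHom_eq_lineChar (t : ℝ) (n : ℕ+) : lineHom t n = lineChar (-Real.log n) t := by
  have hn : ((n : ℕ) : ℂ) ≠ 0 := by exact_mod_cast n.ne_zero
  rw [lineHom_apply, Complex.cpow_def_of_ne_zero hn, lineChar, ← Complex.natCast_log]
  congr 1
  push_cast
  ring

theorem lineHom_mul_conj (t : ℝ) (n m : ℕ+) : lineHom t n * (starRingEnd ℂ) (lineHom t m)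
    = lineChar (Real.log m - Real.log n) t := by
  rw [lineHom_eq_lineChar, lineHom_eq_lineChar]
  simp only [lineChar]
  rw [← Complex.exp_conj, ← Complex.exp_add]
  congr 1
  simp only [map_mul, map_neg, Complex.conj_I, Complex.conj_ofReal, Complex.ofReal_sub,
    Complex.ofReal_neg]
  ring

theorem norm_lineChar (θ t : ℝ) : ‖lineChar θ t‖ = 1 := by
  have : (θ : ℂ) * Complex.I * (t : ℂ) = ((θ * t : ℝ) : ℂ) * Complex.I := by push_cast; ring
  rw [lineChar, this, Complex.norm_exp_ofReal_mul_I]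

theorem tendsto_mean_lineChar (θ : ℝ) :
    Tendsto (fun T : ℝ => ((1 / (2 * T) : ℝ) : ℂ) * ∫ t in (-T)..T, lineChar θ t)
      atTop (𝓝 (if θ = 0 then 1 else 0)) := by
  split_ifs with h
  · refine tendsto_const_nhds.congr' ?_
    filter_upwards [eventually_gt_atTop (0 : ℝ)] with T hT
    have hT' : (T : ℂ) ≠ 0 := by exact_mod_cast hT.ne'
    simp [lineChar, h]
    field_simp
    norm_num
  · have hc : (θ : ℂ) * Complex.I ≠ 0 := mul_ne_zero (by exact_mod_cast h) Complex.I_ne_zero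
    have hb : ∀ T : ℝ, ‖∫ t in (-T)..T, lineChar θ t‖ ≤ 2 / ‖(θ : ℂ) * Complex.I‖ := by
      intro T
      have h1 := norm_lineChar θ T
      have h2 := norm_lineChar θ (-T)
      unfold lineChar at *
      rw [integral_exp_mul_complex hc, norm_div]
      gcongr
      refine (norm_sub_le _ _).trans ?_
      rw [h1, h2]
      norm_num
    have hz : Tendsto (fun T : ℝ => 1 / (2 * T) * (2 / ‖(θ : ℂ) * Complex.I‖)) atTop (𝓝 0) := by
      have h1 : Tendsto (fun T : ℝ => 2 * T) atTop atTop :=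
        tendsto_id.const_mul_atTop (by norm_num)
      simpa using (h1.inv_tendsto_atTop).mul_const (2 / ‖(θ : ℂ) * Complex.I‖)
    refine squeeze_zero_norm' ?_ hz
    filter_upwards [eventually_gt_atTop (0 : ℝ)] with T hT
    rw [norm_mul, Complex.norm_real, Real.norm_of_nonneg (by positivity)]
    gcongr
    exact hb T

/-- The uniform probability measure on the interval `(-T, T]`. -/
noncomputable def lineMeasure (T : ℝ) : Measure ℝ :=
  ENNReal.ofReal (1 / (2 * T)) • volume.restrict (Set.Ioc (-T) T)

theorem integral_lineMeasure {E : Type*} [NormedAddCommGroup E] [NormedSpace ℝ E] {T : ℝ}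
    (hT : 0 < T) (f : ℝ → E) :
    ∫ t, f t ∂lineMeasure T = (1 / (2 * T)) • ∫ t in (-T)..T, f t := by
  rw [lineMeasure, integral_smul_measure, intervalIntegral.integral_of_le (by linarith),
    ENNReal.toReal_ofReal (by positivity)]

theorem asympOrthonormal_line (S : Submonoid ℕ+) :
    AsympOrthonormal S lineHom lineMeasure atTop where
  meas n := by
    simp only [lineHom_eq_lineChar]
    exact (lineChar_continuous _).measurable
  norm t n := by rw [lineHom_eq_lineChar, norm_lineChar]
  prob := by
    filter_upwards [eventually_gt_atTop (0 : ℝ)] with T hT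
    refine ⟨?_⟩
    rw [lineMeasure, Measure.smul_apply, Measure.restrict_apply MeasurableSet.univ, Set.univ_inter,
      Real.volume_Ioc, smul_eq_mul, ← ENNReal.ofReal_mul (by positivity),
      show 1 / (2 * T) * (T - -T) = 1 by field_simp; ring, ENNReal.ofReal_one]
  orth n _ m _ := by
    have h := tendsto_mean_lineChar (Real.log m - Real.log n)
    have e : (Real.log m - Real.log n = 0) ↔ n = m := by
      rw [sub_eq_zero]
      constructor
      · intro h
        have := Real.log_injOn_pos (Set.mem_Ioi.2 (by exact_mod_cast m.pos))
          (Set.mem_Ioi.2 (by exact_mod_cast n.pos)) h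
        exact PNat.eq (by exact_mod_cast this.symm)
      · rintro rfl; rfl
    simp only [e] at h
    refine h.congr' ?_
    filter_upwards [eventually_gt_atTop (0 : ℝ)] with T hT
    rw [integral_lineMeasure hT]
    simp only [lineHom_mul_conj, Complex.real_smul]

theorem hardyNorm_nonneg {r : ℝ} (hr : 0 < r) (a : ℕ+ →₀ ℂ) : 0 ≤ hardyNorm r a := by
  refine ge_of_tendsto (tendsto_hardyMean hr a) ?_
  filter_upwards [eventually_gt_atTop (0 : ℝ)] with T hT
  refine Real.rpow_nonneg (mul_nonneg (by positivity) ?_) _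
  exact intervalIntegral.integral_nonneg (by linarith) fun t _ => by positivity

/-- The **Bohr correspondence**: the Hardy norm as an integral over a space of characters. -/
theorem hardyNorm_eq_integral {Ω : Type} [MeasurableSpace Ω] {S : Submonoid ℕ+}
    {x : Ω → ℕ+ →* ℂ} {μ : Measure Ω} (h : AsympOrthonormal S x (fun _ : ℕ => μ) atTop)
    {a : ℕ+ →₀ ℂ} (ha : ∀ n ∈ a.support, n ∈ S) {r : ℝ} (hr : 0 < r) :
    hardyNorm r a = (∫ ω, ‖charEval (x ω) a‖ ^ r ∂μ) ^ (1 / r) := by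
  have h1 : Tendsto (fun T => ∫ t, ‖charEval (lineHom t) a‖ ^ r ∂lineMeasure T) atTop
      (𝓝 (hardyNorm r a ^ r)) := by
    refine ((tendsto_hardyMean hr a).rpow_const (Or.inr hr.le)).congr' ?_
    filter_upwards [eventually_gt_atTop (0 : ℝ)] with T hT
    have hnn : 0 ≤ ∫ t in (-T)..T, ‖dirichletPoly a (Complex.I * t)‖ ^ r :=
      intervalIntegral.integral_nonneg (by linarith) fun t _ => by positivity
    rw [hardyMean, ← Real.rpow_mul (by positivity), one_div_mul_cancel hr.ne', Real.rpow_one,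
      integral_lineMeasure hT]
    rfl
  have h2 := tendsto_nhds_unique
    ((asympOrthonormal_line S).tendsto_of_tendsto h ha hr h1) tendsto_const_nhds
  rw [← h2, ← Real.rpow_mul (hardyNorm_nonneg hr a), mul_one_div_cancel hr.ne', Real.rpow_one]

/-- The positive integers all of whose prime factors are in `s`. -/
def factoredSubmonoid (s : Finset ℕ) : Submonoid ℕ+ where
  carrier := {n | ∀ p, p ∉ s → (n : ℕ).factorization p = 0}
  one_mem' := by simp
  mul_mem' {n m} hn hm p hp := by
    rw [PNat.mul_coe, Nat.factorization_mul n.ne_zero m.ne_zero, Finsupp.add_apply, hn p hp,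
      hm p hp]

/-- The character with value `exp(iθ_p)` at the prime `p` in `s`. -/
noncomputable def torusHom (s : Finset ℕ) (θ : s → ℝ) : ℕ+ →* ℂ where
  toFun n := ∏ i : s, polarPt 1 (θ i) ^ (n : ℕ).factorization i
  map_one' := by simp
  map_mul' n m := by
    rw [← Finset.prod_mul_distrib]
    refine Finset.prod_congr rfl fun i _ => ?_
    rw [PNat.mul_coe, Nat.factorization_mul n.ne_zero m.ne_zero, Finsupp.add_apply, pow_add]

theorem torusHom_apply (s : Finset ℕ) (θ : s → ℝ) (n : ℕ+) :
    torusHom s θ n = ∏ i : s, polarPt 1 (θ i) ^ (n : ℕ).factorization i := rfl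

theorem norm_torusHom (s : Finset ℕ) (θ : s → ℝ) (n : ℕ+) : ‖torusHom s θ n‖ = 1 := by
  rw [torusHom_apply, norm_prod]
  refine Finset.prod_eq_one fun i _ => ?_
  rw [norm_pow, norm_polarPt zero_le_one, one_pow]

theorem integral_polarPt_pow (a b : ℕ) :
    ∫ θ, polarPt 1 θ ^ a * (starRingEnd ℂ) (polarPt 1 θ ^ b) ∂circ = if a = b then 1 else 0 := by
  have e : ∀ θ, polarPt 1 θ ^ a * (starRingEnd ℂ) (polarPt 1 θ ^ b)
      = Complex.exp ((((a : ℂ) - b) * Complex.I) * θ) := by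
    intro θ
    simp only [polarPt, Complex.ofReal_one, one_mul, ← Complex.exp_conj,
      ← Complex.exp_nat_mul]
    rw [← Complex.exp_add]
    congr 1
    simp
    ring
  simp only [e]
  split_ifs with h
  · subst h; simp
  · have hab : (a : ℂ) - b ≠ 0 := sub_ne_zero.2 (by exact_mod_cast h)
    have h1 : Complex.exp (((a : ℂ) - b) * Complex.I * ((2 * Real.pi : ℝ) : ℂ)) = 1 := by
      rw [Complex.exp_eq_one_iff]
      exact ⟨(a : ℤ) - b, by push_cast; ring⟩
    rw [integral_circ, integral_exp_mul_complex (mul_ne_zero hab Complex.I_ne_zero), h1]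
    simp

/-- The integral factors over the primes, and two distinct elements of the submonoid differ in the
exponent of some prime in `s`. Orthonormality is exact, hence the constant family of measures. -/
theorem asympOrthonormal_torus (s : Finset ℕ) : AsympOrthonormal (factoredSubmonoid s)
    (torusHom s) (fun _ : ℕ => Measure.pi fun _ : s => circ) atTop where
  meas n := by
    simp only [torusHom_apply]
    refine Finset.measurable_fun_prod _ fun i _ => ?_
    exact ((continuous_polarPt_right 1).measurable.comp (measurable_pi_apply i)).pow_const _
  norm := norm_torusHom s
  prob := Eventually.of_forall fun _ => inferInstance
  orth n hn m hm := by
    refine tendsto_const_nhds.congr fun _ => ?_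
    have e : ∀ θ : s → ℝ, torusHom s θ n * (starRingEnd ℂ) (torusHom s θ m)
        = ∏ i : s, (polarPt 1 (θ i) ^ (n : ℕ).factorization i
          * (starRingEnd ℂ) (polarPt 1 (θ i) ^ (m : ℕ).factorization i)) := by
      intro θ
      rw [torusHom_apply, torusHom_apply, map_prod, Finset.prod_mul_distrib]
    simp only [e]
    rw [integral_fintype_prod_eq_prod (fun (i : s) (θ : ℝ) => polarPt 1 θ ^ (n : ℕ).factorization i
          * (starRingEnd ℂ) (polarPt 1 θ ^ (m : ℕ).factorization i))]
    simp only [integral_polarPt_pow]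
    split_ifs with h
    · subst h; simp
    · have : ∃ i : s, (n : ℕ).factorization i ≠ (m : ℕ).factorization i := by
        by_contra! hcon
        refine h (PNat.eq (Nat.eq_of_factorization_eq n.ne_zero m.ne_zero fun p => ?_))
        by_cases hp : p ∈ s
        · exact hcon ⟨p, hp⟩
        · rw [hn p hp, hm p hp]
      obtain ⟨i, hi⟩ := this
      exact (Finset.prod_eq_zero (Finset.mem_univ i) (if_neg hi)).symm

theorem mem_factoredSubmonoid_range {n : ℕ+} {M : ℕ} (h : (n : ℕ) < M) :
    n ∈ factoredSubmonoid (Finset.range M) := by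
  intro p hp
  rw [Finset.mem_range, not_lt] at hp
  exact Nat.factorization_eq_zero_of_lt (h.trans_le hp)

/-- A range containing the support of `a`. -/
theorem exists_support_lt (a : ℕ+ →₀ ℂ) : ∃ M : ℕ, ∀ n ∈ a.support, (n : ℕ) < M :=
  ⟨a.support.sup (fun n => (n : ℕ)) + 1, fun _ hn =>
    Nat.lt_succ_of_le (Finset.le_sup (f := fun n : ℕ+ => (n : ℕ)) hn)⟩

theorem exists_support_subset (a : ℕ+ →₀ ℂ) :
    ∃ s : Finset ℕ, ∀ n ∈ a.support, n ∈ factoredSubmonoid s := by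
  obtain ⟨M, hM⟩ := exists_support_lt a
  exact ⟨_, fun n hn => mem_factoredSubmonoid_range (hM n hn)⟩

/-! ### Norm properties and isometries of the Hardy norm. -/

theorem charEval_add (χ : ℕ+ →* ℂ) (a b : ℕ+ →₀ ℂ) :
    charEval χ (a + b) = charEval χ a + charEval χ b :=
  Finsupp.sum_add_index' (fun _ => zero_mul _) fun _ _ _ => add_mul _ _ _

theorem charEval_smul (χ : ℕ+ →* ℂ) (c : ℂ) (a : ℕ+ →₀ ℂ) :
    charEval χ (c • a) = c * charEval χ a := by
  rw [charEval, Finsupp.sum_smul_index fun _ => zero_mul _, charEval, Finsupp.mul_sum]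
  simp only [mul_assoc]

theorem hardyNorm_eq_eLpNorm {Ω : Type} [MeasurableSpace Ω] {S : Submonoid ℕ+}
    {x : Ω → ℕ+ →* ℂ} {μ : Measure Ω} [IsProbabilityMeasure μ]
    (h : AsympOrthonormal S x (fun _ : ℕ => μ) atTop)
    {a : ℕ+ →₀ ℂ} (ha : ∀ n ∈ a.support, n ∈ S) {r : ℝ} (hr : 0 < r) :
    ENNReal.ofReal (hardyNorm r a)
      = eLpNorm (fun ω => charEval (x ω) a) (ENNReal.ofReal r) μ := by
  have hb : Integrable (fun ω => ‖charEval (x ω) a‖ ^ r) μ := by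
    refine Integrable.of_bound (C := (∑ n ∈ a.support, ‖a n‖) ^ r)
      ((h.measurable_charEval a).norm.pow_const r).aestronglyMeasurable
      (Eventually.of_forall fun ω => ?_)
    rw [Real.norm_of_nonneg (by positivity)]
    gcongr
    exact h.norm_charEval_le a ω
  rw [eLpNorm_eq_lintegral_rpow_enorm_toReal (by simpa using hr) ENNReal.ofReal_ne_top,
    ENNReal.toReal_ofReal hr.le, lintegral_enorm_rpow_eq_ofReal hr.le hb,
    hardyNorm_eq_integral h ha hr, ENNReal.ofReal_rpow_of_nonneg
      (integral_nonneg fun _ => by positivity) (by positivity)]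

theorem exists_torus (s : Finset (ℕ+ →₀ ℂ)) : ∃ t : Finset ℕ, ∀ a ∈ s, ∀ n ∈ a.support,
    n ∈ factoredSubmonoid t := by
  choose f hf using exists_support_subset
  refine ⟨s.biUnion f, fun a ha n hn p hp => hf a n hn p fun h => hp ?_⟩
  exact Finset.mem_biUnion.2 ⟨a, ha, h⟩

theorem hardyNorm_add_le {r : ℝ} (hr : 1 ≤ r) (a b : ℕ+ →₀ ℂ) :
    hardyNorm r (a + b) ≤ hardyNorm r a + hardyNorm r b := by
  classical
  have hr0 : 0 < r := by linarith
  obtain ⟨t, ht⟩ := exists_torus {a, b, a + b}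
  have h := asympOrthonormal_torus t
  have ea := hardyNorm_eq_eLpNorm h (ht a (by simp)) hr0
  have eb := hardyNorm_eq_eLpNorm h (ht b (by simp)) hr0
  have eab := hardyNorm_eq_eLpNorm h (ht (a + b) (by simp)) hr0
  rw [← ENNReal.ofReal_le_ofReal_iff (add_nonneg (hardyNorm_nonneg hr0 a) (hardyNorm_nonneg hr0 b)),
    ENNReal.ofReal_add (hardyNorm_nonneg hr0 a) (hardyNorm_nonneg hr0 b), ea, eb, eab]
  simp only [charEval_add]
  exact eLpNorm_add_le (h.measurable_charEval a).aestronglyMeasurable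
    (h.measurable_charEval b).aestronglyMeasurable (by simpa using hr)

theorem hardyNorm_smul {r : ℝ} (hr : 0 < r) (c : ℂ) (a : ℕ+ →₀ ℂ) :
    hardyNorm r (c • a) = ‖c‖ * hardyNorm r a := by
  classical
  obtain ⟨t, ht⟩ := exists_torus {a, c • a}
  have h := asympOrthonormal_torus t
  rw [hardyNorm_eq_integral h (ht a (by simp)) hr, hardyNorm_eq_integral h (ht (c • a) (by simp)) hr]
  simp only [charEval_smul, norm_mul, Real.mul_rpow (norm_nonneg _) (norm_nonneg _)]
  rw [integral_const_mul, Real.mul_rpow (by positivity) (integral_nonneg fun _ => by positivity),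
    ← Real.rpow_mul (norm_nonneg _), mul_one_div_cancel hr.ne', Real.rpow_one]

theorem hardyNorm_zero {r : ℝ} (hr : 0 < r) : hardyNorm r 0 = 0 := by
  simpa using hardyNorm_smul hr 0 0

theorem hardyNorm_sum_le {κ : Type*} {r : ℝ} (hr : 1 ≤ r) (s : Finset κ) (a : κ → ℕ+ →₀ ℂ) :
    hardyNorm r (∑ i ∈ s, a i) ≤ ∑ i ∈ s, hardyNorm r (a i) := by
  classical
  induction s using Finset.induction with
  | empty => simp [hardyNorm_zero (by linarith : 0 < r)]
  | insert i s hi ih =>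
    rw [Finset.sum_insert hi, Finset.sum_insert hi]
    exact (hardyNorm_add_le hr _ _).trans (by gcongr)

/-- The coefficientwise product of `m` and `a`. -/
noncomputable def coeffMul (m : ℕ+ → ℂ) (a : ℕ+ →₀ ℂ) : ℕ+ →₀ ℂ :=
  Finsupp.onFinset a.support (fun n => m n * a n) fun n h => by
    rw [Finsupp.mem_support_iff]
    exact right_ne_zero_of_mul h

@[simp]
theorem coeffMul_apply (m : ℕ+ → ℂ) (a : ℕ+ →₀ ℂ) (n : ℕ+) : coeffMul m a n = m n * a n := rfl

theorem support_coeffMul_subset (m : ℕ+ → ℂ) (a : ℕ+ →₀ ℂ) :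
    (coeffMul m a).support ⊆ a.support := Finsupp.support_onFinset_subset

theorem charEval_coeffMul (χ : ℕ+ →* ℂ) (m : ℕ+ → ℂ) (a : ℕ+ →₀ ℂ) :
    charEval χ (coeffMul m a) = ∑ n ∈ a.support, m n * a n * χ n := by
  rw [charEval, Finsupp.sum_of_support_subset _ (support_coeffMul_subset m a) _ (by simp)]
  rfl

theorem charEval_coeffMul_hom (χ ψ : ℕ+ →* ℂ) (a : ℕ+ →₀ ℂ) :
    charEval χ (coeffMul ψ a) = charEval (χ * ψ) a := by
  rw [charEval_coeffMul, charEval, Finsupp.sum]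
  refine Finset.sum_congr rfl fun n _ => ?_
  rw [MonoidHom.mul_apply]
  ring

/-- Twisting with a unimodular character is an isometry. -/
theorem hardyNorm_twist {r : ℝ} (hr : 0 < r) {χ : ℕ+ →* ℂ} (hχ : ∀ n, ‖χ n‖ = 1)
    (a : ℕ+ →₀ ℂ) : hardyNorm r (coeffMul χ a) = hardyNorm r a := by
  obtain ⟨t, ht⟩ := exists_support_subset a
  have h := asympOrthonormal_torus t
  -- The twisted characters are again orthonormal, so they compute the same norm.
  have h' : AsympOrthonormal (factoredSubmonoid t) (fun θ => torusHom t θ * χ)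
      (fun _ : ℕ => Measure.pi fun _ : t => circ) atTop := by
    refine ⟨fun n => ?_, fun θ n => ?_, h.prob, fun n hn m hm => ?_⟩
    · simpa using (h.meas n).mul_const (χ n)
    · simp [h.norm, hχ]
    · have h1 := (h.orth n hn m hm).const_mul (χ n * (starRingEnd ℂ) (χ m))
      have e : χ n * (starRingEnd ℂ) (χ m) * (if n = m then 1 else 0) = if n = m then 1 else 0 := by
        split_ifs with hnm
        · subst hnm
          rw [Complex.mul_conj, Complex.normSq_eq_norm_sq, hχ]
          simp
        · simp
      rw [e] at h1
      refine h1.congr fun _ => ?_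
      rw [← integral_const_mul]
      refine integral_congr_ae (Eventually.of_forall fun θ => ?_)
      simp only [MonoidHom.mul_apply, map_mul]
      ring
  rw [hardyNorm_eq_integral h' ht hr,
    hardyNorm_eq_integral h (fun n hn => ht n (support_coeffMul_subset _ _ hn)) hr]
  simp only [charEval_coeffMul_hom]

/-- Multiplication by `k^{-s}` is an isometry. -/
theorem hardyNorm_shift {r : ℝ} (hr : 0 < r) (k : ℕ+) (a : ℕ+ →₀ ℂ) :
    hardyNorm r (a.mapDomain (k * ·)) = hardyNorm r a := by
  classical
  obtain ⟨t, ht⟩ := exists_torus {a, a.mapDomain (k * ·)}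
  have h := asympOrthonormal_torus t
  rw [hardyNorm_eq_integral h (ht a (by simp)) hr,
    hardyNorm_eq_integral h (ht (a.mapDomain (k * ·)) (by simp)) hr]
  have e : ∀ χ : ℕ+ →* ℂ, charEval χ (a.mapDomain (k * ·)) = χ k * charEval χ a := by
    intro χ
    rw [charEval, Finsupp.sum_mapDomain_index (fun _ => zero_mul _) (fun _ _ _ => add_mul _ _ _),
      charEval, Finsupp.mul_sum]
    simp only [map_mul]
    exact Finset.sum_congr rfl fun n _ => by ring
  simp only [e, norm_mul, h.norm, one_mul]

/-! ### Weissler's inequality for Dirichlet polynomials. -/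

/-- The number of prime factors with multiplicity. -/
noncomputable def bigOmega (n : ℕ+) : ℕ := (n : ℕ).factorization.sum fun _ k => k

/-- The two cases are the two sides of the inequality on the torus: radius `ρ` in every coordinate
yields `ρ ^ Ω(n)`, radius `1` yields `1`. -/
theorem prod_torusPt (ρ : ℝ) {s t : Finset ℕ} (hst : s = t ∨ s = ∅) (θ : ℕ → ℝ) {n : ℕ+}
    (hn : n ∈ factoredSubmonoid t) :
    ∏ i ∈ (n : ℕ).factorization.support, torusPt ρ s θ i ^ (n : ℕ).factorization i
      = (if s = ∅ then 1 else (ρ : ℂ) ^ bigOmega n) * torusHom t (fun i => θ i) n := by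
  have hsub : (n : ℕ).factorization.support ⊆ t := fun p hp => by
    by_contra h
    exact (Finsupp.mem_support_iff.1 hp) (hn p h)
  have e1 : torusHom t (fun i => θ i) n
      = ∏ i ∈ (n : ℕ).factorization.support, polarPt 1 (θ i) ^ (n : ℕ).factorization i := by
    rw [torusHom_apply, Finset.prod_coe_sort t fun i => polarPt 1 (θ i) ^ (n : ℕ).factorization i]
    refine (Finset.prod_subset hsub fun i _ hi => ?_).symm
    rw [Finsupp.notMem_support_iff.1 hi, pow_zero]
  rw [e1]
  rcases eq_or_ne s ∅ with rfl | hs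
  · simp [torusPt]
  · rw [if_neg hs, bigOmega, Finsupp.sum, ← Finset.prod_pow_eq_pow_sum, ← Finset.prod_mul_distrib]
    refine Finset.prod_congr rfl fun i hi => ?_
    obtain rfl := hst.resolve_right hs
    rw [torusPt, if_pos (hsub hi), ← mul_pow]
    simp [polarPt]

/-- The contraction from `ℋ_p` to `ℋ_q` given by a power of the number of prime factors. -/
theorem hardyNorm_weissler {p q : ℝ} (hp : 0 < p) (hpq : p ≤ q) (a : ℕ+ →₀ ℂ) :
    hardyNorm q (coeffMul (fun n => ((√(p / q) : ℝ) : ℂ) ^ bigOmega n) a) ≤ hardyNorm p a := by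
  classical
  have hq : 0 < q := hp.trans_le hpq
  obtain ⟨t', ht'⟩ := exists_support_subset a
  -- The prime `2` is added only to make `t` nonempty, since `prod_torusPt` tells its two cases
  -- apart by `s = ∅`.
  set t := insert 2 t' with htdef
  have ht : ∀ n ∈ a.support, n ∈ factoredSubmonoid t := fun n hn p hp =>
    ht' n hn p fun h => hp (Finset.mem_insert_of_mem h)
  have htne : t ≠ ∅ := Finset.insert_ne_empty _ _
  have h := asympOrthonormal_torus t
  set ρ := √(p / q) with hρ
  set b := coeffMul (fun n => (ρ : ℂ) ^ bigOmega n) a with hb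
  have hbt : ∀ n ∈ b.support, n ∈ factoredSubmonoid t := fun n hn =>
    ht n (support_coeffMul_subset _ _ hn)
  set P : MvPolynomial ℕ ℂ := ∑ n ∈ a.support, MvPolynomial.monomial (n : ℕ).factorization (a n)
    with hP
  have hev : ∀ (s : Finset ℕ), s = t ∨ s = ∅ → ∀ θ : ℕ → ℝ,
      MvPolynomial.eval (torusPt ρ s θ) P = ∑ n ∈ a.support,
        (if s = ∅ then 1 else (ρ : ℂ) ^ bigOmega n) * a n * torusHom t (fun i => θ i) n := by
    intro s hs θ
    rw [hP, map_sum]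
    refine Finset.sum_congr rfl fun n hn => ?_
    rw [MvPolynomial.eval_monomial, Finsupp.prod, prod_torusPt ρ hs θ (ht n hn)]
    ring
  have key := weissler_lmarginal P hp hpq t (fun _ => 0)
  simp only [lmarginal] at key
  have hupd : ∀ y : t → ℝ, (fun i : t => Function.updateFinset (fun _ : ℕ => (0 : ℝ)) t y i) = y :=
    fun y => by funext i; simp [Function.updateFinset]
  have e1 : ∀ y : t → ℝ, MvPolynomial.eval (torusPt ρ t
      (Function.updateFinset (fun _ => 0) t y)) P = charEval (torusHom t y) b := by
    intro y
    rw [hev t (Or.inl rfl), hb, charEval_coeffMul, hupd]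
    simp only [if_neg htne]
  have e2 : ∀ y : t → ℝ, MvPolynomial.eval (torusPt ρ ∅
      (Function.updateFinset (fun _ => 0) t y)) P = charEval (torusHom t y) a := by
    intro y
    rw [hev ∅ (Or.inr rfl), hupd]
    simp [charEval, Finsupp.sum]
  rw [← hρ] at key
  simp only [e1, e2] at key
  rw [← ENNReal.ofReal_le_ofReal_iff (hardyNorm_nonneg hp a), hardyNorm_eq_eLpNorm h ht hp,
    hardyNorm_eq_eLpNorm h hbt hq,
    eLpNorm_eq_lintegral_rpow_enorm_toReal (by simpa using hq) ENNReal.ofReal_ne_top,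
    eLpNorm_eq_lintegral_rpow_enorm_toReal (by simpa using hp) ENNReal.ofReal_ne_top,
    ENNReal.toReal_ofReal hq.le, ENNReal.toReal_ofReal hp.le]
  refine (ENNReal.rpow_le_rpow key (by positivity)).trans_eq ?_
  rw [← ENNReal.rpow_mul]
  congr 1
  field_simp

/-! ### Projections defined by additive weights and the partial sum operator on one space. -/

/-- The completely additive function with value `w p` at the prime `p`. -/
noncomputable def addWeight (w : ℕ → ℕ) (n : ℕ+) : ℕ := (n : ℕ).factorization.sum fun p k => k * w p

theorem addWeight_one (w : ℕ → ℕ) : addWeight w 1 = 0 := by simp [addWeight]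

theorem addWeight_mul (w : ℕ → ℕ) (n m : ℕ+) :
    addWeight w (n * m) = addWeight w n + addWeight w m := by
  rw [addWeight, PNat.mul_coe, Nat.factorization_mul n.ne_zero m.ne_zero]
  exact Finsupp.sum_add_index' (fun _ => zero_mul _) fun _ _ _ => add_mul _ _ _

theorem bigOmega_eq_addWeight (n : ℕ+) : bigOmega n = addWeight (fun _ => 1) n := by
  simp [bigOmega, addWeight]

/-- The character `n ↦ z ^ κ(n)` for the completely additive function `κ` with weights `w`. -/
noncomputable def powHom (w : ℕ → ℕ) (z : ℂ) : ℕ+ →* ℂ where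
  toFun n := z ^ addWeight w n
  map_one' := by rw [addWeight_one, pow_zero]
  map_mul' n m := by rw [addWeight_mul, pow_add]

theorem powHom_apply (w : ℕ → ℕ) (z : ℂ) (n : ℕ+) : powHom w z n = z ^ addWeight w n := rfl

theorem sum_root_pow {R : ℕ} {ζ : ℂ} (hζ : IsPrimitiveRoot ζ R) {i j : ℕ} (hi : i < R)
    (hj : j < R) : ∑ k ∈ Finset.range R, (ζ⁻¹ ^ k) ^ j * (ζ ^ k) ^ i = if i = j then (R : ℂ) else 0 := by
  have hR : R ≠ 0 := by omega
  have h0 : ζ ≠ 0 := hζ.ne_zero hR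
  have e : ∀ k, (ζ⁻¹ ^ k) ^ j * (ζ ^ k) ^ i = (ζ⁻¹ ^ j * ζ ^ i) ^ k := fun k => by
    rw [mul_pow, ← pow_mul, ← pow_mul, ← pow_mul, ← pow_mul, mul_comm k, mul_comm k]
  simp only [e]
  split_ifs with h
  · subst h
    rw [← mul_pow, inv_mul_cancel₀ h0]
    simp
  · have hne : ζ⁻¹ ^ j * ζ ^ i ≠ 1 := by
      intro h1
      refine h (hζ.pow_inj hi hj ?_)
      rw [inv_pow, inv_mul_eq_one₀ (pow_ne_zero _ h0)] at h1
      exact h1.symm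
    rw [geom_sum_eq hne, mul_pow, ← pow_mul, ← pow_mul, mul_comm j, mul_comm i, pow_mul, pow_mul,
      inv_pow, hζ.pow_eq_one]
    simp

/-- Restriction to the frequencies in `A` by averaging over roots of unity. -/
theorem hardyNorm_filter_le {r : ℝ} (hr : 1 ≤ r) (w : ℕ → ℕ) (a : ℕ+ →₀ ℂ) {R : ℕ} {ζ : ℂ}
    (hζ : IsPrimitiveRoot ζ R) (ha : ∀ n ∈ a.support, addWeight w n < R) {A : Finset ℕ}
    (hA : ∀ j ∈ A, j < R) :
    hardyNorm r (a.filter fun n => addWeight w n ∈ A)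
      ≤ (1 / (R : ℝ) * ∑ k ∈ Finset.range R, ‖∑ j ∈ A, (ζ⁻¹ ^ k) ^ j‖) * hardyNorm r a := by
  have hr0 : 0 < r := by linarith
  rcases eq_or_ne a 0 with rfl | ha0
  · have : (0 : ℕ+ →₀ ℂ).filter (fun n => addWeight w n ∈ A) = 0 := by
      ext n; simp [Finsupp.filter_apply]
    rw [this, hardyNorm_zero hr0, mul_zero]
  have hR : R ≠ 0 := by
    obtain ⟨n, hn⟩ := Finsupp.support_nonempty_iff.2 ha0
    have := ha n hn
    omega
  have hRc : (R : ℂ) ≠ 0 := by exact_mod_cast hR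
  have hζ1 : ‖ζ‖ = 1 := hζ.norm'_eq_one hR
  have e : a.filter (fun n => addWeight w n ∈ A) = ∑ k ∈ Finset.range R,
      ((1 / (R : ℂ)) * ∑ j ∈ A, (ζ⁻¹ ^ k) ^ j) • coeffMul (powHom w (ζ ^ k)) a := by
    ext n
    rw [Finsupp.finsetSum_apply]
    simp only [Finsupp.smul_apply, coeffMul_apply, smul_eq_mul, powHom_apply]
    by_cases hn : a n = 0
    · simp [Finsupp.filter_apply, hn]
    have hlt := ha n (Finsupp.mem_support_iff.2 hn)
    have h1 : ∑ k ∈ Finset.range R, (1 / (R : ℂ) * ∑ j ∈ A, (ζ⁻¹ ^ k) ^ j) *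
        ((ζ ^ k) ^ addWeight w n * a n)
        = 1 / (R : ℂ) * (∑ j ∈ A, ∑ k ∈ Finset.range R,
          (ζ⁻¹ ^ k) ^ j * (ζ ^ k) ^ addWeight w n) * a n := by
      rw [Finset.sum_comm, Finset.mul_sum, Finset.sum_mul]
      refine Finset.sum_congr rfl fun k _ => ?_
      rw [← Finset.sum_mul]
      ring
    rw [h1, Finset.sum_congr rfl fun j hj => sum_root_pow hζ hlt (hA j hj), Finset.sum_ite_eq,
      Finsupp.filter_apply]
    split_ifs
    · field_simp
    · simp
  rw [e]
  refine (hardyNorm_sum_le hr _ _).trans_eq ?_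
  rw [Finset.mul_sum, Finset.sum_mul]
  refine Finset.sum_congr rfl fun k _ => ?_
  rw [hardyNorm_smul hr0, hardyNorm_twist hr0, norm_mul]
  · simp
  · intro n
    rw [powHom_apply, norm_pow, norm_pow, hζ1, one_pow, one_pow]

theorem exists_weight_bound (w : ℕ → ℕ) (a : ℕ+ →₀ ℂ) :
    ∃ R : ℕ, ∀ n ∈ a.support, addWeight w n < R :=
  ⟨a.support.sup (addWeight w) + 1, fun _ hn =>
    Nat.lt_succ_of_le (Finset.le_sup (f := addWeight w) hn)⟩

/-- The projection to the terms on which an additive function takes a given value. -/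
theorem hardyNorm_filter_eq_le {r : ℝ} (hr : 1 ≤ r) (w : ℕ → ℕ) (a : ℕ+ →₀ ℂ) (j : ℕ) :
    hardyNorm r (a.filter fun n => addWeight w n = j) ≤ hardyNorm r a := by
  obtain ⟨R, hR⟩ := exists_weight_bound w a
  -- The order exceeds all weights in the support as well as `j`. For a single frequency the kernel
  -- is unimodular, whence the constant `1`.
  have hζ := Complex.isPrimitiveRoot_exp (R + j + 1) (by omega)
  have h := hardyNorm_filter_le hr w a hζ (A := {j}) (fun n hn => by have := hR n hn; omega)
    (fun i hi => by rw [Finset.mem_singleton.1 hi]; omega)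
  simp only [Finset.mem_singleton, Finset.sum_singleton, norm_pow, norm_inv,
    hζ.norm'_eq_one (by omega : R + j + 1 ≠ 0)] at h
  have hc : ((R : ℝ) + j + 1) ≠ 0 := by positivity
  simpa [hc] using h

theorem norm_one_sub_root_ge {R k : ℕ} (hk : 0 < k) (hkR : 2 * k ≤ R) :
    4 * (k : ℝ) / R ≤ ‖Complex.exp (2 * Real.pi * Complex.I / R) ^ k - 1‖ := by
  have hk' : (0 : ℝ) < k := by exact_mod_cast hk
  have hR : (0 : ℝ) < R := by exact_mod_cast (by omega : 0 < R)
  have hkR' : 2 * (k : ℝ) ≤ R := by exact_mod_cast hkR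
  have e : Complex.exp (2 * Real.pi * Complex.I / R) ^ k
      = Complex.exp (Complex.I * ((2 * Real.pi * k / R : ℝ) : ℂ)) := by
    rw [← Complex.exp_nat_mul]
    congr 1
    push_cast
    ring
  rw [e, Complex.norm_exp_I_mul_ofReal_sub_one]
  have hpi := Real.pi_pos
  have h1 : 2 * Real.pi * k / R / 2 ≤ Real.pi / 2 := by
    rw [div_div, div_le_div_iff₀ (by positivity) (by positivity)]
    nlinarith
  have h2 := Real.mul_le_sin (x := 2 * Real.pi * k / R / 2) (by positivity) h1
  rw [Real.norm_eq_abs]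
  refine le_trans ?_ (le_abs_self _)
  calc 4 * (k : ℝ) / R = 2 * (2 / Real.pi * (2 * Real.pi * k / R / 2)) := by field_simp; ring
    _ ≤ _ := by gcongr

theorem sum_inv_Ioc_le_log {T R : ℕ} (hT : 0 < T) (hTR : T ≤ R) :
    ∑ k ∈ Finset.Ioc T R, (1 : ℝ) / k ≤ Real.log (R / T) := by
  have hT' : (0 : ℝ) < T := by exact_mod_cast hT
  induction R, hTR using Nat.le_induction with
  | base => simp [hT'.ne']
  | succ R hR ih =>
    have hR' : (0 : ℝ) < R := by exact_mod_cast hT.trans_le hR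
    rw [Finset.sum_Ioc_succ_top hR]
    have h1 := Real.one_sub_inv_le_log_of_pos (x := ((R : ℝ) + 1) / R) (by positivity)
    have h2 : (1 : ℝ) / ((R + 1 : ℕ) : ℝ) = 1 - (((R : ℝ) + 1) / R)⁻¹ := by
      push_cast; field_simp; ring
    have h3 : Real.log ((R + 1 : ℕ) / T) = Real.log (R / T) + Real.log (((R : ℝ) + 1) / R) := by
      rw [← Real.log_mul (by positivity) (by positivity)]
      congr 1
      push_cast
      field_simp
    linarith

/-- A discrete bound for the Lebesgue constants. -/
theorem lebesgue_constant_le {L T : ℕ} (hL : 0 < L) (hT : 0 < T) :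
    1 / ((L * T : ℕ) : ℝ) * ∑ k ∈ Finset.range (L * T), ‖∑ j ∈ Finset.range L,
      ((Complex.exp (2 * Real.pi * Complex.I / (L * T : ℕ)))⁻¹ ^ k) ^ j‖ ≤ 3 + Real.log L := by
  set R := L * T with hRdef
  have hR : 0 < R := Nat.mul_pos hL hT
  have hζ := Complex.isPrimitiveRoot_exp R hR.ne'
  set ζ := Complex.exp (2 * Real.pi * Complex.I / R) with hζdef
  have hζ1 : ‖ζ‖ = 1 := hζ.norm'_eq_one hR.ne'
  have hζ0 : ζ ≠ 0 := hζ.ne_zero hR.ne'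
  have hRr : (0 : ℝ) < R := by exact_mod_cast hR
  have hLr : (0 : ℝ) < L := by exact_mod_cast hL
  have hTr : (0 : ℝ) < T := by exact_mod_cast hT
  -- The usual majorant of the Dirichlet kernel: `L` trivially, and `R/(2k)` from the geometric sum.
  -- They are of the same order at the crossover `k = T = R/L`.
  set g : ℕ → ℝ := fun k => if k ≤ T then (L : ℝ) else R / 2 * (1 / k) with hg
  have hg0 : ∀ k, 0 ≤ g k := fun k => by
    simp only [hg]
    split_ifs <;> positivity
  have hb1 : ∀ k, ‖∑ j ∈ Finset.range L, (ζ⁻¹ ^ k) ^ j‖ ≤ L := by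
    intro k
    refine (norm_sum_le _ _).trans_eq ?_
    simp [hζ1]
  have hgeom : ∀ (k : ℕ) (c : ℝ), 0 < c → c ≤ ‖ζ⁻¹ ^ k - 1‖ →
      ‖∑ j ∈ Finset.range L, (ζ⁻¹ ^ k) ^ j‖ ≤ 2 / c := by
    intro k c hc h
    have hne : ζ⁻¹ ^ k ≠ 1 := fun h1 => by
      rw [h1, sub_self, norm_zero] at h
      linarith
    rw [geom_sum_eq hne, norm_div]
    refine div_le_div₀ zero_le_two ((norm_sub_le _ _).trans ?_) hc h
    rw [norm_pow, norm_pow, norm_inv, hζ1, norm_one]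
    norm_num
  have hgk : ∀ k, T < k → g k = 2 / (4 * (k : ℝ) / R) := fun k hk => by
    simp only [hg, if_neg (not_le.2 hk)]
    have : (k : ℝ) ≠ 0 := by exact_mod_cast (by omega : k ≠ 0)
    field_simp
    norm_num
  -- Indices `k > R/2` are reflected to `R - k`, written `R - 1 - k + 1` to match
  -- `Finset.sum_range_reflect`.
  have hb : ∀ k ∈ Finset.range R, ‖∑ j ∈ Finset.range L, (ζ⁻¹ ^ k) ^ j‖
      ≤ g k + g (R - 1 - k + 1) := by
    intro k hk
    rw [Finset.mem_range] at hk
    have e : R - 1 - k + 1 = R - k := by omega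
    rw [e]
    rcases le_or_gt (2 * k) R with h2 | h2
    · refine le_add_of_le_of_nonneg ?_ (hg0 _)
      rcases le_or_gt k T with hkT | hkT
      · simp only [hg, if_pos hkT]; exact hb1 k
      · rw [hgk k hkT]
        have hk0 : (0 : ℝ) < k := by exact_mod_cast (by omega : 0 < k)
        refine hgeom k _ (by positivity) ((norm_one_sub_root_ge (by omega) h2).trans_eq ?_)
        rw [← hζdef, ← norm_neg, inv_pow]
        have hz : ‖ζ ^ k‖ = 1 := by rw [norm_pow, hζ1, one_pow]
        have : -(ζ ^ k - 1) = ζ ^ k * ((ζ ^ k)⁻¹ - 1) := by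
          field_simp
          ring
        rw [this, norm_mul, hz, one_mul]
    · refine le_add_of_nonneg_of_le (hg0 _) ?_
      rcases le_or_gt (R - k) T with hkT | hkT
      · simp only [hg, if_pos hkT]; exact hb1 k
      · rw [hgk _ hkT]
        have hk0 : (0 : ℝ) < (R - k : ℕ) := by exact_mod_cast (by omega : 0 < R - k)
        refine hgeom k _ (by positivity) ((norm_one_sub_root_ge (by omega) (by omega)).trans_eq ?_)
        rw [← hζdef]
        congr 2
        rw [inv_pow]
        refine (inv_eq_of_mul_eq_one_right ?_).symm
        rw [← pow_add, show k + (R - k) = R by omega, hζ.pow_eq_one]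
  have hTR : T ≤ R := Nat.le_mul_of_pos_left T hL
  have hRT : (R : ℝ) / T = L := by rw [hRdef]; push_cast; field_simp
  have hLT : (L : ℝ) * T = R := by rw [hRdef]; push_cast; ring
  have hsum1 : ∑ k ∈ Finset.Ioc 0 R, g k ≤ R + R / 2 * Real.log L := by
    rw [← Finset.Ioc_union_Ioc_eq_Ioc (Nat.zero_le T) hTR,
      Finset.sum_union (Finset.Ioc_disjoint_Ioc_of_le le_rfl)]
    refine add_le_add ?_ ?_
    · rw [Finset.sum_congr rfl fun k hk => show g k = (L : ℝ) by
        simp only [hg, if_pos (Finset.mem_Ioc.1 hk).2]]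
      simp
      linarith
    · rw [Finset.sum_congr rfl fun k hk => show g k = R / 2 * (1 / k) by
        simp only [hg, if_neg (not_le.2 (Finset.mem_Ioc.1 hk).1)], ← Finset.mul_sum]
      have := sum_inv_Ioc_le_log hT hTR
      rw [hRT] at this
      gcongr
  have hIoc : ∑ k ∈ Finset.range R, g (k + 1) = ∑ k ∈ Finset.Ioc 0 R, g k := by
    rw [Finset.range_eq_Ico, Finset.sum_Ico_add' g 0 R 1]
    rfl
  have hsum2 : ∑ k ∈ Finset.range R, g k ≤ L + (R + R / 2 * Real.log L) := by
    have h1 : ∑ k ∈ Finset.range R, g k ≤ ∑ k ∈ Finset.range (R + 1), g k :=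
      Finset.sum_le_sum_of_subset_of_nonneg (Finset.range_mono (by omega)) fun _ _ _ => hg0 _
    rw [Finset.sum_range_succ', hIoc] at h1
    have h2 : g 0 = L := by simp [hg]
    linarith
  have hsum3 : ∑ k ∈ Finset.range R, g (R - 1 - k + 1) = ∑ k ∈ Finset.Ioc 0 R, g k := by
    rw [Finset.sum_range_reflect (fun k => g (k + 1)) R, hIoc]
  have htotal := (Finset.sum_le_sum hb).trans_eq Finset.sum_add_distrib
  rw [hsum3] at htotal
  have hLR : (L : ℝ) ≤ R := by exact_mod_cast Nat.le_mul_of_pos_right L hT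
  rw [one_div, inv_mul_le_iff₀ hRr]
  nlinarith

theorem addWeight_le_of_log {w : ℕ → ℕ} {f : ℕ → ℝ} {n : ℕ+}
    (h : ∀ p ∈ (n : ℕ).factorization.support, f p ≤ w p) :
    (n : ℕ).factorization.sum (fun p k => (k : ℝ) * f p) ≤ addWeight w n := by
  rw [addWeight, Finsupp.sum, Finsupp.sum]
  push_cast
  exact Finset.sum_le_sum fun p hp => mul_le_mul_of_nonneg_left (h p hp) (Nat.cast_nonneg _)

theorem one_le_of_mem_support_factorization {n p : ℕ} (hp : p ∈ n.factorization.support) :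
    p.Prime := Nat.prime_of_mem_primeFactors (by rwa [Nat.support_factorization] at hp)

theorem bigOmega_le (n : ℕ+) : bigOmega n ≤ n := by
  have h : (2 : ℕ) ^ bigOmega n ≤ n := by
    rw [bigOmega, Finsupp.sum, ← Finset.prod_pow_eq_pow_sum]
    conv_rhs => rw [← Nat.prod_factorization_pow_eq_self n.ne_zero]
    exact Finset.prod_le_prod' fun p hp =>
      Nat.pow_le_pow_left (one_le_of_mem_support_factorization hp).two_le _
  exact (Nat.lt_two_pow_self).le.trans h

/-- An additive function with values in `ℕ` that separates `n ≤ N` from `n > N`. -/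
theorem exists_separating_weight {N : ℕ} (hN : 1 ≤ N) : ∃ (w : ℕ → ℕ) (L : ℕ), 0 < L ∧
    (∀ n : ℕ+, addWeight w n < L ↔ (n : ℕ) ≤ N) ∧ Real.log L ≤ 4 * Real.log (N + 1) := by
  set Q : ℝ := ((N : ℝ) + 1) ^ 2 with hQ
  have hNr : (1 : ℝ) ≤ N := by exact_mod_cast hN
  -- Rounding `Q log p` up costs at most `1` per prime factor, hence at most `Ω(n) ≤ n ≤ N` for `n ≤
  -- N`. Passing from `N` to `N + 1` raises `Q log n` by at least `Q / (N + 1) = N + 1`, which is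
  -- more.
  set w : ℕ → ℕ := fun p => ⌈Q * Real.log p⌉₊ with hw
  have hlogN : Real.log N ≤ N := (Real.log_le_sub_one_of_pos (by linarith)).trans (by linarith)
  have hlog0 : 0 ≤ Real.log N := Real.log_nonneg hNr
  have lower : ∀ n : ℕ+, Q * Real.log (n : ℕ) ≤ addWeight w n := by
    intro n
    rw [Real.log_nat_eq_sum_factorization, Finsupp.mul_sum]
    refine le_trans (le_of_eq ?_) (addWeight_le_of_log (f := fun p => Q * Real.log p)
      fun p _ => Nat.le_ceil _)
    exact Finset.sum_congr rfl fun p _ => by ring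
  have upper : ∀ n : ℕ+, (addWeight w n : ℝ) ≤ Q * Real.log (n : ℕ) + n := by
    intro n
    have h1 : (addWeight w n : ℝ) ≤ Q * Real.log (n : ℕ) + bigOmega n := by
      rw [Real.log_nat_eq_sum_factorization, Finsupp.mul_sum, addWeight, bigOmega]
      simp only [Finsupp.sum]
      push_cast
      rw [← Finset.sum_add_distrib]
      refine Finset.sum_le_sum fun p hp => ?_
      have h2 : ((w p : ℕ) : ℝ) ≤ Q * Real.log p + 1 :=
        (Nat.ceil_lt_add_one (mul_nonneg (by positivity) (Real.log_natCast_nonneg p))).le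
      calc _ ≤ ((n : ℕ).factorization p : ℝ) * (Q * Real.log p + 1) := by gcongr
        _ = _ := by ring
    have h2 : (bigOmega n : ℝ) ≤ (n : ℕ) := by exact_mod_cast bigOmega_le n
    linarith
  have hx0 : 0 ≤ Q * Real.log N + N := by positivity
  refine ⟨w, ⌊Q * Real.log N + N⌋₊ + 1, Nat.succ_pos _, fun n => ?_, ?_⟩
  · rw [Nat.lt_succ_iff, Nat.le_floor_iff hx0]
    constructor
    · intro h
      by_contra hn
      have hn' : (N : ℝ) + 1 ≤ (n : ℕ) := by exact_mod_cast (not_le.1 hn)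
      have h1 := Real.one_sub_inv_le_log_of_pos (x := ((N : ℝ) + 1) / N) (by positivity)
      rw [Real.log_div (by positivity) (by positivity)] at h1
      have h2 : 1 - (((N : ℝ) + 1) / N)⁻¹ = 1 / (N + 1) := by field_simp; ring
      rw [h2] at h1
      have h3 : Real.log (N + 1) ≤ Real.log (n : ℕ) := Real.log_le_log (by positivity) hn'
      have h4 : Q * (Real.log N + 1 / (N + 1)) ≤ Q * Real.log (n : ℕ) := by
        gcongr
        linarith
      have h5 : Q * (Real.log N + 1 / (N + 1)) = Q * Real.log N + (N + 1) := by
        rw [hQ]; field_simp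
      linarith [lower n]
    · intro h
      have hn : ((n : ℕ) : ℝ) ≤ N := by exact_mod_cast h
      have h0 : (0 : ℝ) < (n : ℕ) := by exact_mod_cast n.pos
      have : Real.log (n : ℕ) ≤ Real.log N := Real.log_le_log h0 hn
      have : Q * Real.log (n : ℕ) ≤ Q * Real.log N := by gcongr
      linarith [upper n]
  · rw [show (4 : ℝ) * Real.log (N + 1) = Real.log (((N : ℝ) + 1) ^ 4) by
      rw [Real.log_pow]; norm_num]
    refine Real.log_le_log (by positivity) ?_
    push_cast
    have h1 := Nat.floor_le hx0
    have h2 : Q * Real.log N ≤ Q * N := by gcongr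
    have h3 : Q * N + N + 1 ≤ ((N : ℝ) + 1) ^ 4 := by
      rw [hQ]
      have : (0 : ℝ) ≤ N * ((N : ℝ) + 1) ^ 2 := by positivity
      nlinarith [mul_nonneg this (by linarith : (0 : ℝ) ≤ N)]
    linarith

/-- The norm of the partial sum operator grows at most logarithmically. -/
theorem hardyNorm_partialSum_le {r : ℝ} (hr : 1 ≤ r) {N : ℕ} (hN : 1 ≤ N) (a : ℕ+ →₀ ℂ) :
    hardyNorm r (a.filter fun n => (n : ℕ) ≤ N)
      ≤ (3 + 4 * Real.log (N + 1)) * hardyNorm r a := by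
  obtain ⟨w, L, hL, hw, hlog⟩ := exists_separating_weight hN
  obtain ⟨R, hR⟩ := exists_weight_bound w a
  -- The order must exceed all weights and be a multiple of `L` for the Lebesgue constant.
  have hζ := Complex.isPrimitiveRoot_exp (L * (R + 1)) (by positivity)
  have h := hardyNorm_filter_le hr w a hζ (A := Finset.range L)
    (fun n hn => (hR n hn).trans_le (by nlinarith)) (fun j hj => by
      rw [Finset.mem_range] at hj
      nlinarith)
  simp only [Finset.mem_range, hw] at h
  refine h.trans ?_
  have h2 := lebesgue_constant_le hL (Nat.succ_pos R)
  have := hardyNorm_nonneg (by linarith : 0 < r) a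
  gcongr
  exact h2.trans (by linarith)

/-! ### Partial sum operators from `ℋ_p` to `ℋ_q`. -/

theorem sum_filter_eq {κ : ℕ+ → ℕ} {a : ℕ+ →₀ ℂ} {J : ℕ} (h : ∀ n ∈ a.support, κ n ≤ J) :
    ∑ j ∈ Finset.range (J + 1), a.filter (fun n => κ n = j) = a := by
  ext n
  rw [Finsupp.finsetSum_apply]
  simp only [Finsupp.filter_apply, Finset.sum_ite_eq, Finset.mem_range, Nat.lt_succ_iff]
  split_ifs with hn
  · rfl
  · by_contra h0
    exact hn (h n (Finsupp.mem_support_iff.2 (Ne.symm h0)))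

/-- On the terms with `Ω(n) = j` the Weissler contraction is the scalar `√(p/q) ^ j` and can be
inverted. The projections to these terms are contractions, and there are `J + 1` of them. -/
theorem hardyNorm_le_of_bigOmega_le {p q : ℝ} (hp : 1 ≤ p) (hpq : p ≤ q) {J : ℕ} {a : ℕ+ →₀ ℂ}
    (h : ∀ n ∈ a.support, bigOmega n ≤ J) :
    hardyNorm q a ≤ (J + 1) * √(q / p) ^ J * hardyNorm p a := by
  have hp0 : 0 < p := by linarith
  have hq0 : 0 < q := by linarith
  have hc : 1 ≤ √(q / p) := Real.one_le_sqrt.2 ((one_le_div hp0).2 hpq)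
  have hρ : 0 < √(p / q) := Real.sqrt_pos.2 (by positivity)
  have hinv : √(q / p) = (√(p / q))⁻¹ := by rw [← Real.sqrt_inv, inv_div]
  have hj : ∀ j ∈ Finset.range (J + 1), hardyNorm q (a.filter fun n => bigOmega n = j)
      ≤ √(q / p) ^ J * hardyNorm p a := by
    intro j hj
    set b := a.filter fun n => bigOmega n = j with hb
    have e : coeffMul (fun n => ((√(p / q) : ℝ) : ℂ) ^ bigOmega n) b
        = ((√(p / q) : ℝ) : ℂ) ^ j • b := by
      ext n
      simp only [coeffMul_apply, Finsupp.smul_apply, smul_eq_mul, hb, Finsupp.filter_apply]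
      split_ifs with hn
      · rw [hn]
      · simp
    have h1 := hardyNorm_weissler hp0 hpq b
    rw [e, hardyNorm_smul hq0, norm_pow, Complex.norm_real, Real.norm_of_nonneg hρ.le] at h1
    have h2 : hardyNorm p b ≤ hardyNorm p a := by
      have := hardyNorm_filter_eq_le hp (fun _ => 1) a j
      simpa only [← bigOmega_eq_addWeight] using this
    have h3 : hardyNorm q b ≤ √(q / p) ^ j * hardyNorm p a := by
      rw [hinv, inv_pow, inv_mul_eq_div, le_div_iff₀ (by positivity), mul_comm]
      exact h1.trans h2
    refine h3.trans ?_
    have := hardyNorm_nonneg hp0 a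
    have := Finset.mem_range.1 hj
    gcongr
    omega
  rw [← sum_filter_eq h]
  refine (hardyNorm_sum_le (by linarith) _ _).trans ((Finset.sum_le_sum hj).trans_eq ?_)
  rw [sum_filter_eq h, Finset.sum_const, Finset.card_range, nsmul_eq_mul]
  push_cast
  ring

/-- Splitting off a finite set of primes. -/
theorem hardyNorm_le_of_addWeight_le {p q : ℝ} (hp : 1 ≤ p) (hpq : p ≤ q) {J N : ℕ}
    (S : Finset ℕ) (hS : ∀ P ∈ S, P.Prime) {a : ℕ+ →₀ ℂ} (hN : ∀ n ∈ a.support, (n : ℕ) ≤ N)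
    (h : ∀ n ∈ a.support, addWeight (fun P => if P ∈ S then 0 else 1) n ≤ J) :
    hardyNorm q a
      ≤ ((Nat.log 2 N : ℝ) + 1) ^ S.card * ((J + 1) * √(q / p) ^ J) * hardyNorm p a := by
  have hp0 : 0 < p := by linarith
  have hq0 : 0 < q := by linarith
  induction S using Finset.induction generalizing a with
  | empty =>
    rw [Finset.card_empty, pow_zero, one_mul]
    exact hardyNorm_le_of_bigOmega_le hp hpq fun n hn => by
      simpa [bigOmega_eq_addWeight] using h n hn
  | insert P S hP ih =>
    have hPp : P.Prime := hS P (Finset.mem_insert_self _ _)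
    -- Sort by the exponent `j` of `P`, which takes at most `log₂ N + 1` values. Dividing by `P ^ j`
    -- is an isometry in both spaces and leaves a polynomial free of `P`, to which the smaller set
    -- of primes applies.
    set κ : ℕ → ℕ := fun k => if k = P then 1 else 0 with hκ
    have hκv : ∀ n : ℕ+, addWeight κ n = (n : ℕ).factorization P := by
      intro n
      rw [addWeight, Finsupp.sum]
      simp only [hκ, mul_ite, mul_one, mul_zero, Finset.sum_ite_eq']
      split_ifs with h0
      · rfl
      · exact (Finsupp.notMem_support_iff.1 h0).symm
    have hd : ∀ n ∈ a.support, addWeight κ n ≤ Nat.log 2 N := by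
      intro n hn
      rw [hκv]
      have h1 : 2 ^ (n : ℕ).factorization P ≤ N :=
        (Nat.pow_le_pow_left hPp.two_le _).trans ((Nat.ordProj_le P n.ne_zero).trans (hN n hn))
      exact Nat.le_log_of_pow_le one_lt_two h1
    set B := ((Nat.log 2 N : ℝ) + 1) ^ S.card * ((J + 1) * √(q / p) ^ J) with hB
    have hB0 : 0 ≤ B := by positivity
    have hj : ∀ j ∈ Finset.range (Nat.log 2 N + 1),
        hardyNorm q (a.filter fun n => addWeight κ n = j) ≤ B * hardyNorm p a := by
      intro j _
      set b := a.filter fun n => addWeight κ n = j with hb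
      have hbs : ∀ n ∈ b.support, n ∈ a.support ∧ (n : ℕ).factorization P = j := by
        intro n hn
        rw [hb, Finsupp.support_filter, Finset.mem_filter, hκv] at hn
        exact hn
      set k : ℕ+ := ⟨P ^ j, pow_pos hPp.pos j⟩ with hk
      have hkc : (k : ℕ) = P ^ j := rfl
      have hinj : Function.Injective (k * · : ℕ+ → ℕ+) := mul_right_injective k
      set c := b.comapDomain (k * ·) hinj.injOn with hc
      have hbc : c.mapDomain (k * ·) = b := by
        refine Finsupp.mapDomain_comapDomain _ hinj _ fun n hn => ?_
        obtain ⟨_, h2⟩ := hbs n hn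
        have h3 : k ∣ n := by
          rw [PNat.dvd_iff, hkc, ← h2]
          exact Nat.ordProj_dvd _ _
        obtain ⟨m, rfl⟩ := h3
        exact ⟨m, rfl⟩
      have hcs : ∀ n ∈ c.support, k * n ∈ b.support := fun n hn => by
        simpa [hc] using hn
      have hv : ∀ n ∈ c.support, (n : ℕ).factorization P = 0 := by
        intro n hn
        have h2 := (hbs _ (hcs n hn)).2
        rw [PNat.mul_coe, hkc, Nat.factorization_mul (pow_ne_zero _ hPp.ne_zero) n.ne_zero,
          Finsupp.add_apply, hPp.factorization_pow] at h2
        simpa using h2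
      have h1 := ih (fun Q hQ => hS Q (Finset.mem_insert_of_mem hQ)) (a := c)
        (fun n hn => by
          refine le_trans ?_ (hN _ (hbs _ (hcs n hn)).1)
          rw [PNat.mul_coe]
          exact Nat.le_mul_of_pos_left _ k.pos)
        (fun n hn => by
          have h2 := h _ (hbs _ (hcs n hn)).1
          rw [addWeight_mul] at h2
          refine le_trans (le_of_eq ?_) ((Nat.le_add_left _ _).trans h2)
          rw [addWeight, addWeight]
          refine Finsupp.sum_congr fun Q hQ => ?_
          have hne : Q ≠ P := by
            rintro rfl
            exact (Finsupp.mem_support_iff.1 hQ) (hv n hn)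
          simp [hne])
      rw [← hbc, hardyNorm_shift hq0]
      refine h1.trans ?_
      rw [← hardyNorm_shift hp0 k, hbc]
      have := hardyNorm_filter_eq_le hp κ a j
      gcongr
    rw [← sum_filter_eq hd]
    refine (hardyNorm_sum_le (by linarith) _ _).trans ((Finset.sum_le_sum hj).trans_eq ?_)
    rw [sum_filter_eq hd, Finset.sum_const, Finset.card_range, nsmul_eq_mul,
      Finset.card_insert_of_notMem hP, hB]
    push_cast
    ring

/-- The partial sum operators from `ℋ_p` to `ℋ_q`, with a free parameter `Y`. -/
theorem hardyNorm_partialSum_le' {p q : ℝ} (hp : 1 ≤ p) (hpq : p ≤ q) {m N Y : ℕ} (hm : 1 ≤ m)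
    (hmN : m ≤ N) (hY : 2 ≤ Y) (a : ℕ+ →₀ ℂ) :
    hardyNorm q (a.filter fun n => (n : ℕ) ≤ m)
      ≤ ((Nat.log 2 N : ℝ) + 1) ^ Y * ((⌊Real.log N / Real.log Y⌋₊ + 1)
        * √(q / p) ^ ⌊Real.log N / Real.log Y⌋₊) * ((3 + 4 * Real.log (N + 1)) * hardyNorm p a) := by
  have hp0 : 0 < p := by linarith
  have hsupp : ∀ n ∈ (a.filter fun n : ℕ+ => (n : ℕ) ≤ m).support, (n : ℕ) ≤ N := by
    intro n hn
    rw [Finsupp.support_filter, Finset.mem_filter] at hn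
    exact le_trans hn.2 hmN
  have hlogY : 0 < Real.log Y := Real.log_pos (by exact_mod_cast hY)
  -- An integer up to `N` has at most `log N / log Y` prime factors that are `≥ Y`.
  refine (hardyNorm_le_of_addWeight_le hp hpq (Nat.primesBelow Y)
    (fun P hP => (Nat.mem_primesBelow.1 hP).2) hsupp (J := ⌊Real.log N / Real.log Y⌋₊)
    fun n hn => ?_).trans ?_
  · refine Nat.le_floor ?_
    have hn0 : (0 : ℝ) < (n : ℕ) := by exact_mod_cast n.pos
    have h1 : Real.log (n : ℕ) ≤ Real.log N :=
      Real.log_le_log hn0 (by exact_mod_cast hsupp n hn)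
    rw [le_div_iff₀ hlogY]
    refine le_trans ?_ h1
    rw [Real.log_nat_eq_sum_factorization (n : ℕ), addWeight, Finsupp.sum, Finsupp.sum]
    push_cast
    rw [Finset.sum_mul]
    refine Finset.sum_le_sum fun P hP => ?_
    have hPp : P.Prime := Nat.prime_of_mem_primeFactors (n := (n : ℕ)) (by simpa using hP)
    rw [mul_assoc]
    refine mul_le_mul_of_nonneg_left ?_ (Nat.cast_nonneg _)
    split_ifs with hPS
    · simpa using Real.log_natCast_nonneg P
    · rw [one_mul]
      refine Real.log_le_log (by positivity) ?_
      rw [Nat.mem_primesBelow] at hPS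
      exact_mod_cast not_lt.1 fun h => hPS ⟨h, hPp⟩
  · have h0 := hardyNorm_nonneg hp0 a
    have hc : 1 ≤ √(q / p) := Real.one_le_sqrt.2 ((one_le_div hp0).2 hpq)
    have hcard : (Nat.primesBelow Y).card ≤ Y := by
      refine (Finset.card_le_card fun P hP => ?_).trans_eq (Finset.card_range Y)
      exact Finset.mem_range.2 (Nat.mem_primesBelow.1 hP).1
    have hb : (1 : ℝ) ≤ (Nat.log 2 N : ℝ) + 1 := by
      linarith [(Nat.cast_nonneg (Nat.log 2 N) : (0 : ℝ) ≤ _)]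
    refine mul_le_mul ?_ ((hardyNorm_partialSum_le hp hm a).trans ?_) (hardyNorm_nonneg hp0 _)
      (by positivity)
    · gcongr
    · gcongr

/-! ### Asymptotics and the choice of `Y`. -/

theorem eventually_rpow_mul_log_sq_le {θ η : ℝ} (hθ : θ < 1) (hη : 0 < η) (C : ℝ) :
    ∀ᶠ x : ℝ in atTop, C * (x ^ θ * Real.log x ^ 2) ≤ η * x := by
  have h1 : (fun x : ℝ => Real.log x ^ (2 : ℝ)) =o[atTop] fun x => x ^ (1 - θ) :=
    isLittleO_log_rpow_rpow_atTop 2 (by linarith)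
  have h2 : ∀ᶠ x : ℝ in atTop, ‖Real.log x ^ (2 : ℝ)‖ ≤ η / (|C| + 1) * ‖x ^ (1 - θ)‖ :=
    h1.bound (by positivity)
  filter_upwards [h2, eventually_gt_atTop 0] with x hx hx0
  rw [Real.rpow_two, Real.norm_of_nonneg (by positivity), Real.norm_of_nonneg (by positivity)] at hx
  have h3 : x ^ θ * x ^ (1 - θ) = x := by
    rw [← Real.rpow_add hx0]
    simp
  calc C * (x ^ θ * Real.log x ^ 2) ≤ (|C| + 1) * (x ^ θ * (η / (|C| + 1) * x ^ (1 - θ))) := by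
        have := le_abs_self C
        refine (mul_le_mul_of_nonneg_right (by linarith : C ≤ |C| + 1) (by positivity)).trans ?_
        gcongr
    _ = η * (x ^ θ * x ^ (1 - θ)) := by
        field_simp
    _ = η * x := by rw [h3]

/-- The logarithm of the partial sum bound, with `x = log n`: at most `3 x ^ θ` small primes cost a
factor `x²` each, `8 log x` leaves room for the polynomial factors, and the last term is the
Weissler factor. As `θ < 1`, the first two are `o(x / log x)`. -/
theorem eventually_exponent_le {θ κ κ' : ℝ} (hθ0 : 0 ≤ θ) (hθ : θ < 1) (hκ : κ < κ') :
    ∀ᶠ x : ℝ in atTop, 3 * x ^ θ * (2 * Real.log x) + 8 * Real.log x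
      + (x + 2) * (κ / Real.log x) ≤ x / Real.log x * κ' := by
  have hη : 0 < (κ' - κ) / 2 := by linarith
  filter_upwards [eventually_rpow_mul_log_sq_le hθ hη 15, eventually_ge_atTop 1,
    eventually_ge_atTop (2 * |κ| / ((κ' - κ) / 2)), Real.tendsto_log_atTop.eventually_ge_atTop 1]
    with x h1 hx1 hx2 hL
  have hL0 : 0 < Real.log x := by linarith
  rw [div_le_iff₀ hη] at hx2
  have hxθ : 1 ≤ x ^ θ := Real.one_le_rpow hx1 hθ0
  have hs : Real.log x ^ 2 ≤ x ^ θ * Real.log x ^ 2 := le_mul_of_one_le_left (by positivity) hxθ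
  have hκ0 := le_abs_self κ
  rw [← sub_nonneg]
  have : x / Real.log x * κ' - (3 * x ^ θ * (2 * Real.log x) + 8 * Real.log x
      + (x + 2) * (κ / Real.log x)) = (x * κ' - 6 * (x ^ θ * Real.log x ^ 2) - 8 * Real.log x ^ 2
        - (x + 2) * κ) / Real.log x := by
    field_simp
    ring
  rw [this]
  refine div_nonneg ?_ hL0.le
  nlinarith [sq_nonneg (Real.log x)]

theorem exists_partialSum_bound_le {c K : ℝ} (hc : 1 ≤ c) (hcK : c < K) :
    ∃ n₀ : ℕ, 3 ≤ n₀ ∧ ∀ n : ℕ, n₀ ≤ n → ∃ Y : ℕ, 2 ≤ Y ∧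
      ((Nat.log 2 (4 * n) : ℝ) + 1) ^ Y * ((⌊Real.log ((4 * n : ℕ) : ℝ) / Real.log Y⌋₊ + 1)
        * c ^ ⌊Real.log ((4 * n : ℕ) : ℝ) / Real.log Y⌋₊)
          * (3 + 4 * Real.log (((4 * n : ℕ) : ℝ) + 1))
        ≤ K ^ (Real.log n / Real.log (Real.log n)) / Real.log (Real.log n) := by
  have hc0 : 0 < c := by linarith
  have hK0 : 0 < K := by linarith
  have hlogc : 0 ≤ Real.log c := Real.log_nonneg hc
  have hlt : Real.log c < Real.log K := Real.log_lt_log hc0 hcK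
  -- Taking only primes above `x ^ θ` inflates `log c` to `log c / θ`, which the strict inequality
  -- `c < K` allows.
  obtain ⟨θ, hθ0, hθ1, hθ⟩ : ∃ θ : ℝ, 0 < θ ∧ θ < 1 ∧ Real.log c / θ < Real.log K := by
    obtain ⟨θ, h1, h2⟩ := exists_between (show Real.log c / Real.log K < 1 from
      (div_lt_one (by linarith)).2 hlt)
    have h0 : 0 < θ := lt_of_le_of_lt (div_nonneg hlogc (by linarith)) h1
    refine ⟨θ, h0, h2, ?_⟩
    rw [div_lt_iff₀ (by linarith)] at h1
    rw [div_lt_iff₀ h0]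
    linarith
  have hev : ∀ᶠ x : ℝ in atTop, (3 * x ^ θ * (2 * Real.log x) + 8 * Real.log x
      + (x + 2) * ((Real.log c / θ) / Real.log x) ≤ x / Real.log x * Real.log K)
      ∧ 100 ≤ x ∧ 1 ≤ θ * Real.log x ∧ Real.log x ≤ x := by
    filter_upwards [eventually_exponent_le hθ0.le hθ1 hθ, eventually_ge_atTop 100,
      Real.tendsto_log_atTop.eventually_ge_atTop (1 / θ)] with x h1 h2 h3
    refine ⟨h1, h2, ?_, ?_⟩
    · rw [div_le_iff₀ hθ0] at h3
      linarith
    · have := Real.log_le_sub_one_of_pos (show 0 < x by linarith)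
      linarith
  have hev' := (Real.tendsto_log_atTop.comp tendsto_natCast_atTop_atTop).eventually hev
  obtain ⟨n₁, hn₁⟩ := eventually_atTop.1 hev'
  refine ⟨max n₁ 3, le_max_right _ _, fun n hn => ?_⟩
  obtain ⟨h1, hx, hL1, hLx⟩ := hn₁ n ((le_max_left _ _).trans hn)
  have hn3 : 3 ≤ n := (le_max_right _ _).trans hn
  have hn0 : (0 : ℝ) < n := by exact_mod_cast (by omega : 0 < n)
  simp only [Function.comp_apply] at h1 hx hL1 hLx
  set x := Real.log n with hxdef
  set L := Real.log x with hLdef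
  have hL0 : 0 < L := by
    by_contra h
    nlinarith
  have hx0 : 0 < x := by linarith
  have hxθ : 1 ≤ x ^ θ := Real.one_le_rpow (by linarith) hθ0.le
  have hxsq : x ^ 2 = Real.exp (2 * L) := by
    rw [mul_comm, Real.exp_mul, hLdef, Real.exp_log hx0, Real.rpow_two]
  have hlog4 : Real.log 4 ≤ 2 := by
    rw [show (4 : ℝ) = 2 ^ 2 by norm_num, Real.log_pow]
    have := Real.log_two_lt_d9
    push_cast
    linarith
  have hlogN : Real.log ((4 * n : ℕ) : ℝ) ≤ x + 2 := by
    push_cast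
    rw [Real.log_mul (by norm_num) hn0.ne']
    linarith
  have hlogN' : Real.log (((4 * n : ℕ) : ℝ) + 1) ≤ x + 3 := by
    have h2 : ((4 * n : ℕ) : ℝ) + 1 ≤ 2 * (4 * n : ℝ) := by
      have h3 : (3 : ℝ) ≤ n := by exact_mod_cast hn3
      push_cast
      linarith
    refine (Real.log_le_log (by positivity) h2).trans ?_
    rw [Real.log_mul (by norm_num) (by positivity), Real.log_mul (by norm_num) hn0.ne']
    have := Real.log_two_lt_d9
    linarith
  refine ⟨⌈x ^ θ⌉₊ + 1, ?_, ?_⟩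
  · have : 1 ≤ ⌈x ^ θ⌉₊ := Nat.one_le_ceil_iff.2 (by linarith)
    omega
  set Y : ℕ := ⌈x ^ θ⌉₊ + 1 with hY
  have hYle : (Y : ℝ) ≤ 3 * x ^ θ := by
    rw [hY]
    push_cast
    have := Nat.ceil_lt_add_one (show 0 ≤ x ^ θ by linarith)
    linarith
  have hlogY : θ * L ≤ Real.log Y := by
    rw [hLdef, ← Real.log_rpow hx0]
    refine Real.log_le_log (by linarith) ?_
    rw [hY]
    push_cast
    have := Nat.le_ceil (x ^ θ)
    linarith
  set J : ℕ := ⌊Real.log ((4 * n : ℕ) : ℝ) / Real.log Y⌋₊ with hJ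
  have hJle : (J : ℝ) ≤ (x + 2) / (θ * L) := by
    refine (Nat.floor_le ?_).trans ?_
    · exact div_nonneg (Real.log_natCast_nonneg _) (by linarith)
    · have : 0 < θ * L := by linarith
      exact div_le_div₀ (by linarith) hlogN this hlogY
  have hJle' : (J : ℝ) + 1 ≤ Real.exp (2 * L) := by
    have : (x + 2) / (θ * L) ≤ x + 2 := div_le_self (by linarith) hL1
    rw [← hxsq]
    nlinarith
  have e1 : ((Nat.log 2 (4 * n) : ℝ) + 1) ≤ Real.exp (2 * L) := by
    have h2 : (Nat.log 2 (4 * n) : ℝ) * Real.log 2 ≤ Real.log ((4 * n : ℕ) : ℝ) := by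
      rw [← Real.log_pow]
      refine Real.log_le_log (by positivity) ?_
      exact_mod_cast Nat.pow_log_le_self 2 (by omega)
    have h3 : (1 / 2 : ℝ) ≤ Real.log 2 := by
      have := Real.log_two_gt_d9
      linarith
    have h4 : (Nat.log 2 (4 * n) : ℝ) * (1 / 2) ≤ Nat.log 2 (4 * n) * Real.log 2 := by gcongr
    rw [← hxsq]
    nlinarith
  have e2 : ((Nat.log 2 (4 * n) : ℝ) + 1) ^ Y ≤ Real.exp (3 * x ^ θ * (2 * L)) := by
    calc ((Nat.log 2 (4 * n) : ℝ) + 1) ^ Y ≤ Real.exp (2 * L) ^ Y := by gcongr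
      _ = Real.exp (Y * (2 * L)) := by rw [← Real.exp_nat_mul]
      _ ≤ _ := by gcongr
  have e3 : c ^ J ≤ Real.exp ((x + 2) * ((Real.log c / θ) / L)) := by
    calc c ^ J = Real.exp (J * Real.log c) := by rw [Real.exp_nat_mul, Real.exp_log hc0]
      _ ≤ Real.exp ((x + 2) / (θ * L) * Real.log c) := by gcongr
      _ = _ := by
        congr 1
        field_simp
  have e4 : 3 + 4 * Real.log (((4 * n : ℕ) : ℝ) + 1) ≤ Real.exp (2 * L) := by
    rw [← hxsq]
    nlinarith
  have e5 : L ≤ Real.exp (2 * L) := by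
    rw [← hxsq]
    nlinarith
  have e6 : 0 ≤ Real.log (((4 * n : ℕ) : ℝ) + 1) := by
    exact_mod_cast Real.log_natCast_nonneg (4 * n + 1)
  rw [le_div_iff₀ hL0, Real.rpow_def_of_pos hK0]
  calc _ ≤ Real.exp (3 * x ^ θ * (2 * L)) * (Real.exp (2 * L)
        * Real.exp ((x + 2) * ((Real.log c / θ) / L))) * Real.exp (2 * L) * Real.exp (2 * L) := by
        gcongr
    _ = Real.exp (3 * x ^ θ * (2 * L) + 6 * L + (x + 2) * ((Real.log c / θ) / L)) := by
        simp only [← Real.exp_add]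
        congr 1
        ring
    _ ≤ _ := by
        refine Real.exp_le_exp.2 ?_
        rw [mul_comm (Real.log K)]
        linarith

/-! ### Summation by parts, dyadic condensation and the multiplier theorem. -/

/-- On the block from `2 ^ k` to `2 ^ (k + 1)` one bound `β k` serves all partial sums, and the
differences of `l` telescope to at most `l (2 ^ k)`. -/
theorem hardyNorm_sum_Ico_sub_smul_filter_le {q : ℝ} (hq : 1 ≤ q) {l β : ℕ → ℝ}
    (hl0 : ∀ n, 0 ≤ l n) (hl : Antitone l) (hβ0 : ∀ j, 0 ≤ β j) {a : ℕ+ →₀ ℂ} {A : ℝ} (hA : 0 ≤ A)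
    (hβ : ∀ j m, 1 ≤ m → m ≤ 2 ^ (j + 1) →
      hardyNorm q (a.filter fun n => (n : ℕ) ≤ m) ≤ β j * A) (k : ℕ) :
    hardyNorm q (∑ m ∈ Finset.Ico 1 (2 ^ k),
        ((l m - l (m + 1) : ℝ) : ℂ) • a.filter fun n : ℕ+ => (n : ℕ) ≤ m)
      ≤ (∑ j ∈ Finset.range k, β j * l (2 ^ j)) * A := by
  have hq0 : 0 < q := by linarith
  induction k with
  | zero => simp [hardyNorm_zero hq0]
  | succ k ih =>
    rw [← Finset.sum_Ico_consecutive _ Nat.one_le_two_pow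
      (Nat.pow_le_pow_right (by norm_num) k.le_succ), Finset.sum_range_succ, add_mul]
    refine (hardyNorm_add_le hq _ _).trans (add_le_add ih ?_)
    calc _ ≤ ∑ m ∈ Finset.Ico (2 ^ k) (2 ^ (k + 1)), (l m - l (m + 1)) * (β k * A) := by
          refine (hardyNorm_sum_le hq _ _).trans (Finset.sum_le_sum fun m hm => ?_)
          rw [Finset.mem_Ico] at hm
          have hd : 0 ≤ l m - l (m + 1) := sub_nonneg.2 (hl m.le_succ)
          rw [hardyNorm_smul hq0, Complex.norm_real, Real.norm_of_nonneg hd]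
          exact mul_le_mul_of_nonneg_left
            (hβ k m (Nat.one_le_two_pow.trans hm.1) hm.2.le) hd
      _ = (l (2 ^ k) - l (2 ^ (k + 1))) * (β k * A) := by
          rw [← Finset.sum_mul]
          congr 1
          have := Finset.sum_Ico_sub l (Nat.pow_le_pow_right (n := 2) (by norm_num) k.le_succ)
          rw [← neg_inj, ← Finset.sum_neg_distrib]
          simpa using this
      _ ≤ l (2 ^ k) * (β k * A) := by
          have := hl0 (2 ^ (k + 1))
          have := mul_nonneg (hβ0 k) hA
          gcongr
          linarith
      _ = _ := by ring

/-- Summation by parts for a Dirichlet polynomial. -/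
theorem coeffMul_eq_sum_filter (l : ℕ → ℝ) {a : ℕ+ →₀ ℂ} {M : ℕ} (hM : ∀ n ∈ a.support, (n : ℕ) < M) :
    coeffMul (fun n => (l n : ℂ)) a
      = ∑ m ∈ Finset.Ico 1 M, ((l m - l (m + 1) : ℝ) : ℂ) • (a.filter fun n : ℕ+ => (n : ℕ) ≤ m)
        + (l M : ℂ) • a := by
  ext n
  rw [coeffMul_apply, Finsupp.add_apply, Finsupp.finsetSum_apply, Finsupp.smul_apply]
  by_cases hn : a n = 0
  · simp [Finsupp.filter_apply, hn]
  have hnM := hM n (Finsupp.mem_support_iff.2 hn)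
  rw [← Finset.sum_Ico_consecutive _ (show 1 ≤ (n : ℕ) from n.pos) hnM.le,
    Finset.sum_eq_zero, zero_add]
  · have h1 : ∀ m ∈ Finset.Ico (n : ℕ) M,
        (((l m - l (m + 1) : ℝ) : ℂ) • (a.filter fun n : ℕ+ => (n : ℕ) ≤ m)) n
          = ((l m - l (m + 1) : ℝ) : ℂ) * a n := by
      intro m hm
      rw [Finsupp.smul_apply, Finsupp.filter_apply, if_pos (Finset.mem_Ico.1 hm).1, smul_eq_mul]
    rw [Finset.sum_congr rfl h1, ← Finset.sum_mul, smul_eq_mul, ← add_mul, ← Complex.ofReal_sum,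
      ← Complex.ofReal_add]
    congr 2
    have h2 := Finset.sum_Ico_sub l hnM.le
    have h3 : ∑ m ∈ Finset.Ico (n : ℕ) M, (l m - l (m + 1))
        = -∑ m ∈ Finset.Ico (n : ℕ) M, (l (m + 1) - l m) := by
      rw [← Finset.sum_neg_distrib]
      simp
    rw [h3, h2]
    ring
  · intro m hm
    rw [Finsupp.smul_apply, Finsupp.filter_apply, if_neg (not_le.2 (Finset.mem_Ico.1 hm).2),
      smul_zero]

theorem hardyNorm_coeffMul_le_of_dyadic {q : ℝ} (hq : 1 ≤ q) {l β : ℕ → ℝ}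
    (hl0 : ∀ n, 0 ≤ l n) (hl : Antitone l) (hβ0 : ∀ j, 0 ≤ β j) {C : ℝ}
    (hC : ∀ k, ∑ j ∈ Finset.range k, β j * l (2 ^ j) ≤ C) {a : ℕ+ →₀ ℂ} {A : ℝ} (hA : 0 ≤ A)
    (hβ : ∀ j m, 1 ≤ m → m ≤ 2 ^ (j + 1) →
      hardyNorm q (a.filter fun n => (n : ℕ) ≤ m) ≤ β j * A) :
    hardyNorm q (coeffMul (fun n => (l n : ℂ)) a) ≤ C * A := by
  have hq0 : 0 < q := by linarith
  obtain ⟨k, hk⟩ : ∃ k : ℕ, ∀ n ∈ a.support, (n : ℕ) < 2 ^ k := by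
    refine ⟨a.support.sup fun n => (n : ℕ), fun n hn => lt_of_le_of_lt ?_ Nat.lt_two_pow_self⟩
    exact Finset.le_sup (f := fun n : ℕ+ => (n : ℕ)) hn
  have hfil : (a.filter fun n : ℕ+ => (n : ℕ) ≤ 2 ^ k) = a :=
    Finsupp.filter_eq_self_iff _ _ |>.2 fun n hn => (hk n (Finsupp.mem_support_iff.2 hn)).le
  rw [coeffMul_eq_sum_filter l hk]
  refine (hardyNorm_add_le hq _ _).trans ?_
  have h1 := hardyNorm_sum_Ico_sub_smul_filter_le hq hl0 hl hβ0 hA hβ k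
  -- The boundary term is bounded by the next term of the dyadic sum, since `a` is its own partial
  -- sum at `2 ^ k`.
  have h2 : hardyNorm q ((l (2 ^ k) : ℂ) • a) ≤ β k * l (2 ^ k) * A := by
    rw [hardyNorm_smul hq0, Complex.norm_real, Real.norm_of_nonneg (hl0 _), mul_comm (β k),
      mul_assoc]
    refine mul_le_mul_of_nonneg_left ?_ (hl0 _)
    have := hβ k (2 ^ k) Nat.one_le_two_pow (Nat.pow_le_pow_right (by norm_num) k.le_succ)
    rwa [hfil] at this
  have h3 := mul_le_mul_of_nonneg_right (hC (k + 1)) hA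
  rw [Finset.sum_range_succ, add_mul] at h3
  linarith

/-- Cauchy condensation with weights that are only controlled from below on dyadic blocks. -/
theorem exists_sum_dyadic_le {l β g : ℕ → ℝ} (hl0 : ∀ n, 0 ≤ l n) (hl : Antitone l)
    (hβ0 : ∀ j, 0 ≤ β j) {i₀ : ℕ}
    (hβ : ∀ i, i₀ ≤ i → ∀ n ∈ Finset.Ioc (2 ^ i) (2 ^ (i + 1)), β (i + 1) ≤ g n)
    {f : ℕ → ℝ} (hf0 : ∀ n, 0 ≤ f n) (hf : Summable f)
    (hfg : ∀ n, 2 ^ i₀ < n → f n = l n * g n / n) :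
    ∃ C, ∀ k, ∑ j ∈ Finset.range k, β j * l (2 ^ j) ≤ C := by
  have hblock : ∀ i, i₀ ≤ i → β (i + 1) * l (2 ^ (i + 1))
      ≤ 2 * ∑ n ∈ Finset.Ioc (2 ^ i) (2 ^ (i + 1)), f n := by
    intro i hi
    have h1 : ∀ n ∈ Finset.Ioc (2 ^ i) (2 ^ (i + 1)),
        β (i + 1) * l (2 ^ (i + 1)) / 2 ^ (i + 1) ≤ f n := by
      intro n hn
      have hb := hβ i hi n hn
      rw [Finset.mem_Ioc] at hn
      have hn0 : 0 < n := lt_of_le_of_lt (Nat.zero_le _) hn.1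
      rw [hfg n (lt_of_le_of_lt (Nat.pow_le_pow_right (by norm_num) hi) hn.1), mul_comm (l n)]
      have h2 := hβ0 (i + 1)
      have h3 := hl hn.2
      have h4 : (n : ℝ) ≤ 2 ^ (i + 1) := by exact_mod_cast hn.2
      have h5 := hl0 (2 ^ (i + 1))
      have h6 : (0 : ℝ) < n := by exact_mod_cast hn0
      exact div_le_div₀ (mul_nonneg (h2.trans hb) (hl0 n))
        (mul_le_mul hb h3 h5 (h2.trans hb)) h6 h4
    -- The block has `2 ^ i` elements, each contributing at least `β l / 2 ^ (i + 1)`: hence the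
    -- factor `2`.
    have h2 := Finset.card_nsmul_le_sum _ _ _ h1
    rw [Nat.card_Ioc, nsmul_eq_mul, pow_succ, mul_two, Nat.add_sub_cancel, ← mul_two,
      ← pow_succ] at h2
    push_cast at h2
    have h3 : (2 : ℝ) ^ i * (β (i + 1) * l (2 ^ (i + 1)) / 2 ^ (i + 1))
        = β (i + 1) * l (2 ^ (i + 1)) / 2 := by
      rw [pow_succ (2 : ℝ)]
      field_simp
    rw [h3] at h2
    linarith
  have hsum : ∀ k, ∑ j ∈ Finset.range (i₀ + 1 + k), β j * l (2 ^ j)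
      ≤ ∑ j ∈ Finset.range (i₀ + 1), β j * l (2 ^ j)
        + 2 * ∑ n ∈ Finset.Ioc 0 (2 ^ (i₀ + k)), f n := by
    intro k
    induction k with
    | zero =>
      have := Finset.sum_nonneg fun n (_ : n ∈ Finset.Ioc 0 (2 ^ (i₀ + 0))) => hf0 n
      simp only [add_zero] at this ⊢
      linarith
    | succ k ih =>
      rw [← add_assoc, Finset.sum_range_succ, ← add_assoc,
        ← Finset.sum_Ioc_consecutive _ (Nat.zero_le (2 ^ (i₀ + k)))
          (Nat.pow_le_pow_right (by norm_num) (Nat.le_succ _))]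
      have := hblock (i₀ + k) (Nat.le_add_right _ _)
      rw [show i₀ + 1 + k = i₀ + k + 1 by ring] at ih ⊢
      linarith
  refine ⟨∑ j ∈ Finset.range (i₀ + 1), β j * l (2 ^ j) + 2 * ∑' n, f n, fun k => ?_⟩
  refine (Finset.sum_le_sum_of_subset_of_nonneg
    (Finset.range_mono (Nat.le_add_left k (i₀ + 1))) fun j _ _ =>
      mul_nonneg (hβ0 j) (hl0 _)).trans ((hsum k).trans ?_)
  have := hf.sum_le_tsum (Finset.Ioc 0 (2 ^ (i₀ + k))) fun n _ => hf0 n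
  linarith

theorem exists_hardyNorm_coeffMul_le {p q : ℝ} (hp : 1 ≤ p) (hpq : p ≤ q) {l : ℕ → ℝ}
    (hl0 : ∀ n, 0 ≤ l n) (hl : Antitone l) {ε : ℝ} (hε : 0 < ε)
    (hsum : Summable fun n : ℕ => if 3 ≤ n then l n / ((n : ℝ) * Real.log (Real.log n)) *
      (√(q / p) + ε) ^ (Real.log n / Real.log (Real.log n)) else 0) :
    ∃ C, ∀ a, hardyNorm q (coeffMul (fun n => (l n : ℂ)) a) ≤ C * hardyNorm p a := by
  have hp0 : 0 < p := by linarith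
  have hc : 1 ≤ √(q / p) := Real.one_le_sqrt.2 ((one_le_div hp0).2 hpq)
  set K := √(q / p) + ε with hK
  have hK0 : 0 < K := by linarith
  set g : ℕ → ℝ := fun n => K ^ (Real.log n / Real.log (Real.log n)) / Real.log (Real.log n) with hg
  obtain ⟨n₀, hn₀, hbound⟩ := exists_partialSum_bound_le hc (show √(q / p) < K by linarith)
  have hloglog : ∀ n : ℕ, 3 ≤ n → 0 < Real.log (Real.log n) := by
    intro n hn
    have hn' : (3 : ℝ) ≤ n := by exact_mod_cast hn
    refine Real.log_pos ((Real.lt_log_iff_exp_lt (by linarith)).2 ?_)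
    have := Real.exp_one_lt_d9
    linarith
  -- For the finitely many small blocks any finite bound will do; `Y = 2` is used.
  have hsmall : ∀ j : ℕ, ∃ b : ℝ, 0 ≤ b ∧ (∀ m, 1 ≤ m → m ≤ 2 ^ (j + 1) → ∀ a,
      hardyNorm q (a.filter fun n => (n : ℕ) ≤ m) ≤ b * hardyNorm p a) := by
    intro j
    have hlog : 0 ≤ Real.log (((2 ^ (j + 1) : ℕ) : ℝ) + 1) := by
      exact_mod_cast Real.log_natCast_nonneg (2 ^ (j + 1) + 1)
    refine ⟨_, ?_, fun m hm hmj a =>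
      (hardyNorm_partialSum_le' hp hpq hm hmj le_rfl a).trans_eq (mul_assoc _ _ _).symm⟩
    positivity
  have hlarge : ∀ i : ℕ, n₀ ≤ i → ∃ b : ℝ, 0 ≤ b ∧ (∀ m, 1 ≤ m → m ≤ 2 ^ (i + 1 + 1) → ∀ a,
      hardyNorm q (a.filter fun n => (n : ℕ) ≤ m) ≤ b * hardyNorm p a) ∧
      ∀ n ∈ Finset.Ioc (2 ^ i) (2 ^ (i + 1)), b ≤ g n := by
    intro i hi
    -- Monotonicity of `g` is avoided by taking its minimum over the block as the bound. Any `n > 2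
    -- ^ i` satisfies `2 ^ (i + 2) ≤ 4 n`, which is why the partial sum bound was stated up to `4
    -- n`.
    obtain ⟨n, hn, hmin⟩ := Finset.exists_min_image (Finset.Ioc (2 ^ i) (2 ^ (i + 1))) g
      ⟨2 ^ (i + 1), Finset.mem_Ioc.2 ⟨Nat.pow_lt_pow_right (by norm_num) i.lt_succ_self, le_rfl⟩⟩
    rw [Finset.mem_Ioc] at hn
    have hin : n₀ ≤ n := (hi.trans Nat.lt_two_pow_self.le).trans hn.1.le
    obtain ⟨Y, hY, hb⟩ := hbound n hin
    refine ⟨g n, ?_, fun m hm hmi a => ?_, hmin⟩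
    · have := hloglog n (hn₀.trans hin)
      rw [hg]
      positivity
    · have hmn : m ≤ 4 * n := by
        rw [pow_succ, pow_succ] at hmi
        omega
      refine ((hardyNorm_partialSum_le' hp hpq hm hmn hY a).trans_eq (mul_assoc _ _ _).symm).trans ?_
      exact mul_le_mul_of_nonneg_right hb (hardyNorm_nonneg hp0 a)
  have hall : ∀ j : ℕ, ∃ b : ℝ, 0 ≤ b ∧ (∀ m, 1 ≤ m → m ≤ 2 ^ (j + 1) → ∀ a,
      hardyNorm q (a.filter fun n => (n : ℕ) ≤ m) ≤ b * hardyNorm p a) ∧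
      (n₀ + 1 ≤ j → ∀ n ∈ Finset.Ioc (2 ^ (j - 1)) (2 ^ j), b ≤ g n) := by
    intro j
    by_cases hj : n₀ + 1 ≤ j
    · obtain ⟨i, rfl⟩ : ∃ i, j = i + 1 := ⟨j - 1, by omega⟩
      obtain ⟨b, h1, h2, h3⟩ := hlarge i (by omega)
      exact ⟨b, h1, h2, fun _ => h3⟩
    · obtain ⟨b, h1, h2⟩ := hsmall j
      exact ⟨b, h1, h2, fun h => absurd h hj⟩
  choose β hβ0 hβ hβg using hall
  have hdyadic : ∃ C, ∀ k, ∑ j ∈ Finset.range k, β j * l (2 ^ j) ≤ C := by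
    refine exists_sum_dyadic_le hl0 hl hβ0 (i₀ := n₀)
      (fun i hi n hn => hβg (i + 1) (by omega) n hn) (fun n => ?_) hsum (fun n hn => ?_)
    · split_ifs with hn
      · have := hloglog n hn
        have := hl0 n
        positivity
      · exact le_rfl
    · have h3 : 3 ≤ n := (hn₀.trans Nat.lt_two_pow_self.le).trans hn.le
      have h4 := hloglog n h3
      rw [if_pos h3, hg]
      field_simp
  obtain ⟨C, hC⟩ := hdyadic
  exact ⟨C, fun a => hardyNorm_coeffMul_le_of_dyadic (hp.trans hpq) hl0 hl hβ0 hC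
    (hardyNorm_nonneg hp0 a) fun j m hm hmj => hβ j m hm hmj a⟩

theorem coeffMul_sub (m : ℕ+ → ℂ) (a b : ℕ+ →₀ ℂ) :
    coeffMul m (a - b) = coeffMul m a - coeffMul m b := by
  ext n
  simp [mul_sub]

/-- The norm inequality on Dirichlet polynomials passes to the completion: coefficientwise
multiplication is linear, so it maps Cauchy sequences to Cauchy sequences, and it respects
convergence of each coefficient. -/
theorem mainTheorem4 (p q : ℝ) (hp : 1 ≤ p) (hpq : p < q)
    (lam : ℕ+ → ℝ) (hpos : ∀ n, 0 < lam n) (hanti : Antitone lam)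
    (hsum : ∃ ε : ℝ, 0 < ε ∧ Summable fun n : {n : ℕ+ // 3 ≤ n} =>
      lam n.1 / ((n.1 : ℝ) * Real.log (Real.log (n.1 : ℝ))) *
        (√(q / p) + ε) ^ (Real.log (n.1 : ℝ) / Real.log (Real.log (n.1 : ℝ)))) :
    IsHardyMultiplier p q lam := by
  obtain ⟨ε, hε, hs⟩ := hsum
  -- `Nat.toPNat'` sends `0` to `1`, so the extension to `ℕ` stays decreasing.
  set l : ℕ → ℝ := fun n => lam n.toPNat' with hl
  have hlam : ∀ n : ℕ+, l n = lam n := fun n => by rw [hl]; simp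
  have hlanti : Antitone l := by
    refine fun m n hmn => hanti ?_
    rw [← PNat.coe_le_coe, Nat.toPNat'_coe, Nat.toPNat'_coe]
    split_ifs <;> omega
  set ι : {n : ℕ+ // 3 ≤ n} → ℕ := fun n => (n.1 : ℕ) with hι
  have hιinj : Function.Injective ι := PNat.coe_injective.comp Subtype.coe_injective
  obtain ⟨C, hC⟩ := exists_hardyNorm_coeffMul_le hp hpq.le (fun n => (hpos _).le) hlanti hε (by
    rw [← hιinj.summable_iff]
    · refine hs.congr fun n => ?_
      have h3 : 3 ≤ ι n := n.2
      simp only [Function.comp_apply, if_pos h3]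
      rw [← hlam n.1]
    · intro n hn
      refine if_neg fun h3 => hn ⟨⟨⟨n, by omega⟩, h3⟩, rfl⟩)
  have hfun : (fun n : ℕ+ => (l n : ℂ)) = fun n => (lam n : ℂ) := funext fun n => by rw [hlam]
  replace hC : ∀ a, hardyNorm q (coeffMul (fun n => (lam n : ℂ)) a) ≤ C * hardyNorm p a := by
    intro a
    rw [← hfun]
    exact hC a
  rintro a ⟨P, hP, ha⟩
  refine ⟨fun k => coeffMul (fun n => (lam n : ℂ)) (P k), fun δ hδ => ?_, fun n => ?_⟩
  · obtain ⟨N, hN⟩ := hP (δ / (|C| + 1)) (by positivity)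
    refine ⟨N, fun k hk m hm => ?_⟩
    have h1 := hN k hk m hm
    rw [lt_div_iff₀ (by positivity)] at h1
    have h0 := hardyNorm_nonneg (show 0 < p by linarith) (P k - P m)
    rw [← coeffMul_sub]
    refine (hC _).trans_lt (lt_of_le_of_lt ?_ h1)
    rw [mul_comm]
    exact mul_le_mul_of_nonneg_left (by linarith [le_abs_self C]) h0
  · simpa using (ha n).const_mul _
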